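/- Notation. For $\nu,x\in\mathbb R$, $z\in\mathbb C$ let $F\left(\begin{matrix}p,q\\ r\end{matrix};x\right)={}_2F_1(p,q;r;x)=\sum_{k\ge0}\frac{(p)_k(q)_k}{(r)_k\,k!}x^k$ ($|x|<1$) and $M(a,c;z)=\sum_{k\ge0}\frac{(a)_k}{(c)_k\,k!}z^k$. Complex powers are principal values, so $(i\omega+0)^{b-1}=(i\omega)^{b-1}$ for real $\omega\ne0$; $1/\Gamma$ is $0$ at the poles of $\Gamma$. Put $\mathcal F^{-1}[G](y)=\frac1{\sqrt{2\pi}}\int_{-\infty}^\infty e^{-i\omega y}G(\omega)\,d\omega$. For $f:\mathbb R\to\mathbb C$ let $$W^{-\mu}[f](x)=\frac1{\Gamma(\mu)}\int_x^\infty f(y)(y-x)^{\mu-1}dy\quad(\mu>0),\qquad W^0[f]=f,$$ and let the fractional derivative of order $\nu$ be the Weyl derivative $W^\nu[f]=(-1)^nD^n\,W^{\nu-n}[f]$, where $n$ is a positive integer with $n>\nu$. **(i)** Let $a,b,c\in\mathbb R$ with $0<b<\min(a,c-a)$. Then $\omega\mapsto(i\omega+0)^{b-1}M(a,c;i\omega)$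 is absolutely integrable on $\mathbb R$ and $$\mathcal F^{-1}\big[(i\omega+0)^{b-1}M(a,c;i\omega)\big](y)=\begin{cases}0,&y>1,\\[2pt] \sqrt{2\pi}\,\dfrac{\Gamma(c)}{\Gamma(a)\Gamma(1-a-b+c)}\,y^{a-b}(1-y)^{c-a-b}F\left(\begin{matrix}1-b,\,c-b\\ c+1-a-b\end{matrix};1-y\right),&0<y<1,\\[6pt] \dfrac{\sqrt{2\pi}}{\Gamma(1-b)}\,\dfrac1{(1-y)^b}\,F\left(\begin{matrix}b,\,c-a\\ c\end{matrix};\dfrac1{1-y}\right),&y<0.\end{cases}$$ **(ii)** For $a,c,\nu,x\in\mathbb R$ and $\delta>0$ put $$A^{\nu}_{\delta,a,c}[f](x)=\frac1{\Gamma(-\nu)}\frac1{\delta^\nu}\int_1^\infty\frac1{(1+y)^{\nu+1}}F\left(\begin{matrix}\nu+1,\,c-a\\ c\end{matrix};\frac2{1+y}\right)f(x+\delta y)\,dy$$ $$\qquad+\frac{\Gamma(c)}{2^{c-\nu-1}\Gamma(a)\Gamma(c-a-\nu)}\frac1{\delta^\nu}\int_{-1}^1(1-y)^{a-\nu-1}(1+y)^{c-a-\nu-1}F\left(\begin{matrix}-\nu,\,c-\nu-1\\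 c-a-\nu\end{matrix};\frac{1+y}2\right)f(x+\delta y)\,dy.$$ Let $0<\nu<\min(a,c-a)-1$, let $n>\nu$ be an integer, and let $f:\mathbb R\to\mathbb C$ be $n$ times continuously differentiable with $f(t)=O(t^{\nu-n-\varepsilon})$ as $t\to+\infty$ for some $\varepsilon>0$. Then the integral defining $W^{\nu-n}[f](x)$ converges absolutely for every $x$, $W^{\nu-n}[f]$ is $n$ times continuously differentiable, both integrals in $A^{\nu}_{\delta,a,c}[f](x)$ converge absolutely for all $x$ and all $\delta>0$, and for every $x\in\mathbb R$ $$W^\nu[f](x)=\lim_{\delta\downarrow0}A^{\nu}_{\delta,a,c}[f](x).$$ **(iii)** For $\alpha,\beta>-1$ and an integer $n\ge1$ let $P_n^{(\alpha,\beta)}(\xi)=\sum_{s=0}^n\binom{n+\alpha}{n-s}\binom{n+\beta}{s}\big(\tfrac{\xi-1}2\big)^s\big(\tfrac{\xi+1}2\big)^{n-s}$ be the Jacobi polynomial, $k_n$ its coefficient of $\xi^n$, $w(\xi)=(1-\xi)^\alpha(1+\xi)^\beta$, $h_n=\int_{-1}^1P_n^{(\alpha,\beta)}(\xi)^2w(\xi)\,d\xi$,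 and define the approximate fractional Jacobi derivative by $$W^{\nu,n}_{\delta,\alpha,\beta}[f](x)=(-1)^n\,\frac{k_n\,n!}{h_n}\,\frac1{\delta^n}\int_{-1}^1W^{\nu-n}[f](x+\delta\xi)\,P_n^{(\alpha,\beta)}(\xi)\,w(\xi)\,d\xi .$$ Let $0<\nu\le n$, $\nu<n+\min(\alpha,\beta)$, and let $f:\mathbb R\to\mathbb C$ be continuous with $f(t)=O(t^{\nu-n-\varepsilon})$ as $t\to+\infty$ for some $\varepsilon>0$. Then for all $x\in\mathbb R$, $\delta>0$ the integral over $\xi$ above and both integrals below converge absolutely, and the expression $A^\nu_{\delta,a,c}[f](x)$ with $a=n+\alpha+1$, $c=2n+\alpha+\beta+2$ is the approximate fractional Jacobi derivative: $$A^{\nu}_{\delta,\,n+\alpha+1,\,2n+\alpha+\beta+2}[f](x)=W^{\nu,n}_{\delta,\alpha,\beta}[f](x)=\frac1{\Gamma(-\nu)}\frac1{\delta^\nu}\int_1^\infty\frac{f(x+\delta y)}{(y+1)^{\nu+1}}F\left(\begin{matrix}\nu+1,\,n+\beta+1\\ 2n+\alpha+\beta+2\end{matrix};\frac2{y+1}\right)dy$$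 $$\qquad+\frac{\Gamma(2n+\alpha+\beta+2)}{2^{2n-\nu+\alpha+\beta+1}\Gamma(n+\alpha+1)\Gamma(n-\nu+\beta+1)}\frac1{\delta^\nu}\int_{-1}^1f(x+\delta y)(1-y)^{n+\alpha-\nu}(1+y)^{n+\beta-\nu}F\left(\begin{matrix}-\nu,\,2n-\nu+\alpha+\beta+1\\ n-\nu+\beta+1\end{matrix};\frac{1+y}2\right)dy .$$ -/

import Mathlib

open Filter Topology MeasureTheory Asymptotics
open scoped Nat

/-- Kummer's confluent hypergeometric function
`M(a, c; z) = ∑ₖ (a)ₖ / (c)ₖ * zᵏ / k!`, for real parameters and a complex argument. -/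
noncomputable def kummerM (a c : ℝ) (z : ℂ) : ℂ :=
  ∑' k : ℕ, (((ascPochhammer ℝ k).eval a / (ascPochhammer ℝ k).eval c : ℝ) : ℂ) * z ^ k / (k ! : ℂ)

/-- The inverse of the unitary Fourier transform `F(ω) = (2π)^(-1/2) ∫ e^(iωx) f(x) dx`, namely
`(2π)^(-1/2) ∫ e^(-iωy) G(ω) dω`. -/
noncomputable def inverseFourier (G : ℝ → ℂ) (y : ℝ) : ℂ :=
  ((1 / √(2 * Real.pi) : ℝ) : ℂ) * ∫ ω : ℝ, G ω * Complex.exp (-(Complex.I * ω * y))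

/-- The function `ω ↦ (iω + 0)^(b-1) M(a, c; iω)`. For `ω ≠ 0` the number `iω` is off the cut
`(-∞, 0]`, so that `(iω + 0)^(b-1)` is the principal power of `iω`. -/
noncomputable def kummerTransfer (a b c ω : ℝ) : ℂ :=
  (Complex.I * ω) ^ ((b - 1 : ℝ) : ℂ) * kummerM a c (Complex.I * ω)

/-- The Weyl fractional integral `W^(-μ)[f](x) = Γ(μ)⁻¹ ∫ₓ^∞ f(y) (y - x)^(μ-1) dy` for `μ > 0`,
with `W⁰ = id`. -/
noncomputable def weylIntegral (μ : ℝ) (f : ℝ → ℂ) (x : ℝ) : ℂ :=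
  if μ = 0 then f x
  else ((1 / Real.Gamma μ : ℝ) : ℂ) * ∫ y in Set.Ioi x, f y * (((y - x) ^ (μ - 1) : ℝ) : ℂ)

/-- The Weyl fractional derivative `W^ν[f] = (-1)ⁿ Dⁿ [W^(ν-n)[f]]`, where `ν < n`. -/
noncomputable def weylDeriv (n : ℕ) (ν : ℝ) (f : ℝ → ℂ) (x : ℝ) : ℂ :=
  (-1) ^ n * iteratedDeriv n (weylIntegral (n - ν) f) x

/-- The kernel on `y > 1` of the approximate fractional derivative (without constants). -/
noncomputable def outerKernel (a c ν y : ℝ) : ℝ :=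
  1 / (1 + y) ^ (ν + 1) * ₂F₁ (ν + 1) (c - a) c (2 / (1 + y))

/-- The kernel on `-1 < y < 1` of the approximate fractional derivative (without constants). -/
noncomputable def innerKernel (a c ν y : ℝ) : ℝ :=
  (1 - y) ^ (a - ν - 1) * (1 + y) ^ (c - a - ν - 1) *
    ₂F₁ (-ν) (c - ν - 1) (c - a - ν) ((1 + y) / 2)

/-- The approximate fractional derivative of order `ν` with parameters `a`, `c` and width `δ`.
Since `Real.Gamma` is `0` at its poles, `1 / Γ(-ν)` is `0` for `ν = 0, 1, 2, …`, as usual. -/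
noncomputable def approxDeriv (a c ν δ : ℝ) (f : ℝ → ℂ) (x : ℝ) : ℂ :=
  ((1 / Real.Gamma (-ν) * (1 / δ ^ ν) : ℝ) : ℂ) *
      (∫ y in Set.Ioi (1 : ℝ), (outerKernel a c ν y : ℂ) * f (x + δ * y)) +
    ((Real.Gamma c / (2 ^ (c - ν - 1) * Real.Gamma a * Real.Gamma (c - a - ν)) *
      (1 / δ ^ ν) : ℝ) : ℂ) *
      ∫ y in Set.Ioo (-1 : ℝ) 1, (innerKernel a c ν y : ℂ) * f (x + δ * y)

/-- The Jacobi polynomial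
`P_n^(α,β) = ∑ₛ binom(n+α, n-s) binom(n+β, s) ((X-1)/2)^s ((X+1)/2)^(n-s)`. -/
noncomputable def jacobiPoly (n : ℕ) (α β : ℝ) : Polynomial ℝ :=
  ∑ s ∈ Finset.range (n + 1),
    Polynomial.C (Ring.choose (n + α) (n - s) * Ring.choose (n + β) s) *
      (Polynomial.C (1 / 2) * (Polynomial.X - 1)) ^ s *
      (Polynomial.C (1 / 2) * (Polynomial.X + 1)) ^ (n - s)

/-- The Jacobi measure `(1 - ξ)^α (1 + ξ)^β dξ` on `(-1, 1)`. -/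
noncomputable def jacobiMeasure (α β : ℝ) : Measure ℝ :=
  (volume.restrict (Set.Ioo (-1 : ℝ) 1)).withDensity
    fun ξ => ENNReal.ofReal ((1 - ξ) ^ α * (1 + ξ) ^ β)

/-- The approximate orthogonal derivative of order `n` attached to a polynomial `p` of degree `n`
that is orthogonal with respect to `μ`: it is
`(kₙ n! / hₙ) δ⁻ⁿ ∫ f(x + δξ) p(ξ) dμ(ξ)`, where `kₙ` is the coefficient of `ξⁿ` in `p` and
`hₙ = ∫ p² dμ`. -/
noncomputable def orthogonalDeriv (n : ℕ) (p : Polynomial ℝ) (μ : Measure ℝ) (δ : ℝ)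
    (f : ℝ → ℂ) (x : ℝ) : ℂ :=
  ((p.coeff n * (n ! : ℝ) / (∫ ξ, p.eval ξ ^ 2 ∂μ) * (1 / δ ^ n) : ℝ) : ℂ) *
    ∫ ξ, f (x + δ * ξ) * ((p.eval ξ : ℝ) : ℂ) ∂μ

/-- The approximate fractional Jacobi derivative `(-1)ⁿ D_δⁿ [W^(ν-n)[f]](x)`, where `D_δⁿ` is the
approximate orthogonal derivative attached to `P_n^(α,β)`. -/
noncomputable def jacobiFracDeriv (n : ℕ) (α β ν δ : ℝ) (f : ℝ → ℂ) (x : ℝ) : ℂ :=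
  (-1) ^ n * orthogonalDeriv n (jacobiPoly n α β) (jacobiMeasure α β) δ (weylIntegral (n - ν) f) x

open ProbabilityTheory (beta beta_pos)

/-- The rising factorial `(a)ₖ`. -/
noncomputable abbrev rising (a : ℝ) (k : ℕ) : ℝ := (ascPochhammer ℝ k).eval a

theorem rising_zero (a : ℝ) : rising a 0 = 1 := by simp [rising]

theorem rising_succ (a : ℝ) (k : ℕ) : rising a (k + 1) = rising a k * (a + k) :=
  ascPochhammer_succ_eval k a

theorem rising_succ_left (a : ℝ) (k : ℕ) : rising a (k + 1) = a * rising (a + 1) k := by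
  induction k with
  | zero => simp [rising]
  | succ k ih => rw [rising_succ, ih, rising_succ]; push_cast; ring

theorem rising_pos {a : ℝ} (ha : 0 < a) (k : ℕ) : 0 < rising a k := ascPochhammer_pos k a ha

theorem Gamma_add_nat {a : ℝ} (ha : 0 < a) (k : ℕ) :
    Real.Gamma (a + k) = rising a k * Real.Gamma a := by
  induction k with
  | zero => simp [rising]
  | succ k ih =>
    rw [rising_succ, mul_right_comm, ← ih, Nat.cast_succ, ← add_assoc,
      Real.Gamma_add_one (by positivity), mul_comm]

/-- The coefficient of `xᵏ` in `₂F₁ a b c x`. -/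
noncomputable abbrev hypCoeff (a b c : ℝ) (k : ℕ) : ℝ :=
  rising a k * rising b k / (rising c k * k !)

theorem one_le_ordinaryHypergeometricSeries_radius (a b c : ℝ) :
    1 ≤ (ordinaryHypergeometricSeries ℝ a b c).radius := by
  by_cases h : ∀ k : ℕ, ↑k ≠ -a ∧ ↑k ≠ -b ∧ ↑k ≠ -c
  · exact (ordinaryHypergeometricSeries_radius_eq_one ℝ a b c h).ge
  · simp only [not_forall] at h
    obtain ⟨k, hk⟩ := h
    by_cases h1 : (k : ℝ) = -a
    · obtain rfl : a = -(k : ℝ) := by linarith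
      rw [ordinaryHypergeometric_radius_top_of_neg_nat₁]; exact le_top
    by_cases h2 : (k : ℝ) = -b
    · obtain rfl : b = -(k : ℝ) := by linarith
      rw [ordinaryHypergeometric_radius_top_of_neg_nat₂]; exact le_top
    by_cases h3 : (k : ℝ) = -c
    · obtain rfl : c = -(k : ℝ) := by linarith
      rw [ordinaryHypergeometric_radius_top_of_neg_nat₃]; exact le_top
    exact absurd ⟨h1, h2, h3⟩ hk

theorem hypCoeff_mul_pow (a b c x : ℝ) (k : ℕ) :
    ordinaryHypergeometricSeries ℝ a b c k (fun _ => x) = hypCoeff a b c k * x ^ k := by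
  rw [ordinaryHypergeometricSeries_apply_eq, smul_eq_mul, hypCoeff, div_eq_mul_inv, mul_inv]
  ring

theorem mem_eball_of_abs_lt_one {x : ℝ} (hx : |x| < 1) {r : ENNReal} (hr : 1 ≤ r) :
    x ∈ Metric.eball (0 : ℝ) r := by
  refine Metric.eball_subset_eball hr ?_
  rw [mem_eball_zero_iff, ← ofReal_norm, Real.norm_eq_abs]
  exact ENNReal.ofReal_lt_one.2 hx

theorem summable_norm_hypCoeff (a b c : ℝ) {x : ℝ} (hx : |x| < 1) :
    Summable fun k => ‖hypCoeff a b c k * x ^ k‖ := by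
  simpa only [hypCoeff_mul_pow] using FormalMultilinearSeries.summable_norm_apply _
    (mem_eball_of_abs_lt_one hx (one_le_ordinaryHypergeometricSeries_radius a b c))

theorem hasSum_hyp (a b c : ℝ) {x : ℝ} (hx : |x| < 1) :
    HasSum (fun k => hypCoeff a b c k * x ^ k) (₂F₁ a b c x) := by
  simp only [← hypCoeff_mul_pow]
  exact FormalMultilinearSeries.hasSum _
    (mem_eball_of_abs_lt_one hx (one_le_ordinaryHypergeometricSeries_radius a b c))

theorem continuousOn_hyp (a b c : ℝ) : ContinuousOn (₂F₁ a b c : ℝ → ℝ) (Set.Ioo (-1) 1) := by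
  have h := (ordinaryHypergeometricSeries ℝ a b c).hasFPowerSeriesOnBall
    (zero_lt_one.trans_le (one_le_ordinaryHypergeometricSeries_radius a b c))
  refine h.continuousOn.mono fun x hx => ?_
  exact mem_eball_of_abs_lt_one (abs_lt.2 hx) (one_le_ordinaryHypergeometricSeries_radius a b c)

theorem hyp_symm (a b c x : ℝ) : ₂F₁ a b c x = ₂F₁ b a c x := by
  unfold ordinaryHypergeometric
  rw [ordinaryHypergeometricSeries_symm]

theorem choose_add_sub_one (s : ℝ) (k : ℕ) :
    Ring.choose (s + k - 1) k = rising s k / k ! := by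
  rw [← Ring.multichoose_eq, eq_div_iff (by positivity), mul_comm, ← nsmul_eq_mul,
    Ring.factorial_nsmul_multichoose_eq_ascPochhammer, Polynomial.ascPochhammer_smeval_eq_eval]

theorem hasSum_binomial (s : ℝ) {x : ℝ} (hx : |x| < 1) :
    HasSum (fun k => rising s k / k ! * x ^ k) ((1 - x) ^ (-s)) := by
  have h := (Real.one_div_one_sub_rpow_hasFPowerSeriesOnBall_zero s).hasSum
    (mem_eball_of_abs_lt_one hx le_rfl)
  rw [zero_add, one_div, ← Real.rpow_neg (by linarith [(abs_lt.1 hx).2])] at h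
  simp only [FormalMultilinearSeries.ofScalars_apply_eq, choose_add_sub_one, smul_eq_mul] at h
  exact h

theorem summable_norm_binomial (s : ℝ) {x : ℝ} (hx : |x| < 1) :
    Summable fun k => ‖rising s k / k ! * x ^ k‖ := by
  have h := summable_norm_hypCoeff s 1 1 hx
  refine h.congr fun k => ?_
  congr 2
  rw [hypCoeff]
  have := (rising_pos one_pos k).ne'
  field_simp

/-- The Pfaff–Saalschütz sum. -/
theorem sum_hypCoeff_mul_rising {c : ℝ} (hc : 0 < c) (a b : ℝ) (N : ℕ) :
    ∑ j ∈ Finset.range (N + 1),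
      hypCoeff a b c j * (rising (c - a - b) (N - j) / (N - j)!) =
      hypCoeff (c - a) (c - b) c N := by
  induction N with
  | zero => simp [hypCoeff, rising]
  | succ N ih =>
    set F : ℕ → ℝ := fun j => hypCoeff a b c j * (rising (c - a - b) (N + 1 - j) / (N + 1 - j)!)
      with hF
    set t : ℕ → ℝ := fun j => hypCoeff a b c j * (rising (c - a - b) (N - j) / (N - j)!) with ht
    have hstep : ∀ j ∈ Finset.range (N + 1),
        (N + 1) * (c + N) * F j - (c - a + N) * (c - b + N) * t j =
          -((j + 1 : ℕ) : ℝ) * (c + (j + 1 : ℕ) - 1) * F (j + 1) - -(j : ℝ) * (c + j - 1) * F j := by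
      intro j hj
      obtain ⟨m, rfl⟩ := Nat.exists_eq_add_of_le (Nat.lt_succ_iff.1 (Finset.mem_range.1 hj))
      have h1 : j + m + 1 - j = m + 1 := by omega
      have h2 : j + m - j = m := by omega
      have h3 : j + m + 1 - (j + 1) = m := by omega
      have hc' := (rising_pos hc j).ne'
      have hcj : c + j ≠ 0 := by positivity
      have hm : (m : ℝ) + 1 ≠ 0 := by positivity
      have hj1 : (j : ℝ) + 1 ≠ 0 := by positivity
      have hmf : (m ! : ℝ) ≠ 0 := by positivity
      have hjf : (j ! : ℝ) ≠ 0 := by positivity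
      simp only [hF, ht, h1, h2, h3, hypCoeff, rising_succ, Nat.factorial_succ]
      push_cast
      field_simp
      ring
    have hsum := Finset.sum_congr rfl hstep
    rw [Finset.sum_range_sub (fun j : ℕ => -(j : ℝ) * (c + j - 1) * F j), Finset.sum_sub_distrib,
      ← Finset.mul_sum, ← Finset.mul_sum, ih] at hsum
    rw [Finset.sum_range_succ]
    have hcN : (c + N) ≠ 0 := by positivity
    have hN : (N : ℝ) + 1 ≠ 0 := by positivity
    have hc' := (rising_pos hc N).ne'
    have key : ((N : ℝ) + 1) * (c + N) * (∑ j ∈ Finset.range (N + 1), F j + F (N + 1)) =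
        (c - a + N) * (c - b + N) * hypCoeff (c - a) (c - b) c N := by
      push_cast at hsum
      linear_combination hsum
    apply mul_left_cancel₀ (mul_ne_zero hN hcN)
    rw [key]
    simp only [hypCoeff, rising_succ, Nat.factorial_succ]
    push_cast
    field_simp

/-- Euler's transformation of the hypergeometric function. -/
theorem hyp_euler {c : ℝ} (hc : 0 < c) (a b : ℝ) {x : ℝ} (hx : |x| < 1) :
    ₂F₁ (c - a) (c - b) c x = (1 - x) ^ (a + b - c) * ₂F₁ a b c x := by
  have h1 := summable_norm_hypCoeff a b c hx
  have h2 := summable_norm_binomial (c - a - b) hx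
  have h := tsum_mul_tsum_eq_tsum_sum_range_of_summable_norm h1 h2
  rw [(hasSum_hyp a b c hx).tsum_eq, (hasSum_binomial (c - a - b) hx).tsum_eq] at h
  rw [mul_comm, show a + b - c = -(c - a - b) by ring, h,
    ← (hasSum_hyp (c - a) (c - b) c hx).tsum_eq]
  refine tsum_congr fun N => ?_
  rw [← sum_hypCoeff_mul_rising hc, Finset.sum_mul]
  refine Finset.sum_congr rfl fun j hj => ?_
  rw [← Nat.add_sub_of_le (Nat.lt_succ_iff.1 (Finset.mem_range.1 hj)), pow_add,
    Nat.add_sub_cancel_left]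
  ring

theorem HasSum.of_forall_eq {f g : ℕ → ℝ} {a : ℝ} (hf : HasSum f a) (h : ∀ k, g k = f k) :
    HasSum g a := by
  rwa [funext h]

theorem ofReal_rpow_mul_one_sub {p q t : ℝ} (ht : t ∈ Set.Ioo (0 : ℝ) 1) :
    ((t ^ (p - 1) * (1 - t) ^ (q - 1) : ℝ) : ℂ) =
      (t : ℂ) ^ ((p : ℂ) - 1) * (1 - (t : ℂ)) ^ ((q : ℂ) - 1) := by
  rw [Complex.ofReal_mul, Complex.ofReal_cpow ht.1.le, Complex.ofReal_cpow (by linarith [ht.2])]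
  push_cast
  rfl

theorem integrableOn_beta {p q : ℝ} (hp : 0 < p) (hq : 0 < q) :
    IntegrableOn (fun t : ℝ => t ^ (p - 1) * (1 - t) ^ (q - 1)) (Set.Ioo 0 1) := by
  have h := Complex.betaIntegral_convergent (u := p) (v := q) (by simpa) (by simpa)
  rw [intervalIntegrable_iff_integrableOn_Ioo_of_le zero_le_one] at h
  have h2 : IntegrableOn (fun t : ℝ => ((t ^ (p - 1) * (1 - t) ^ (q - 1) : ℝ) : ℂ))
      (Set.Ioo 0 1) := h.congr_fun (fun t ht => (ofReal_rpow_mul_one_sub ht).symm) measurableSet_Ioo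
  rw [IntegrableOn]
  simpa using h2.re

theorem integral_beta {p q : ℝ} (hp : 0 < p) (hq : 0 < q) :
    ∫ t in Set.Ioo (0 : ℝ) 1, t ^ (p - 1) * (1 - t) ^ (q - 1) = beta p q := by
  have h : ((∫ t in Set.Ioo (0 : ℝ) 1, t ^ (p - 1) * (1 - t) ^ (q - 1) : ℝ) : ℂ) =
      Complex.betaIntegral p q := by
    rw [Complex.betaIntegral, intervalIntegral.integral_of_le zero_le_one,
      integral_Ioc_eq_integral_Ioo, ← integral_complex_ofReal]
    exact setIntegral_congr_fun measurableSet_Ioo fun t ht => ofReal_rpow_mul_one_sub ht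
  rw [ProbabilityTheory.beta_eq_betaIntegralReal p q hp hq, ← h, Complex.ofReal_re]

/-- The `n`-th derivative of `t ↦ t ^ (p - 1) * (1 - t) ^ (q - 1)` on `(0, 1)`. -/
noncomputable def betaD : ℕ → ℝ → ℝ → ℝ → ℝ
  | 0, p, q, t => t ^ (p - 1) * (1 - t) ^ (q - 1)
  | n + 1, p, q, t => (p - 1) * betaD n (p - 1) q t - (q - 1) * betaD n p (q - 1) t

theorem betaD_zero (p q t : ℝ) : betaD 0 p q t = t ^ (p - 1) * (1 - t) ^ (q - 1) := rfl

theorem betaD_succ (n : ℕ) (p q t : ℝ) : betaD (n + 1) p q t =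
    (p - 1) * betaD n (p - 1) q t - (q - 1) * betaD n p (q - 1) t := rfl

theorem measurable_betaD (n : ℕ) (p q : ℝ) : Measurable (betaD n p q) := by
  induction n generalizing p q with
  | zero => simp only [funext (betaD_zero p q)]; fun_prop
  | succ n ih =>
    have h1 := ih (p - 1) q
    have h2 := ih p (q - 1)
    exact (h1.const_mul _).sub (h2.const_mul _)

theorem hasDerivAt_betaD (n : ℕ) (p q : ℝ) {t : ℝ} (ht : t ∈ Set.Ioo (0 : ℝ) 1) :
    HasDerivAt (betaD n p q) (betaD (n + 1) p q t) t := by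
  induction n generalizing p q with
  | zero =>
    have h1 : HasDerivAt (fun t : ℝ => t ^ (p - 1)) ((p - 1) * t ^ (p - 1 - 1)) t :=
      Real.hasDerivAt_rpow_const (Or.inl ht.1.ne')
    have h2 : HasDerivAt (fun t : ℝ => (1 - t) ^ (q - 1)) (-1 * (q - 1) * (1 - t) ^ (q - 1 - 1)) t :=
      ((hasDerivAt_id t).const_sub 1).rpow_const (Or.inl (by simpa using (sub_pos.2 ht.2).ne'))
    refine (h1.mul h2).congr_deriv ?_
    simp only [betaD_succ, betaD_zero]
    ring
  | succ n ih =>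
    exact ((ih (p - 1) q).const_mul (p - 1)).sub ((ih p (q - 1)).const_mul (q - 1))

theorem exists_abs_betaD_le (n : ℕ) (p q : ℝ) : ∃ C, 0 ≤ C ∧ ∀ t ∈ Set.Ioo (0 : ℝ) 1,
    |betaD n p q t| ≤ C * (t ^ (p - n - 1) * (1 - t) ^ (q - n - 1)) := by
  induction n generalizing p q with
  | zero =>
    refine ⟨1, zero_le_one, fun t ht => ?_⟩
    have := Real.rpow_nonneg ht.1.le (p - 1)
    have := Real.rpow_nonneg (sub_pos.2 ht.2).le (q - 1)
    simp only [betaD_zero, Nat.cast_zero, sub_zero, one_mul]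
    rw [abs_of_nonneg (by positivity)]
  | succ n ih =>
    obtain ⟨C, hC, h1⟩ := ih (p - 1) q
    obtain ⟨D, hD, h2⟩ := ih p (q - 1)
    refine ⟨|p - 1| * C + |q - 1| * D, by positivity, fun t ht => ?_⟩
    have ht' := sub_pos.2 ht.2
    have e1 : (1 - t) ^ (q - n - 1) ≤ (1 - t) ^ (q - (n + 1 : ℕ) - 1) :=
      Real.rpow_le_rpow_of_exponent_ge ht' (by linarith [ht.1]) (by push_cast; linarith)
    have e2 : t ^ (p - n - 1) ≤ t ^ (p - (n + 1 : ℕ) - 1) :=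
      Real.rpow_le_rpow_of_exponent_ge ht.1 ht.2.le (by push_cast; linarith)
    have a1 := Real.rpow_nonneg ht.1.le (p - (n + 1 : ℕ) - 1)
    have a2 := Real.rpow_nonneg ht'.le (q - (n + 1 : ℕ) - 1)
    have hp' : p - 1 - (n : ℝ) - 1 = p - (n + 1 : ℕ) - 1 := by push_cast; ring
    have hq' : q - 1 - (n : ℝ) - 1 = q - (n + 1 : ℕ) - 1 := by push_cast; ring
    have b1 := h1 t ht
    have b2 := h2 t ht
    rw [hp'] at b1
    rw [hq'] at b2
    calc |betaD (n + 1) p q t| ≤ |p - 1| * |betaD n (p - 1) q t| + |q - 1| * |betaD n p (q - 1) t| := by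
          rw [betaD_succ, ← abs_mul, ← abs_mul]; exact abs_sub _ _
      _ ≤ |p - 1| * (C * (t ^ (p - (n + 1 : ℕ) - 1) * (1 - t) ^ (q - (n + 1 : ℕ) - 1))) +
          |q - 1| * (D * (t ^ (p - (n + 1 : ℕ) - 1) * (1 - t) ^ (q - (n + 1 : ℕ) - 1))) := by
          gcongr
          · exact b1.trans (by gcongr)
          · exact b2.trans (by gcongr)
      _ = _ := by ring

theorem integrableOn_betaD {n : ℕ} {p q : ℝ} (hp : n < p) (hq : n < q) :
    IntegrableOn (betaD n p q) (Set.Ioo 0 1) := by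
  obtain ⟨C, _, h⟩ := exists_abs_betaD_le n p q
  refine Integrable.mono' ((integrableOn_beta (sub_pos.2 hp) (sub_pos.2 hq)).const_mul C)
    (measurable_betaD n p q).aestronglyMeasurable ?_
  filter_upwards [ae_restrict_mem measurableSet_Ioo] with t ht using h t ht

theorem tendsto_betaD_zero {n : ℕ} {p : ℝ} (hp : n + 1 < p) (q : ℝ) :
    Tendsto (betaD n p q) (𝓝[>] 0) (𝓝 0) := by
  obtain ⟨C, _, h⟩ := exists_abs_betaD_le n p q
  have hc : ContinuousAt (fun t : ℝ => C * (t ^ (p - n - 1) * (1 - t) ^ (q - n - 1))) 0 := by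
    refine ContinuousAt.mul continuousAt_const (ContinuousAt.mul ?_ ?_)
    · exact continuousAt_id.rpow_const (Or.inr (by linarith))
    · exact ContinuousAt.rpow_const (by fun_prop) (Or.inl (by norm_num))
  have h0 := hc.tendsto.mono_left (nhdsWithin_le_nhds (s := Set.Ioi 0))
  rw [Real.zero_rpow (by linarith), zero_mul, mul_zero] at h0
  refine squeeze_zero_norm' ?_ h0
  filter_upwards [Ioo_mem_nhdsGT zero_lt_one] with t ht using h t ht

theorem tendsto_betaD_one {n : ℕ} {q : ℝ} (hq : n + 1 < q) (p : ℝ) :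
    Tendsto (betaD n p q) (𝓝[<] 1) (𝓝 0) := by
  obtain ⟨C, _, h⟩ := exists_abs_betaD_le n p q
  have hc : ContinuousAt (fun t : ℝ => C * (t ^ (p - n - 1) * (1 - t) ^ (q - n - 1))) 1 := by
    refine ContinuousAt.mul continuousAt_const (ContinuousAt.mul ?_ ?_)
    · exact continuousAt_id.rpow_const (Or.inl one_ne_zero)
    · exact ContinuousAt.rpow_const (by fun_prop) (Or.inr (by linarith))
  have h0 := hc.tendsto.mono_left (nhdsWithin_le_nhds (s := Set.Iio 1))
  rw [sub_self, Real.zero_rpow (by linarith), mul_zero, mul_zero] at h0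
  refine squeeze_zero_norm' ?_ h0
  filter_upwards [Ioo_mem_nhdsLT zero_lt_one] with t ht using h t ht

theorem ContinuousOn.integrableOn_mul_betaD {g : ℝ → ℂ} (hg : ContinuousOn g (Set.Icc 0 1))
    {n : ℕ} {p q : ℝ} (hp : n < p) (hq : n < q) :
    IntegrableOn (fun t => g t * (betaD n p q t : ℂ)) (Set.Ioo 0 1) := by
  obtain ⟨C, hC⟩ := isCompact_Icc.exists_bound_of_continuousOn hg
  refine (integrableOn_betaD hp hq).ofReal.bdd_mul (c := C)
    ((hg.mono Set.Ioo_subset_Icc_self).aestronglyMeasurable measurableSet_Ioo) ?_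
  filter_upwards [ae_restrict_mem measurableSet_Ioo] with t ht
    using hC t (Set.Ioo_subset_Icc_self ht)

theorem integral_mul_betaD_succ {n : ℕ} {p q : ℝ} (hp : n + 1 < p) (hq : n + 1 < q) {g g' : ℝ → ℂ}
    (hg : ContinuousOn g (Set.Icc 0 1)) (hg' : ContinuousOn g' (Set.Icc 0 1))
    (hd : ∀ t ∈ Set.Ioo (0 : ℝ) 1, HasDerivAt g (g' t) t) :
    ∫ t in Set.Ioo (0 : ℝ) 1, g t * (betaD (n + 1) p q t : ℂ) =
      -∫ t in Set.Ioo (0 : ℝ) 1, g' t * (betaD n p q t : ℂ) := by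
  have i1 := hg.integrableOn_mul_betaD (n := n + 1) (p := p) (q := q)
    (by push_cast; linarith) (by push_cast; linarith)
  have i2 := hg'.integrableOn_mul_betaD (n := n) (p := p) (q := q) (by linarith) (by linarith)
  have hderiv : ∀ t ∈ Set.Ioo (0 : ℝ) 1, HasDerivAt (fun t => g t * (betaD n p q t : ℂ))
      (g' t * (betaD n p q t : ℂ) + g t * (betaD (n + 1) p q t : ℂ)) t := fun t ht =>
    (hd t ht).mul (hasDerivAt_betaD n p q ht).ofReal_comp
  have hi : IntervalIntegrable (fun t => g' t * (betaD n p q t : ℂ) +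
      g t * (betaD (n + 1) p q t : ℂ)) volume 0 1 := by
    rw [intervalIntegrable_iff_integrableOn_Ioo_of_le zero_le_one]
    exact i2.add i1
  have t0 : Tendsto (fun t => g t * (betaD n p q t : ℂ)) (𝓝[>] 0) (𝓝 0) := by
    have h1 : Tendsto g (𝓝[>] 0) (𝓝 (g 0)) :=
      ((hg 0 (by simp)).mono Set.Ioo_subset_Icc_self).tendsto.mono_left
        (nhdsWithin_Ioo_eq_nhdsGT (zero_lt_one (α := ℝ))).ge
    have h2 := (Complex.continuous_ofReal.tendsto 0).comp (tendsto_betaD_zero hp q)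
    simpa using h1.mul h2
  have t1 : Tendsto (fun t => g t * (betaD n p q t : ℂ)) (𝓝[<] 1) (𝓝 0) := by
    have h1 : Tendsto g (𝓝[<] 1) (𝓝 (g 1)) :=
      ((hg 1 (by simp)).mono Set.Ioo_subset_Icc_self).tendsto.mono_left
        (nhdsWithin_Ioo_eq_nhdsLT (zero_lt_one (α := ℝ))).ge
    have h2 := (Complex.continuous_ofReal.tendsto 0).comp (tendsto_betaD_one hq p)
    simpa using h1.mul h2
  have h := intervalIntegral.integral_eq_sub_of_hasDerivAt_of_tendsto zero_lt_one hderiv hi t0 t1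
  rw [intervalIntegral.integral_of_le zero_le_one, integral_Ioc_eq_integral_Ioo,
    integral_add i2 i1, sub_zero] at h
  exact eq_neg_of_add_eq_zero_right h

/-- Integration by parts, `n` times, against the `n`-th derivative of the beta density. -/
theorem integral_mul_betaD {n : ℕ} {p q : ℝ} (hp : n < p) (hq : n < q) (g : ℕ → ℝ → ℂ)
    (hg : ∀ j ≤ n, ContinuousOn (g j) (Set.Icc 0 1))
    (hd : ∀ j < n, ∀ t ∈ Set.Ioo (0 : ℝ) 1, HasDerivAt (g j) (g (j + 1) t) t) :
    ∫ t in Set.Ioo (0 : ℝ) 1, g 0 t * (betaD n p q t : ℂ) =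
      (-1) ^ n * ∫ t in Set.Ioo (0 : ℝ) 1, g n t * (betaD 0 p q t : ℂ) := by
  induction n generalizing g with
  | zero => simp
  | succ n ih =>
    push_cast at hp hq
    rw [integral_mul_betaD_succ hp hq (hg 0 (by omega)) (hg 1 (by omega)) (hd 0 (by omega)),
      ih (by linarith) (by linarith) (fun j => g (j + 1)) (fun j hj => hg _ (by omega))
        (fun j hj => hd _ (by omega)), pow_succ]
    ring

/-- The expansion of the `n`-th derivative of the beta density in powers of `1 - t`. -/
theorem hasSum_betaD (n : ℕ) (p q : ℝ) {t : ℝ} (ht : t ∈ Set.Ioo (0 : ℝ) 1) :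
    HasSum (fun k : ℕ => (-1) ^ n * (rising (1 - p) k / k ! * rising (q - n + k) n) *
      (1 - t) ^ (q - n - 1 + k)) (betaD n p q t) := by
  have ht' := sub_pos.2 ht.2
  induction n generalizing p q with
  | zero =>
    have h := (hasSum_binomial (1 - p) (x := 1 - t)
      (by rw [abs_of_pos ht']; linarith [ht.1])).mul_right ((1 - t) ^ (q - 1))
    rw [sub_sub_cancel, neg_sub] at h
    refine HasSum.of_forall_eq h fun k => ?_
    rw [Nat.cast_zero, sub_zero, Real.rpow_add ht', Real.rpow_natCast, rising_zero]
    ring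
  | succ n ih =>
    have h1 := (ih (p - 1) q).mul_left (p - 1)
    have h2 := (ih p (q - 1)).mul_left (q - 1)
    have h1' : HasSum (fun k : ℕ => (-1) ^ (n + 1) * (k * rising (1 - p) k / k ! *
        rising (q - (n + 1) + k) n) * (1 - t) ^ (q - (n + 1 : ℕ) - 1 + k))
        ((p - 1) * betaD n (p - 1) q t) := by
      rw [← hasSum_nat_add_iff' 1]
      simp only [Finset.range_one, Finset.sum_singleton, Nat.cast_zero, zero_mul, zero_div,
        mul_zero, sub_zero]
      refine HasSum.of_forall_eq h1 fun k => ?_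
      have e1 : q - (n + 1) + (k + 1 : ℕ) = q - n + k := by push_cast; ring
      have e2 : q - (n + 1 : ℕ) - 1 + (k + 1 : ℕ) = q - n - 1 + k := by push_cast; ring
      rw [e1, e2, rising_succ_left, Nat.factorial_succ, pow_succ,
        show 1 - p + 1 = 1 - (p - 1) by ring]
      have : (k ! : ℝ) ≠ 0 := by positivity
      push_cast
      field_simp
      ring
    refine HasSum.of_forall_eq (h1'.sub h2) fun k => ?_
    have e1 : q - (n + 1 : ℕ) + k = q - 1 - n + k := by push_cast; ring
    have e2 : q - (n + 1 : ℕ) - 1 + k = q - 1 - n - 1 + k := by push_cast; ring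
    have e3 : q - (n + 1 : ℝ) + k = q - 1 - n + k := by ring
    rw [e1, e2, e3, rising_succ, pow_succ]
    have : (k ! : ℝ) ≠ 0 := by positivity
    field_simp
    ring

theorem integral_one_sub_mul_sub {s u v : ℝ} (hs : s < 1) (hu : 0 < u) (hv : 0 < v) :
    ∫ t in Set.Ioo s 1, (1 - t) ^ (u - 1) * (t - s) ^ (v - 1) =
      (1 - s) ^ (u + v - 1) * beta u v := by
  have hs' := sub_pos.2 hs
  have h := intervalIntegral.mul_integral_comp_add_mul
    (f := fun t : ℝ => (1 - t) ^ (u - 1) * (t - s) ^ (v - 1)) (1 - s) s (a := 0) (b := 1)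
  rw [mul_zero, mul_one, add_zero, add_sub_cancel, intervalIntegral.integral_of_le hs.le,
    integral_Ioc_eq_integral_Ioo, intervalIntegral.integral_of_le zero_le_one,
    integral_Ioc_eq_integral_Ioo] at h
  rw [← h, setIntegral_congr_fun (g := fun r : ℝ => (1 - s) ^ (u + v - 2) *
    (r ^ (v - 1) * (1 - r) ^ (u - 1))) measurableSet_Ioo, integral_const_mul, integral_beta hv hu,
    ← mul_assoc, show u + v - 1 = 1 + (u + v - 2) by ring, Real.rpow_add hs', Real.rpow_one]
  · rw [beta, beta, mul_comm (Real.Gamma u), add_comm u]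
  · intro r hr
    have e1 : 1 - (s + (1 - s) * r) = (1 - s) * (1 - r) := by ring
    have e2 : s + (1 - s) * r - s = (1 - s) * r := by ring
    have e3 : u + v - 2 = (u - 1) + (v - 1) := by ring
    simp only [e1, e2, e3]
    rw [Real.mul_rpow hs'.le (sub_pos.2 hr.2).le, Real.mul_rpow hs'.le hr.1.le, Real.rpow_add hs']
    ring

theorem integrableOn_one_sub_mul_sub {s u v : ℝ} (hs : s < 1) (hu : 0 < u) (hv : 0 < v) :
    IntegrableOn (fun t : ℝ => (1 - t) ^ (u - 1) * (t - s) ^ (v - 1)) (Set.Ioo s 1) := by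
  refine Integrable.of_integral_ne_zero ?_
  rw [integral_one_sub_mul_sub hs hu hv]
  exact (mul_pos (Real.rpow_pos_of_pos (sub_pos.2 hs) _) (beta_pos hu hv)).ne'

theorem beta_add_nat {p q : ℝ} (hp : 0 < p) (hq : 0 < q) (k : ℕ) :
    beta p (q + k) = beta p q * (rising q k / rising (p + q) k) := by
  rw [beta, beta, ← add_assoc, Gamma_add_nat hq, Gamma_add_nat (add_pos hp hq)]
  ring

theorem integral_beta_mul_rpow {p q : ℝ} (hp : 0 < p) (hq : 0 < q) (b : ℝ) {s : ℝ} (hs : s < 0) :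
    ∫ t in Set.Ioo (0 : ℝ) 1, betaD 0 p q t * (t - s) ^ (-b) =
      beta p q * ((1 - s) ^ (-b) * ₂F₁ b q (p + q) (1 / (1 - s))) := by
  have hs1 : 0 < 1 - s := by linarith
  set x := 1 / (1 - s) with hx
  have hx0 : 0 < x := by positivity
  have hx1 : x < 1 := by rw [hx, div_lt_one hs1]; linarith
  have hxa : |x| < 1 := by rwa [abs_of_pos hx0]
  set F : ℕ → ℝ → ℝ := fun k t => rising b k / k ! * x ^ k * betaD 0 p (q + k) t with hF
  have hint : ∀ k, IntegrableOn (F k) (Set.Ioo 0 1) := fun k =>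
    (integrableOn_betaD (n := 0) (by simpa) (by push_cast; positivity)).const_mul _
  have hval : ∀ k, ∫ t in Set.Ioo (0 : ℝ) 1, F k t =
      beta p q * (hypCoeff b q (p + q) k * x ^ k) := fun k => by
    simp only [hF, integral_const_mul, betaD_zero]
    rw [integral_beta hp (by positivity), beta_add_nat hp hq, hypCoeff]
    have := (rising_pos (add_pos hp hq) k).ne'
    field_simp
  have hnorm : ∀ k, ∫ t in Set.Ioo (0 : ℝ) 1, ‖F k t‖ =
      beta p q * ‖hypCoeff b q (p + q) k * x ^ k‖ := fun k => by
    rw [← abs_of_pos (beta_pos hp hq), ← Real.norm_eq_abs, ← norm_mul, ← hval k]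
    simp only [hF, norm_mul _ (betaD 0 p _ _), integral_const_mul, norm_mul _ (∫ _ in _, _)]
    congr 1
    rw [Real.norm_of_nonneg (setIntegral_nonneg measurableSet_Ioo fun t ht => ?_)]
    · refine setIntegral_congr_fun measurableSet_Ioo fun t ht => Real.norm_of_nonneg ?_
      exact mul_nonneg (Real.rpow_nonneg ht.1.le _) (Real.rpow_nonneg (sub_pos.2 ht.2).le _)
    · exact mul_nonneg (Real.rpow_nonneg ht.1.le _) (Real.rpow_nonneg (sub_pos.2 ht.2).le _)
  have hsum := hasSum_integral_of_summable_integral_norm hint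
    (by simp only [hnorm]; exact (summable_norm_hypCoeff b q (p + q) hxa).mul_left _)
  simp only [hval] at hsum
  have h2 := hsum.unique ((hasSum_hyp b q (p + q) hxa).mul_left (beta p q))
  rw [mul_left_comm, ← h2, ← integral_const_mul]
  refine setIntegral_congr_fun measurableSet_Ioo fun t ht => ?_
  have ht' := sub_pos.2 ht.2
  have hy : |x * (1 - t)| < 1 := by
    rw [abs_of_pos (by positivity)]
    nlinarith [ht.1, ht.2]
  have hbin := ((hasSum_binomial b hy).mul_right (betaD 0 p q t)).tsum_eq
  have hFt : ∀ k, F k t = rising b k / k ! * (x * (1 - t)) ^ k * betaD 0 p q t := fun k => by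
    simp only [hF, betaD_zero]
    rw [show q + k - 1 = (q - 1) + k by ring, Real.rpow_add ht', Real.rpow_natCast, mul_pow]
    ring
  simp only [hFt, hbin]
  rw [← mul_assoc, ← Real.mul_rpow hs1.le (by linarith [(abs_lt.1 hy).2]), mul_comm]
  congr 2
  rw [hx]; field_simp; ring

theorem rising_div_Gamma {μ : ℝ} (n : ℕ) :
    rising (1 - μ) n / Real.Gamma μ = (-1) ^ n / Real.Gamma (μ - n) := by
  induction n with
  | zero => simp [rising]
  | succ n ih =>
    rw [rising_succ, mul_div_right_comm, ih, pow_succ]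
    push_cast
    by_cases h : μ - (n + 1) = 0
    · rw [h, Real.Gamma_zero, show 1 - μ + n = -(μ - (n + 1)) by ring, h]; simp
    · rw [show μ - n = μ - (n + 1) + 1 by ring, Real.Gamma_add_one h]
      rw [show 1 - μ + n = -(μ - (n + 1)) by ring]
      field_simp

/-- The Weyl integral of order `μ` of the `n`-th derivative of the beta density. -/
noncomputable def betaKernel (μ : ℝ) (n : ℕ) (p q s : ℝ) : ℝ :=
  if μ = 0 then (Set.Ioo 0 1).indicator (betaD n p q) s
  else 1 / Real.Gamma μ * ∫ t in Set.Ioo (max 0 s) 1, betaD n p q t * (t - s) ^ (μ - 1)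

theorem betaKernel_of_one_le {μ : ℝ} {n : ℕ} {p q s : ℝ} (hs : 1 ≤ s) :
    betaKernel μ n p q s = 0 := by
  unfold betaKernel
  split_ifs
  · exact Set.indicator_of_notMem (fun h => h.2.not_ge hs) _
  · rw [Set.Ioo_eq_empty (not_lt.2 (le_max_of_le_right hs))]; simp

theorem integral_betaD_mul_rpow {n : ℕ} {p q : ℝ} (hp : n < p) (hq : n < q) (μ : ℝ) {s : ℝ}
    (hs : s < 0) :
    ∫ t in Set.Ioo (0 : ℝ) 1, betaD n p q t * (t - s) ^ (μ - 1) =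
      rising (1 - μ) n * ∫ t in Set.Ioo (0 : ℝ) 1, betaD 0 p q t * (t - s) ^ (-(1 - μ + n)) := by
  set g : ℕ → ℝ → ℂ := fun j t => (((-1) ^ j * rising (1 - μ) j * (t - s) ^ (μ - 1 - j) : ℝ) : ℂ)
  have hd : ∀ j, ∀ t ∈ Set.Icc (0 : ℝ) 1, HasDerivAt (g j) (g (j + 1) t) t := fun j t ht => by
    refine HasDerivAt.ofReal_comp ?_
    have hts : t - s ≠ 0 := by linarith [ht.1]
    refine ((((hasDerivAt_id t).sub_const s).rpow_const (p := μ - 1 - j) (Or.inl hts)).const_mul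
      ((-1) ^ j * rising (1 - μ) j)).congr_deriv ?_
    rw [rising_succ, pow_succ, show μ - 1 - ((j + 1 : ℕ) : ℝ) = μ - 1 - j - 1 by push_cast; ring]
    simp only [id]
    ring
  have h := integral_mul_betaD hp hq g
    (fun j _ t ht => (hd j t ht).continuousAt.continuousWithinAt)
    (fun j _ t ht => hd j t (Set.Ioo_subset_Icc_self ht))
  simp only [g, ← Complex.ofReal_mul] at h
  rw [integral_complex_ofReal, integral_complex_ofReal] at h
  have h' : ∫ t in Set.Ioo (0 : ℝ) 1, (-1) ^ 0 * rising (1 - μ) 0 * (t - s) ^ (μ - 1 - (0 : ℕ)) *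
      betaD n p q t = (-1) ^ n * ∫ t in Set.Ioo (0 : ℝ) 1,
        (-1) ^ n * rising (1 - μ) n * (t - s) ^ (μ - 1 - n) * betaD 0 p q t := by
    exact_mod_cast h
  rw [← integral_const_mul] at h' ⊢
  convert h' using 3 with t t
  · simp [rising]; ring
  · rw [show -(1 - μ + n) = μ - 1 - n by ring]
    have : ((-1 : ℝ) ^ n) * (-1) ^ n = 1 := by rw [← mul_pow]; simp
    linear_combination -(rising (1 - μ) n * (t - s) ^ (μ - 1 - n) * betaD 0 p q t) * this

theorem betaKernel_of_neg {n : ℕ} {p q μ b : ℝ} (hp : n < p) (hq : n < q) (hb : b = 1 - μ + n)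
    {s : ℝ} (hs : s < 0) :
    betaKernel μ n p q s = (-1) ^ n * (beta p q / Real.Gamma (1 - b)) *
      ((1 - s) ^ (-b) * ₂F₁ b q (p + q) (1 / (1 - s))) := by
  have h1b : 1 - b = μ - n := by rw [hb]; ring
  have hr := rising_div_Gamma (μ := μ) n
  rw [betaKernel, h1b]
  split_ifs with h
  · rw [h, Real.Gamma_zero, div_zero] at hr
    rw [Set.indicator_of_notMem (fun h => h.1.not_gt hs), h]
    linear_combination (beta p q * ((1 - s) ^ (-b) * ₂F₁ b q (p + q) (1 / (1 - s)))) * hr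
  · have hn : (0 : ℝ) ≤ n := n.cast_nonneg
    rw [max_eq_left hs.le, integral_betaD_mul_rpow hp hq μ hs, ← hb,
      integral_beta_mul_rpow (by linarith) (by linarith) b hs]
    linear_combination (beta p q * ((1 - s) ^ (-b) * ₂F₁ b q (p + q) (1 / (1 - s)))) * hr

theorem integral_betaD_Ioo {n : ℕ} {p q μ : ℝ} (hq : n < q) (hμ : 0 < μ)
    {s : ℝ} (hs : 0 < s) (hs1 : s < 1) :
    ∫ t in Set.Ioo s 1, betaD n p q t * (t - s) ^ (μ - 1) =
      (-1) ^ n * (Real.Gamma μ * Real.Gamma q / Real.Gamma (q - n + μ)) *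
        ((1 - s) ^ (q - n + μ - 1) * ₂F₁ (1 - p) q (q - n + μ) (1 - s)) := by
  have hs1' := sub_pos.2 hs1
  have hxa : |1 - s| < 1 := by rw [abs_of_pos hs1']; linarith
  have hq0 : 0 < q := n.cast_nonneg.trans_lt hq
  have hqn : 0 < q - n := sub_pos.2 hq
  set A : ℝ := (-1) ^ n * (Real.Gamma μ * Real.Gamma q / Real.Gamma (q - n + μ)) *
    (1 - s) ^ (q - n + μ - 1) with hA
  set coef : ℕ → ℝ := fun k => (-1) ^ n * (rising (1 - p) k / k ! * rising (q - n + k) n) with hc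
  set F : ℕ → ℝ → ℝ := fun k t => coef k * ((1 - t) ^ (q - n + k - 1) * (t - s) ^ (μ - 1)) with hF
  have hk : ∀ k : ℕ, 0 < q - n + k := fun k => by positivity
  have hint : ∀ k, IntegrableOn (F k) (Set.Ioo s 1) := fun k =>
    (integrableOn_one_sub_mul_sub hs1 (hk k) hμ).const_mul _
  have hval : ∀ k, ∫ t in Set.Ioo s 1, F k t =
      A * (hypCoeff (1 - p) q (q - n + μ) k * (1 - s) ^ k) := fun k => by
    simp only [hF, integral_const_mul]
    rw [integral_one_sub_mul_sub hs1 (hk k) hμ, hA, beta, hc,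
      show q - n + k + μ - 1 = q - n + μ - 1 + k by ring, Real.rpow_add hs1', Real.rpow_natCast,
      show q - n + k + μ = q - n + μ + k by ring, Gamma_add_nat (add_pos hqn hμ)]
    have e1 : rising (q - n + k) n * Real.Gamma (q - n + k) = rising q k * Real.Gamma q := by
      rw [← Gamma_add_nat (hk k), ← Gamma_add_nat hq0]
      congr 1; ring
    have := (rising_pos (add_pos hqn hμ) k).ne'
    have := (Real.Gamma_pos_of_pos (add_pos hqn hμ)).ne'
    simp only [hypCoeff]
    field_simp
    linear_combination rising (1 - p) k * e1
  have hnorm : ∀ k, ∫ t in Set.Ioo s 1, ‖F k t‖ =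
      ‖A‖ * ‖hypCoeff (1 - p) q (q - n + μ) k * (1 - s) ^ k‖ := fun k => by
    rw [← norm_mul, ← hval k]
    simp only [hF, norm_mul (coef k), integral_const_mul]
    have hnn : ∀ t ∈ Set.Ioo s 1, 0 ≤ (1 - t) ^ (q - n + k - 1) * (t - s) ^ (μ - 1) := fun t ht =>
      mul_nonneg (Real.rpow_nonneg (sub_pos.2 ht.2).le _) (Real.rpow_nonneg (sub_pos.2 ht.1).le _)
    rw [Real.norm_of_nonneg (setIntegral_nonneg measurableSet_Ioo hnn)]
    congr 1
    exact setIntegral_congr_fun measurableSet_Ioo fun t ht => Real.norm_of_nonneg (hnn t ht)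
  have hsum := hasSum_integral_of_summable_integral_norm hint
    (by simp only [hnorm]; exact (summable_norm_hypCoeff (1 - p) q (q - n + μ) hxa).mul_left _)
  simp only [hval] at hsum
  have h2 := hsum.unique ((hasSum_hyp (1 - p) q (q - n + μ) hxa).mul_left A)
  rw [← mul_assoc, ← hA, ← h2]
  refine setIntegral_congr_fun measurableSet_Ioo fun t ht => ?_
  have hb := ((hasSum_betaD n p q ⟨hs.trans ht.1, ht.2⟩).mul_right ((t - s) ^ (μ - 1))).tsum_eq
  simp only [← hb, hF, hc]
  refine tsum_congr fun k => ?_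
  rw [show q - n - 1 + k = q - n + k - 1 by ring]
  ring

theorem betaD_eq_hyp {n : ℕ} {p q : ℝ} (hq : n < q) {s : ℝ} (hs : s ∈ Set.Ioo (0 : ℝ) 1) :
    betaD n p q s = (-1) ^ n * (Real.Gamma q / Real.Gamma (q - n)) *
        ((1 - s) ^ (q - n - 1) * ₂F₁ (1 - p) q (q - n) (1 - s)) := by
  have hs1' := sub_pos.2 hs.2
  have hxa : |1 - s| < 1 := by rw [abs_of_pos hs1']; linarith [hs.1]
  have hq0 : 0 < q := n.cast_nonneg.trans_lt hq
  have hqn : 0 < q - n := sub_pos.2 hq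
  rw [← mul_assoc]
  refine (hasSum_betaD n p q hs).unique (((hasSum_hyp (1 - p) q (q - n) hxa).mul_left
    ((-1) ^ n * (Real.Gamma q / Real.Gamma (q - n)) * (1 - s) ^ (q - n - 1))).of_forall_eq
      fun k => ?_)
  have e1 : rising (q - n + k) n * (rising (q - n) k * Real.Gamma (q - n)) =
      rising q k * Real.Gamma q := by
    rw [← Gamma_add_nat hqn, ← Gamma_add_nat (by positivity), ← Gamma_add_nat hq0]
    congr 1; ring
  have := (rising_pos hqn k).ne'
  have := (Real.Gamma_pos_of_pos hqn).ne'
  rw [Real.rpow_add hs1', Real.rpow_natCast, hypCoeff]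
  field_simp
  linear_combination rising (1 - p) k * e1

theorem betaKernel_of_mem_Ioo {n : ℕ} {p q μ b : ℝ} (hq : n < q) (hμ : 0 ≤ μ)
    (hb : b = 1 - μ + n) {s : ℝ} (hs : s ∈ Set.Ioo (0 : ℝ) 1) :
    betaKernel μ n p q s = (-1) ^ n * (Real.Gamma q / Real.Gamma (q + 1 - b)) *
      (s ^ (p - b) * (1 - s) ^ (q - b) * ₂F₁ (1 - b) (p + q - b) (q + 1 - b) (1 - s)) := by
  have hqb : q + 1 - b = q - n + μ := by rw [hb]; ring
  have hpos : 0 < q + 1 - b := by rw [hqb]; linarith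
  have hE := hyp_euler hpos (1 - b) (p + q - b) (x := 1 - s)
    (by rw [abs_of_pos (sub_pos.2 hs.2)]; linarith [hs.1])
  rw [show q + 1 - b - (1 - b) = q by ring, show q + 1 - b - (p + q - b) = 1 - p by ring,
    show 1 - b + (p + q - b) - (q + 1 - b) = p - b by ring, sub_sub_cancel, hyp_symm] at hE
  rw [mul_comm (s ^ (p - b)), mul_assoc ((1 - s) ^ (q - b)), ← hE, betaKernel, show q - b = q + 1 - b - 1 by ring, hqb]
  split_ifs with h
  · rw [Set.indicator_of_mem hs, betaD_eq_hyp hq hs, h, add_zero]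
  · rw [max_eq_right hs.1.le, integral_betaD_Ioo hq (lt_of_le_of_ne hμ (Ne.symm h)) hs.1 hs.2]
    have := (Real.Gamma_pos_of_pos (lt_of_le_of_ne hμ (Ne.symm h))).ne'
    field_simp

theorem integral_exp_mul_betaD {a c : ℝ} (ha : 0 < a) (hca : 0 < c - a) (z : ℂ) :
    ∫ t in Set.Ioo (0 : ℝ) 1, Complex.exp (z * t) * (betaD 0 a (c - a) t : ℂ) =
      beta a (c - a) * kummerM a c z := by
  have hc : 0 < c := by linarith
  set F : ℕ → ℝ → ℂ := fun k t => z ^ k / (k ! : ℂ) * (betaD 0 (a + k) (c - a) t : ℂ) with hF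
  have hint : ∀ k, IntegrableOn (F k) (Set.Ioo 0 1) := fun k =>
    (integrableOn_betaD (n := 0) (by push_cast; positivity) (by push_cast; exact hca)).ofReal.const_mul _
  have hb : ∀ k : ℕ, ∫ t in Set.Ioo (0 : ℝ) 1, betaD 0 (a + k) (c - a) t =
      beta a (c - a) * (rising a k / rising c k) := fun k => by
    simp only [betaD_zero]
    rw [integral_beta (by positivity) hca, beta, mul_comm (Real.Gamma _), add_comm (a + k), ← beta,
      beta_add_nat hca ha, sub_add_cancel, beta, beta, sub_add_cancel, add_sub_cancel,
      mul_comm (Real.Gamma a)]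
  have hval : ∀ k, ∫ t in Set.Ioo (0 : ℝ) 1, F k t =
      beta a (c - a) * (((rising a k / rising c k : ℝ) : ℂ) * z ^ k / (k ! : ℂ)) := fun k => by
    simp only [hF, integral_const_mul, integral_complex_ofReal, hb]
    push_cast
    ring
  have hnn : ∀ (u : ℝ), ∀ t ∈ Set.Ioo (0 : ℝ) 1, 0 ≤ betaD 0 u (c - a) t := fun u t ht =>
    mul_nonneg (Real.rpow_nonneg ht.1.le _) (Real.rpow_nonneg (sub_pos.2 ht.2).le _)
  have hpow : ∀ (k : ℕ), ∀ t ∈ Set.Ioo (0 : ℝ) 1,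
      betaD 0 (a + k) (c - a) t = t ^ k * betaD 0 a (c - a) t := fun k t ht => by
    rw [betaD_zero, betaD_zero, show a + k - 1 = k + (a - 1) by ring, Real.rpow_add ht.1,
      Real.rpow_natCast, mul_assoc]
  have hsm : Summable fun k => ∫ t in Set.Ioo (0 : ℝ) 1, ‖F k t‖ := by
    refine Summable.of_nonneg_of_le (fun k => integral_nonneg fun t => norm_nonneg _) (fun k => ?_)
      ((NormedSpace.expSeries_div_summable ‖z‖).mul_right (beta a (c - a)))
    rw [← integral_beta ha hca, ← integral_const_mul]
    refine setIntegral_mono_on (hint k).norm ((integrableOn_beta ha hca).const_mul _)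
      measurableSet_Ioo fun t ht => ?_
    rw [hF, norm_mul, norm_div, norm_pow, Complex.norm_natCast, Complex.norm_real,
      Real.norm_of_nonneg (hnn _ t ht), hpow k t ht]
    refine mul_le_mul_of_nonneg_left ?_ (by positivity)
    exact mul_le_of_le_one_left (hnn a t ht) (pow_le_one₀ ht.1.le ht.2.le)
  have h := (hasSum_integral_of_summable_integral_norm hint hsm).tsum_eq
  simp only [hval, tsum_mul_left] at h
  rw [kummerM, h]
  refine setIntegral_congr_fun measurableSet_Ioo fun t ht => ?_
  have he := ((NormedSpace.expSeries_div_hasSum_exp (z * t)).mul_right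
    (betaD 0 a (c - a) t : ℂ)).tsum_eq
  rw [← Complex.exp_eq_exp_ℂ] at he
  simp only [← he, hF]
  refine tsum_congr fun k => ?_
  rw [hpow k t ht, mul_pow]
  push_cast
  ring

/-- The Fourier integral of the `n`-th derivative of the beta density. -/
noncomputable def betaFourier (n : ℕ) (p q ω : ℝ) : ℂ :=
  ∫ t in Set.Ioo (0 : ℝ) 1, Complex.exp (Complex.I * ω * t) * (betaD n p q t : ℂ)

theorem continuous_exp_I_mul (ω : ℝ) : Continuous fun t : ℝ => Complex.exp (Complex.I * ω * t) := by
  fun_prop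

theorem norm_exp_I_mul (ω t : ℝ) : ‖Complex.exp (Complex.I * ω * t)‖ = 1 := by
  rw [show Complex.I * ω * t = ((ω * t : ℝ) : ℂ) * Complex.I by push_cast; ring,
    Complex.norm_exp_ofReal_mul_I]

theorem integrableOn_exp_mul_betaD {n : ℕ} {p q : ℝ} (hp : n < p) (hq : n < q) (ω : ℝ) :
    IntegrableOn (fun t : ℝ => Complex.exp (Complex.I * ω * t) * (betaD n p q t : ℂ))
      (Set.Ioo 0 1) :=
  (continuous_exp_I_mul ω).continuousOn.integrableOn_mul_betaD hp hq

theorem continuous_betaFourier {n : ℕ} {p q : ℝ} (hp : n < p) (hq : n < q) :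
    Continuous (betaFourier n p q) := by
  refine continuous_of_dominated (bound := fun t => ‖betaD n p q t‖)
    (fun ω => (integrableOn_exp_mul_betaD hp hq ω).aestronglyMeasurable)
    (fun ω => ae_of_all _ fun t => ?_) (integrableOn_betaD hp hq).norm
    (ae_of_all _ fun t => by fun_prop)
  rw [norm_mul, norm_exp_I_mul, one_mul, Complex.norm_real]

theorem betaFourier_eq {n : ℕ} {p q : ℝ} (hp : n < p) (hq : n < q) (ω : ℝ) :
    betaFourier n p q ω = (-1) ^ n * (Complex.I * ω) ^ n * betaFourier 0 p q ω := by
  have h := integral_mul_betaD hp hq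
    (fun j t => (Complex.I * ω) ^ j * Complex.exp (Complex.I * ω * t))
    (fun j _ => by fun_prop) (fun j _ t _ => by
      have h1 : HasDerivAt (fun t : ℝ => Complex.I * ω * (t : ℂ)) (Complex.I * ω) t := by
        simpa using (hasDerivAt_id t).ofReal_comp.const_mul (Complex.I * ω)
      refine (h1.cexp.const_mul ((Complex.I * ω) ^ j)).congr_deriv ?_
      rw [pow_succ]; ring)
  simp only [pow_zero, one_mul] at h
  rw [betaFourier, h, betaFourier, mul_assoc ((-1) ^ n)]
  simp only [mul_assoc ((Complex.I * (ω : ℂ)) ^ n), integral_const_mul]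

theorem norm_betaFourier_zero_le {p q : ℝ} (hp : 0 < p) (hq : 0 < q) (ω : ℝ) :
    ‖betaFourier 0 p q ω‖ ≤ beta p q := by
  rw [← integral_beta hp hq]
  refine norm_integral_le_of_norm_le (integrableOn_beta hp hq) ?_
  filter_upwards [ae_restrict_mem measurableSet_Ioo] with t ht
  rw [norm_mul, norm_exp_I_mul, one_mul, Complex.norm_real, Real.norm_of_nonneg, betaD_zero]
  exact mul_nonneg (Real.rpow_nonneg ht.1.le _) (Real.rpow_nonneg (sub_pos.2 ht.2).le _)

theorem betaFourier_reflect (p q ω : ℝ) :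
    betaFourier 0 p q ω = Complex.exp (Complex.I * ω) * betaFourier 0 q p (-ω) := by
  have h := intervalIntegral.integral_comp_sub_left (a := 0) (b := 1)
    (fun t : ℝ => Complex.exp (Complex.I * ω * t) * (betaD 0 p q t : ℂ)) 1
  rw [sub_self, sub_zero, intervalIntegral.integral_of_le zero_le_one,
    intervalIntegral.integral_of_le zero_le_one, integral_Ioc_eq_integral_Ioo,
    integral_Ioc_eq_integral_Ioo] at h
  rw [betaFourier, ← h, betaFourier, ← integral_const_mul]
  refine setIntegral_congr_fun measurableSet_Ioo fun t ht => ?_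
  simp only [betaD_zero, sub_sub_cancel]
  rw [← mul_assoc, ← Complex.exp_add, mul_comm (t ^ (q - 1))]
  congr 2
  push_cast; ring

theorem betaFourier_pascal {p q : ℝ} (hp : 0 < p) (hq : 0 < q) (ω : ℝ) :
    betaFourier 0 p q ω = betaFourier 0 (p + 1) q ω + betaFourier 0 p (q + 1) ω := by
  unfold betaFourier
  rw [← integral_add (integrableOn_exp_mul_betaD (by push_cast; linarith) (by simpa) ω)
    (integrableOn_exp_mul_betaD (by simpa) (by push_cast; linarith) ω)]
  refine setIntegral_congr_fun measurableSet_Ioo fun t ht => ?_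
  simp only [betaD_zero]
  rw [show p + 1 - 1 = p - 1 + 1 by ring, show q + 1 - 1 = q - 1 + 1 by ring,
    Real.rpow_add_one ht.1.ne', Real.rpow_add_one (sub_pos.2 ht.2).ne']
  push_cast; ring

theorem mul_betaFourier {p q : ℝ} (hp : 1 < p) (hq : 1 < q) (ω : ℝ) :
    Complex.I * ω * betaFourier 0 p q ω =
      (q - 1) * betaFourier 0 p (q - 1) ω - (p - 1) * betaFourier 0 (p - 1) q ω := by
  have h1 := betaFourier_eq (n := 1) (by simpa) (by simpa) ω (p := p) (q := q)
  have h2 : betaFourier 1 p q ω =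
      (p - 1) * betaFourier 0 (p - 1) q ω - (q - 1) * betaFourier 0 p (q - 1) ω := by
    unfold betaFourier
    rw [← integral_const_mul, ← integral_const_mul, ← integral_sub]
    · refine integral_congr_ae (ae_of_all _ fun t => ?_)
      simp only [betaD_succ]
      push_cast; ring
    · exact (integrableOn_exp_mul_betaD (by push_cast; linarith) (by push_cast; linarith) ω).const_mul _
    · exact (integrableOn_exp_mul_betaD (by push_cast; linarith) (by push_cast; linarith) ω).const_mul _
  linear_combination h1 - h2

theorem norm_exp_sub_one_le {s : ℝ} (hs : 0 ≤ s) (hs1 : s ≤ 1) (x : ℝ) :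
    ‖Complex.exp (Complex.I * x) - 1‖ ≤ 2 * |x| ^ (1 - s) := by
  rcases le_total |x| 1 with h | h
  · have h1 := Real.norm_exp_I_mul_ofReal_sub_one_le (x := x)
    rcases (abs_nonneg x).eq_or_lt with h0 | h0
    · rw [abs_eq_zero.1 h0.symm]; simp; positivity
    have h2 : |x| ^ (1 : ℝ) ≤ |x| ^ (1 - s) :=
      Real.rpow_le_rpow_of_exponent_ge h0 h (by linarith)
    rw [Real.rpow_one] at h2
    rw [Real.norm_eq_abs] at h1
    linarith [Real.rpow_nonneg h0.le (1 - s)]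
  · have h1 : ‖Complex.exp (Complex.I * x) - 1‖ ≤ 1 + 1 := by
      refine (norm_sub_le _ _).trans (add_le_add ?_ (by simp))
      rw [mul_comm, Complex.norm_exp_ofReal_mul_I]
    linarith [Real.one_le_rpow h (by linarith : 0 ≤ 1 - s)]

theorem betaFourier_decay_aux {s p q : ℝ} (hs : 0 < s) (hs1 : s ≤ 1) (hp : s < p) (hq : 1 < q) :
    ∃ C, ∀ ω : ℝ, ω ≠ 0 → ‖betaFourier 0 p q ω‖ ≤ C * |ω| ^ (-s) := by
  obtain ⟨C, hC, hbd⟩ := exists_abs_betaD_le 1 p q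
  have hp0 : 0 < p := hs.trans hp
  have hq0 : 0 < q := by linarith
  refine ⟨2 * C * beta (p - s) (q - 1), fun ω hω => ?_⟩
  have hIω : Complex.I * (ω : ℂ) ≠ 0 := by simp [hω]
  have hω' : 0 < |ω| := abs_pos.2 hω
  set E : ℝ → ℂ := fun t => (Complex.exp (Complex.I * ω * t) - 1) / (Complex.I * ω) with hE
  have hEd : ∀ t : ℝ, HasDerivAt E (Complex.exp (Complex.I * ω * t)) t := fun t => by
    have h1 : HasDerivAt (fun t : ℝ => Complex.I * ω * (t : ℂ)) (Complex.I * ω) t := by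
      simpa using (hasDerivAt_id t).ofReal_comp.const_mul (Complex.I * ω)
    refine ((h1.cexp.sub_const 1).div_const (Complex.I * ω)).congr_deriv ?_
    exact mul_div_cancel_right₀ _ hIω
  have hEc : Continuous E := continuous_iff_continuousAt.2 fun t => (hEd t).continuousAt
  have hEb : ∀ r : ℝ, 0 ≤ r → r ≤ 1 → ∀ t : ℝ, 0 < t → ‖E t‖ ≤ 2 * (t ^ (1 - r) * |ω| ^ (-r)) := by
    intro r hr hr1 t ht
    have h := norm_exp_sub_one_le hr hr1 (ω * t)
    rw [hE, norm_div, norm_mul, Complex.norm_I, one_mul, Complex.norm_real, Real.norm_eq_abs,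
      div_le_iff₀ hω', show Complex.I * (ω : ℂ) * t = Complex.I * ((ω * t : ℝ) : ℂ) by
        push_cast; ring]
    refine h.trans (le_of_eq ?_)
    rw [abs_mul, abs_of_pos ht, Real.mul_rpow hω'.le ht.le, show 1 - r = -r + 1 by ring,
      Real.rpow_add_one hω'.ne']
    ring
  have hbdE : ∀ t ∈ Set.Ioo (0 : ℝ) 1, ‖E t * (betaD 1 p q t : ℂ)‖ ≤
      2 * C * |ω| ^ (-s) * (t ^ (p - s - 1) * (1 - t) ^ (q - 1 - 1)) := fun t ht => by
    have h1 := hEb s hs.le hs1 t ht.1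
    have h2 := hbd t ht
    push_cast at h2
    rw [norm_mul, Complex.norm_real, Real.norm_eq_abs]
    refine (mul_le_mul h1 h2 (abs_nonneg _) ((norm_nonneg _).trans h1)).trans (le_of_eq ?_)
    rw [show p - s - 1 = (1 - s) + (p - 1 - 1) by ring, Real.rpow_add ht.1]
    ring
  have hi0 := integrableOn_exp_mul_betaD (n := 0) (by simpa) (by simpa) ω (p := p) (q := q)
  have hib := (integrableOn_beta (p := p - s) (q := q - 1) (by linarith) (by linarith)).const_mul
    (2 * C * |ω| ^ (-s))
  have hbdE' : ∀ᵐ t ∂(volume.restrict (Set.Ioo (0 : ℝ) 1)), ‖E t * (betaD 1 p q t : ℂ)‖ ≤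
      2 * C * |ω| ^ (-s) * (t ^ (p - s - 1) * (1 - t) ^ (q - 1 - 1)) := by
    filter_upwards [ae_restrict_mem measurableSet_Ioo] with t ht using hbdE t ht
  have hi1 : IntegrableOn (fun t => E t * (betaD 1 p q t : ℂ)) (Set.Ioo 0 1) :=
    Integrable.mono' hib (hEc.aestronglyMeasurable.mul
      (Complex.measurable_ofReal.comp (measurable_betaD 1 p q)).aestronglyMeasurable) hbdE'
  have t0 : Tendsto (fun t => E t * (betaD 0 p q t : ℂ)) (𝓝[>] 0) (𝓝 0) := by
    have hb := (tendsto_betaD_zero (n := 0) (p := p + 1) (by push_cast; linarith) q).const_mul 2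
    rw [mul_zero] at hb
    refine squeeze_zero_norm' ?_ hb
    filter_upwards [Ioo_mem_nhdsGT zero_lt_one] with t ht
    have h1 := hEb 0 le_rfl zero_le_one t ht.1
    rw [sub_zero, Real.rpow_one, neg_zero, Real.rpow_zero, mul_one] at h1
    have h2 : 0 ≤ t ^ (p - 1) * (1 - t) ^ (q - 1) :=
      mul_nonneg (Real.rpow_nonneg ht.1.le _) (Real.rpow_nonneg (sub_pos.2 ht.2).le _)
    rw [norm_mul, Complex.norm_real, betaD_zero, betaD_zero, Real.norm_of_nonneg h2,
      show p + 1 - 1 = p - 1 + 1 by ring, Real.rpow_add_one ht.1.ne']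
    nlinarith
  have t1 : Tendsto (fun t => E t * (betaD 0 p q t : ℂ)) (𝓝[<] 1) (𝓝 0) := by
    have h2 := (Complex.continuous_ofReal.tendsto 0).comp
      (tendsto_betaD_one (n := 0) (q := q) (by push_cast; linarith) p)
    simpa using ((hEc.tendsto 1).mono_left nhdsWithin_le_nhds).mul h2
  have h := intervalIntegral.integral_eq_sub_of_hasDerivAt_of_tendsto zero_lt_one
    (f' := fun t => Complex.exp (Complex.I * ω * t) * (betaD 0 p q t : ℂ) +
      E t * (betaD 1 p q t : ℂ))
    (fun t ht => (hEd t).mul (hasDerivAt_betaD 0 p q ht).ofReal_comp)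
    (by rw [intervalIntegrable_iff_integrableOn_Ioo_of_le zero_le_one]; exact hi0.add hi1) t0 t1
  rw [intervalIntegral.integral_of_le zero_le_one, integral_Ioc_eq_integral_Ioo,
    integral_add hi0 hi1, sub_zero] at h
  rw [betaFourier, eq_neg_of_add_eq_zero_left h, norm_neg]
  refine (norm_integral_le_of_norm_le hib hbdE').trans (le_of_eq ?_)
  rw [integral_const_mul, integral_beta (by linarith) (by linarith)]
  ring

theorem betaFourier_decay {s p q : ℝ} (hs : 0 < s) (hp : s < p) (hq : s < q) :
    ∃ C, ∀ ω : ℝ, ω ≠ 0 → ‖betaFourier 0 p q ω‖ ≤ C * |ω| ^ (-s) := by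
  obtain ⟨N, hN⟩ := exists_nat_ge s
  induction N generalizing s p q with
  | zero => exact absurd hs (by simpa using hN)
  | succ N ih =>
    push_cast at hN
    rcases le_or_gt s 1 with h1 | h1
    · obtain ⟨C, hC⟩ := betaFourier_decay_aux hs h1 hq (q := p + 1) (by linarith)
      obtain ⟨D, hD⟩ := betaFourier_decay_aux hs h1 hp (q := q + 1) (by linarith)
      refine ⟨C + D, fun ω hω => ?_⟩
      rw [betaFourier_pascal (by linarith) (by linarith), betaFourier_reflect (p + 1), add_mul]
      refine (norm_add_le _ _).trans (add_le_add ?_ (hD ω hω))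
      have h := hC (-ω) (neg_ne_zero.2 hω)
      rw [norm_mul, mul_comm Complex.I, Complex.norm_exp_ofReal_mul_I, one_mul]
      rwa [abs_neg] at h
    · obtain ⟨C, hC⟩ := ih (s := s - 1) (p := p) (q := q - 1) (by linarith) (by linarith)
        (by linarith) (by linarith)
      obtain ⟨D, hD⟩ := ih (s := s - 1) (p := p - 1) (q := q) (by linarith) (by linarith)
        (by linarith) (by linarith)
      refine ⟨|q - 1| * C + |p - 1| * D, fun ω hω => ?_⟩
      have hω' : 0 < |ω| := abs_pos.2 hω
      have h := congrArg norm (mul_betaFourier (p := p) (q := q) (by linarith) (by linarith) ω)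
      rw [norm_mul, norm_mul, Complex.norm_I, one_mul, Complex.norm_real, Real.norm_eq_abs] at h
      have h2 : |ω| * ‖betaFourier 0 p q ω‖ ≤
          |q - 1| * (C * |ω| ^ (-(s - 1))) + |p - 1| * (D * |ω| ^ (-(s - 1))) := by
        rw [h]
        refine (norm_sub_le _ _).trans (add_le_add ?_ ?_)
        · rw [norm_mul]
          refine mul_le_mul (le_of_eq ?_) (hC ω hω) (norm_nonneg _) (abs_nonneg _)
          rw [← Complex.ofReal_one, ← Complex.ofReal_sub, Complex.norm_real, Real.norm_eq_abs]
        · rw [norm_mul]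
          refine mul_le_mul (le_of_eq ?_) (hD ω hω) (norm_nonneg _) (abs_nonneg _)
          rw [← Complex.ofReal_one, ← Complex.ofReal_sub, Complex.norm_real, Real.norm_eq_abs]
      rw [show -(s - 1) = -s + 1 by ring, Real.rpow_add_one hω'.ne'] at h2
      refine le_of_mul_le_mul_left (h2.trans (le_of_eq ?_)) hω'
      ring

theorem one_div_mem_slitPlane {r : ℂ} (hr : 0 < r.re) : 1 / r ∈ Complex.slitPlane := by
  refine Or.inl ?_
  rw [one_div, Complex.inv_re]
  exact div_pos hr (Complex.normSq_pos.2 fun h => by simp [h] at hr)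

theorem integrableOn_rpow_mul_exp_neg {σ ε : ℝ} (hσ : 0 < σ) (hε : 0 < ε) :
    IntegrableOn (fun t : ℝ => t ^ (σ - 1) * Real.exp (-(ε * t))) (Set.Ioi 0) := by
  have h := integrableOn_rpow_mul_exp_neg_mul_rpow (s := σ - 1) (p := 1) (b := ε) (by linarith)
    one_pos hε
  simpa using h

theorem norm_rpow_mul_cexp (σ : ℝ) (r : ℂ) {t : ℝ} (ht : 0 < t) :
    ‖((t ^ (σ - 1) : ℝ) : ℂ) * Complex.exp (-(r * t))‖ =
      t ^ (σ - 1) * Real.exp (-(r.re * t)) := by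
  rw [norm_mul, Complex.norm_real, Real.norm_of_nonneg (Real.rpow_nonneg ht.le _),
    Complex.norm_exp]
  simp

theorem integrableOn_rpow_mul_cexp {σ : ℝ} (hσ : 0 < σ) {r : ℂ} (hr : 0 < r.re) :
    IntegrableOn (fun t : ℝ => ((t ^ (σ - 1) : ℝ) : ℂ) * Complex.exp (-(r * t))) (Set.Ioi 0) := by
  refine Integrable.mono' (integrableOn_rpow_mul_exp_neg hσ hr) ?_ ?_
  · exact Measurable.aestronglyMeasurable (by fun_prop)
  · filter_upwards [ae_restrict_mem measurableSet_Ioi] with t ht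
      using (norm_rpow_mul_cexp σ r ht).le

theorem integral_rpow_mul_cexp_neg {σ : ℝ} (hσ : 0 < σ) {r : ℂ} (hr : 0 < r.re) :
    ∫ t in Set.Ioi (0 : ℝ), ((t ^ (σ - 1) : ℝ) : ℂ) * Complex.exp (-(r * t)) =
      (1 / r) ^ (σ : ℂ) * Real.Gamma σ := by
  set U : Set ℂ := {z | 0 < z.re} with hU
  have hUo : IsOpen U := isOpen_lt continuous_const Complex.continuous_re
  have hUc : IsPreconnected U := (convex_halfSpace_re_gt 0).isPreconnected
  have h1 : DifferentiableOn ℂ (fun r : ℂ => ∫ t in Set.Ioi (0 : ℝ),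
      ((t ^ (σ - 1) : ℝ) : ℂ) * Complex.exp (-(r * t))) U := by
    intro r₀ hr₀
    have hr₀' : 0 < r₀.re := hr₀
    have hmem : ∀ z ∈ Metric.ball r₀ (r₀.re / 2), r₀.re / 2 < z.re := fun z hz => by
      have h := (Complex.abs_re_le_norm (z - r₀)).trans_lt (mem_ball_iff_norm.1 hz)
      rw [Complex.sub_re] at h
      linarith [(abs_lt.1 h).1]
    refine (hasDerivAt_integral_of_dominated_loc_of_deriv_le (μ := volume.restrict (Set.Ioi 0))
      (F' := fun z t => ((t ^ (σ - 1) : ℝ) : ℂ) * (Complex.exp (-(z * t)) * (-t)))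
      (bound := fun t : ℝ => t ^ (σ + 1 - 1) * Real.exp (-(r₀.re / 2 * t)))
      (Metric.ball_mem_nhds r₀ (half_pos hr₀')) ?_ ?_ ?_ ?_ ?_ ?_).2.differentiableAt.differentiableWithinAt
    · exact Eventually.of_forall fun z => Measurable.aestronglyMeasurable (by fun_prop)
    · exact integrableOn_rpow_mul_cexp hσ hr₀
    · exact Measurable.aestronglyMeasurable (by fun_prop)
    · filter_upwards [ae_restrict_mem measurableSet_Ioi] with t ht z hz
      have ht' : (0 : ℝ) < t := ht
      rw [← mul_assoc, norm_mul, norm_rpow_mul_cexp σ z ht, norm_neg, Complex.norm_real,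
        Real.norm_of_nonneg ht'.le, show σ + 1 - 1 = σ - 1 + 1 by ring,
        Real.rpow_add_one ht'.ne', mul_right_comm]
      have := hmem z hz
      gcongr
    · exact integrableOn_rpow_mul_exp_neg (by linarith) (half_pos hr₀')
    · refine ae_of_all _ fun t z _ => ?_
      have h : HasDerivAt (fun z : ℂ => -(z * t)) (-t : ℂ) z := by
        exact ((hasDerivAt_id z).mul_const (t : ℂ)).neg.congr_deriv (by simp)
      exact h.cexp.const_mul _
  have h2 : DifferentiableOn ℂ (fun r : ℂ => (1 / r) ^ (σ : ℂ) * (Real.Gamma σ : ℂ)) U := by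
    intro z hz
    have hz0 : z ≠ 0 := fun h => by simp [hU, h] at hz
    refine DifferentiableAt.differentiableWithinAt (DifferentiableAt.mul_const ?_ _)
    exact ((differentiableAt_const _).div differentiableAt_id hz0).cpow (differentiableAt_const _)
      (one_div_mem_slitPlane hz)
  have hreal : ∀ x : ℝ, 0 < x → (∫ t in Set.Ioi (0 : ℝ), ((t ^ (σ - 1) : ℝ) : ℂ) *
      Complex.exp (-((x : ℂ) * t))) = (1 / (x : ℂ)) ^ (σ : ℂ) * (Real.Gamma σ : ℂ) := fun x hx => by
    have h := Complex.integral_cpow_mul_exp_neg_mul_Ioi (a := σ) (by simpa) hx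
    rw [Complex.Gamma_ofReal] at h
    rw [← h]
    refine setIntegral_congr_fun measurableSet_Ioi fun t ht => ?_
    rw [Complex.ofReal_cpow (le_of_lt ht)]
    push_cast; rfl
  refine (h1.analyticOnNhd hUo).eqOn_of_preconnected_of_frequently_eq (h2.analyticOnNhd hUo) hUc
    (z₀ := 1) (by simp [hU]) ?_ hr
  have ht : Tendsto (fun x : ℝ => (x : ℂ)) (𝓝[>] 1) (𝓝[≠] 1) := by
    refine tendsto_nhdsWithin_iff.2 ⟨?_, ?_⟩
    · exact (Complex.continuous_ofReal.tendsto' 1 1 (by simp)).mono_left nhdsWithin_le_nhds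
    · filter_upwards [self_mem_nhdsWithin] with x hx
      have hx' : (1 : ℝ) < x := hx
      simpa using hx'.ne'
  refine ht.frequently (Eventually.frequently ?_)
  filter_upwards [self_mem_nhdsWithin] with x hx using hreal x (zero_lt_one.trans hx)

/-- The Abel-regularised Fourier integral of `(iω)^(-μ)`. -/
noncomputable def abelKernel (μ ε x : ℝ) : ℂ :=
  Real.Gamma (1 - μ) * (Complex.I ^ ((-μ : ℝ) : ℂ) * (1 / (ε - Complex.I * x)) ^ ((1 - μ : ℝ) : ℂ) +
    (-Complex.I) ^ ((-μ : ℝ) : ℂ) * (1 / (ε + Complex.I * x)) ^ ((1 - μ : ℝ) : ℂ))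

theorem mul_ofReal_cpow {z : ℂ} (hz : z ≠ 0) {ω : ℝ} (hω : 0 < ω) (s : ℝ) :
    (z * ω) ^ (s : ℂ) = z ^ (s : ℂ) * ((ω ^ s : ℝ) : ℂ) := by
  have hω' : (ω : ℂ) ≠ 0 := Complex.ofReal_ne_zero.2 hω.ne'
  rw [Complex.ofReal_cpow hω.le, mul_comm z, Complex.cpow_def_of_ne_zero (mul_ne_zero hω' hz),
    Complex.log_ofReal_mul hω hz, Complex.cpow_def_of_ne_zero hz, Complex.cpow_def_of_ne_zero hω',
    ← Complex.exp_add, Complex.ofReal_log hω.le]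
  congr 1; ring

theorem integrable_of_integrableOn_Ioi {g : ℝ → ℂ} (h1 : IntegrableOn g (Set.Ioi 0))
    (h2 : IntegrableOn (fun x => g (-x)) (Set.Ioi 0)) : Integrable g := by
  have h3 : IntegrableOn g (Set.Iio 0) := by
    rw [← (Measure.measurePreserving_neg (volume : Measure ℝ)).integrableOn_comp_preimage
      (Homeomorph.neg ℝ).measurableEmbedding]
    have : (Neg.neg ⁻¹' Set.Iio (0 : ℝ)) = Set.Ioi 0 := by ext; simp
    rw [this]
    exact h2
  have h4 : IntegrableOn g (Set.Iic 0) := by rwa [integrableOn_Iic_iff_integrableOn_Iio]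
  rw [← integrableOn_univ, ← Set.Iic_union_Ioi (a := (0 : ℝ))]
  exact h4.union h1

theorem integral_eq_add_integral_Ioi {g : ℝ → ℂ} (hg : Integrable g) :
    ∫ x, g x = (∫ x in Set.Ioi (0 : ℝ), g x) + ∫ x in Set.Ioi (0 : ℝ), g (-x) := by
  rw [← intervalIntegral.integral_Iic_add_Ioi hg.integrableOn hg.integrableOn (b := 0), add_comm,
    integral_comp_neg_Ioi 0 g, neg_zero]

theorem abel_integrand {μ ε x ω : ℝ} (hω : 0 < ω) :
    (Complex.I * ω) ^ ((-μ : ℝ) : ℂ) * (Real.exp (-(ε * |ω|)) : ℂ) * Complex.exp (Complex.I * ω * x) =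
      Complex.I ^ ((-μ : ℝ) : ℂ) *
        (((ω ^ (1 - μ - 1) : ℝ) : ℂ) * Complex.exp (-((ε - Complex.I * x) * ω))) := by
  rw [mul_ofReal_cpow Complex.I_ne_zero hω, abs_of_pos hω, show 1 - μ - 1 = -μ by ring,
    mul_assoc, mul_assoc, Complex.ofReal_exp, ← Complex.exp_add]
  congr 3
  push_cast; ring

theorem abel_integrand_neg {μ ε x ω : ℝ} (hω : 0 < ω) :
    (Complex.I * (-ω : ℝ)) ^ ((-μ : ℝ) : ℂ) * (Real.exp (-(ε * |-ω|)) : ℂ) *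
        Complex.exp (Complex.I * (-ω : ℝ) * x) =
      (-Complex.I) ^ ((-μ : ℝ) : ℂ) *
        (((ω ^ (1 - μ - 1) : ℝ) : ℂ) * Complex.exp (-((ε + Complex.I * x) * ω))) := by
  rw [show Complex.I * ((-ω : ℝ) : ℂ) = -Complex.I * ω by push_cast; ring,
    mul_ofReal_cpow (neg_ne_zero.2 Complex.I_ne_zero) hω, abs_neg, abs_of_pos hω,
    show 1 - μ - 1 = -μ by ring, mul_assoc, mul_assoc, Complex.ofReal_exp, ← Complex.exp_add]
  congr 3
  push_cast; ring

theorem integrable_abel {μ ε : ℝ} (hμ : μ < 1) (hε : 0 < ε) (x : ℝ) :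
    Integrable fun ω : ℝ => (Complex.I * ω) ^ ((-μ : ℝ) : ℂ) * (Real.exp (-(ε * |ω|)) : ℂ) *
      Complex.exp (Complex.I * ω * x) := by
  refine integrable_of_integrableOn_Ioi ?_ ?_
  · refine ((integrableOn_rpow_mul_cexp (σ := 1 - μ) (r := ε - Complex.I * x) (by linarith)
      (by simpa)).const_mul (Complex.I ^ ((-μ : ℝ) : ℂ))).congr ?_
    filter_upwards [ae_restrict_mem measurableSet_Ioi] with ω hω using (abel_integrand hω).symm
  · refine ((integrableOn_rpow_mul_cexp (σ := 1 - μ) (r := ε + Complex.I * x) (by linarith)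
      (by simpa)).const_mul ((-Complex.I) ^ ((-μ : ℝ) : ℂ))).congr ?_
    filter_upwards [ae_restrict_mem measurableSet_Ioi] with ω hω using (abel_integrand_neg hω).symm

theorem integral_abel {μ ε : ℝ} (hμ : μ < 1) (hε : 0 < ε) (x : ℝ) :
    ∫ ω : ℝ, (Complex.I * ω) ^ ((-μ : ℝ) : ℂ) * (Real.exp (-(ε * |ω|)) : ℂ) *
      Complex.exp (Complex.I * ω * x) = abelKernel μ ε x := by
  rw [integral_eq_add_integral_Ioi (integrable_abel hμ hε x),
    setIntegral_congr_fun measurableSet_Ioi fun ω hω => abel_integrand hω,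
    setIntegral_congr_fun measurableSet_Ioi fun ω hω => abel_integrand_neg hω,
    integral_const_mul, integral_const_mul, integral_rpow_mul_cexp_neg (by linarith) (by simpa),
    integral_rpow_mul_cexp_neg (by linarith) (by simpa), abelKernel]
  ring

theorem norm_abelKernel_le {μ : ℝ} (hμ : μ < 1) (ε : ℝ) {x : ℝ} (hx : x ≠ 0) :
    ‖abelKernel μ ε x‖ ≤ 2 * Real.Gamma (1 - μ) * |x| ^ (μ - 1) := by
  have hx' := abs_pos.2 hx
  have hG := (Real.Gamma_pos_of_pos (by linarith : 0 < 1 - μ))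
  have key : ∀ z : ℂ, |z.im| = |x| → ‖(1 / z) ^ ((1 - μ : ℝ) : ℂ)‖ ≤ |x| ^ (μ - 1) := by
    intro z hz
    have h1 : |x| ≤ ‖z‖ := hz ▸ Complex.abs_im_le_norm z
    rw [Complex.norm_cpow_real, one_div, norm_inv, ← neg_sub 1 μ, Real.rpow_neg hx'.le,
      ← Real.inv_rpow hx'.le]
    exact Real.rpow_le_rpow (by positivity) (inv_anti₀ hx' h1) (by linarith)
  have h1 := key (ε - Complex.I * x) (by simp)
  have h2 := key (ε + Complex.I * x) (by simp)
  rw [abelKernel, norm_mul, Complex.norm_real, Real.norm_of_nonneg hG.le]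
  have h3 : ‖Complex.I ^ ((-μ : ℝ) : ℂ)‖ = 1 := by rw [Complex.norm_cpow_real]; simp
  have h4 : ‖(-Complex.I) ^ ((-μ : ℝ) : ℂ)‖ = 1 := by rw [Complex.norm_cpow_real]; simp
  calc _ ≤ Real.Gamma (1 - μ) * (|x| ^ (μ - 1) + |x| ^ (μ - 1)) := by
        refine mul_le_mul_of_nonneg_left ((norm_add_le _ _).trans ?_) hG.le
        rw [norm_mul, norm_mul, h3, h4, one_mul, one_mul]
        exact add_le_add h1 h2
    _ = _ := by ring

theorem I_cpow_ofReal (s : ℝ) : Complex.I ^ (s : ℂ) = Complex.exp (s * Real.pi / 2 * Complex.I) := by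
  rw [Complex.cpow_def_of_ne_zero Complex.I_ne_zero, Complex.log_I]
  congr 1; ring

theorem neg_I_cpow_ofReal (s : ℝ) :
    (-Complex.I) ^ (s : ℂ) = Complex.exp (-(s * Real.pi / 2 * Complex.I)) := by
  rw [Complex.cpow_def_of_ne_zero (neg_ne_zero.2 Complex.I_ne_zero), Complex.log_neg_I]
  congr 1; ring

theorem abelKernel_zero_of_pos {μ x : ℝ} (hμ : 0 < μ) (hμ1 : μ < 1) (hx : 0 < x) :
    abelKernel μ 0 x = ((2 * Real.pi / Real.Gamma μ * x ^ (μ - 1) : ℝ) : ℂ) := by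
  have hx' : (x : ℂ) ≠ 0 := Complex.ofReal_ne_zero.2 hx.ne'
  have e1 : 1 / (((0 : ℝ) : ℂ) - Complex.I * x) = Complex.I * (x⁻¹ : ℝ) := by
    push_cast; field_simp; simp; linear_combination (x : ℂ) * Complex.I_mul_I
  have e2 : 1 / (((0 : ℝ) : ℂ) + Complex.I * x) = -Complex.I * (x⁻¹ : ℝ) := by
    push_cast; field_simp; simp; linear_combination (x : ℂ) * Complex.I_mul_I
  have e3 : (x⁻¹) ^ (1 - μ) = x ^ (μ - 1) := by
    rw [Real.inv_rpow hx.le, ← Real.rpow_neg hx.le, neg_sub]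
  have hsin : Complex.exp ((-μ : ℝ) * Real.pi / 2 * Complex.I) *
      Complex.exp ((1 - μ : ℝ) * Real.pi / 2 * Complex.I) +
      Complex.exp (-((-μ : ℝ) * Real.pi / 2 * Complex.I)) *
      Complex.exp (-((1 - μ : ℝ) * Real.pi / 2 * Complex.I)) =
      2 * (Real.sin (Real.pi * μ) : ℂ) := by
    have : (Real.sin (Real.pi * μ) : ℂ) = Complex.cos (Real.pi / 2 - Real.pi * μ) := by
      rw [Complex.cos_pi_div_two_sub]; push_cast; rfl
    rw [this, Complex.two_cos, ← Complex.exp_add, ← Complex.exp_add]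
    congr 2 <;> (push_cast; ring)
  have hG := Real.Gamma_mul_Gamma_one_sub μ
  have hs : 0 < Real.sin (Real.pi * μ) :=
    Real.sin_pos_of_pos_of_lt_pi (by positivity) (by nlinarith [Real.pi_pos])
  have hGμ := Real.Gamma_pos_of_pos hμ
  rw [abelKernel, e1, e2, mul_ofReal_cpow Complex.I_ne_zero (inv_pos.2 hx),
    mul_ofReal_cpow (neg_ne_zero.2 Complex.I_ne_zero) (inv_pos.2 hx), e3, I_cpow_ofReal,
    I_cpow_ofReal, neg_I_cpow_ofReal, neg_I_cpow_ofReal, ← mul_assoc, ← mul_assoc, ← add_mul, hsin]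
  have hr : Real.Gamma (1 - μ) * (2 * Real.sin (Real.pi * μ) * x ^ (μ - 1)) =
      2 * Real.pi / Real.Gamma μ * x ^ (μ - 1) := by
    rw [eq_div_iff hs.ne'] at hG
    rw [div_mul_eq_mul_div, eq_div_iff hGμ.ne']
    linear_combination (2 * x ^ (μ - 1)) * hG
  exact_mod_cast congrArg (fun r : ℝ => (r : ℂ)) hr

theorem abelKernel_zero_of_neg {μ x : ℝ} (hx : x < 0) : abelKernel μ 0 x = 0 := by
  have hx' : (x : ℂ) ≠ 0 := Complex.ofReal_ne_zero.2 hx.ne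
  have hn : 0 < (-x)⁻¹ := inv_pos.2 (by linarith)
  have e1 : 1 / (((0 : ℝ) : ℂ) - Complex.I * x) = -Complex.I * ((-x)⁻¹ : ℝ) := by
    push_cast; field_simp; simp; linear_combination (x : ℂ) * Complex.I_mul_I
  have e2 : 1 / (((0 : ℝ) : ℂ) + Complex.I * x) = Complex.I * ((-x)⁻¹ : ℝ) := by
    push_cast; field_simp; simp; linear_combination (x : ℂ) * Complex.I_mul_I
  have hsum : Complex.exp ((-μ : ℝ) * Real.pi / 2 * Complex.I) *
      Complex.exp (-((1 - μ : ℝ) * Real.pi / 2 * Complex.I)) +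
      Complex.exp (-((-μ : ℝ) * Real.pi / 2 * Complex.I)) *
      Complex.exp ((1 - μ : ℝ) * Real.pi / 2 * Complex.I) = 0 := by
    have h2 : Complex.exp (-(Real.pi / 2 * Complex.I)) = -Complex.I := by
      rw [Complex.exp_neg, Complex.exp_pi_div_two_mul_I, Complex.inv_I]
    rw [← Complex.exp_add, ← Complex.exp_add]
    rw [show ((-μ : ℝ) : ℂ) * Real.pi / 2 * Complex.I + -(((1 - μ : ℝ) : ℂ) * Real.pi / 2 * Complex.I)
        = -(Real.pi / 2 * Complex.I) by push_cast; ring,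
      show -(((-μ : ℝ) : ℂ) * Real.pi / 2 * Complex.I) + ((1 - μ : ℝ) : ℂ) * Real.pi / 2 * Complex.I
        = Real.pi / 2 * Complex.I by push_cast; ring, h2, Complex.exp_pi_div_two_mul_I]
    ring
  rw [abelKernel, e1, e2, mul_ofReal_cpow Complex.I_ne_zero hn,
    mul_ofReal_cpow (neg_ne_zero.2 Complex.I_ne_zero) hn, I_cpow_ofReal,
    I_cpow_ofReal, neg_I_cpow_ofReal, neg_I_cpow_ofReal, ← mul_assoc, ← mul_assoc, ← add_mul, hsum]
  simp

theorem continuousAt_abelKernel (μ : ℝ) {x : ℝ} (hx : x ≠ 0) :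
    ContinuousAt (fun ε => abelKernel μ ε x) 0 := by
  have hx' : (x : ℂ) ≠ 0 := Complex.ofReal_ne_zero.2 hx
  have key : ∀ z : ℂ → ℂ, ContinuousAt z 0 → (z 0).im ≠ 0 →
      ContinuousAt (fun ε : ℝ => (1 / z ε) ^ ((1 - μ : ℝ) : ℂ)) 0 := by
    intro z hz hz0
    have hz1 : z 0 ≠ 0 := fun h => by simp [h] at hz0
    have hc : ContinuousAt (fun ε : ℝ => 1 / z ε) 0 := by
      refine ContinuousAt.div continuousAt_const ?_ (by simpa)
      exact ContinuousAt.comp (f := fun ε : ℝ => (ε : ℂ)) (by simpa) (by fun_prop)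
    refine hc.cpow continuousAt_const (Or.inr ?_)
    rw [Complex.ofReal_zero, one_div, Complex.inv_im]
    exact div_ne_zero (neg_ne_zero.2 hz0) (Complex.normSq_pos.2 hz1).ne'
  have h1 := key (fun ε => ε - Complex.I * x) (by fun_prop) (by simpa)
  have h2 := key (fun ε => ε + Complex.I * x) (by fun_prop) (by simpa)
  exact continuousAt_const.mul ((continuousAt_const.mul h1).add (continuousAt_const.mul h2))

theorem integrableOn_abs_sub_rpow {r : ℝ} (hr : -1 < r) (y a b : ℝ) :
    IntegrableOn (fun t : ℝ => |t - y| ^ r) (Set.Ioo a b) := by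
  have h0 : ∀ K : ℝ, IntervalIntegrable (fun u : ℝ => |u| ^ r) volume 0 K := by
    have hpos : ∀ K : ℝ, 0 ≤ K → IntervalIntegrable (fun u : ℝ => |u| ^ r) volume 0 K := by
      intro K hK
      refine (intervalIntegral.intervalIntegrable_rpow' hr).congr ?_
      intro u hu
      rw [Set.uIoc_of_le hK] at hu
      simp only [abs_of_pos hu.1]
    intro K
    rcases le_total 0 K with hK | hK
    · exact hpos K hK
    · have h := (hpos (-K) (by linarith))
      rw [IntervalIntegrable.iff_comp_neg] at h
      simpa using h
  have h1 : IntervalIntegrable (fun u : ℝ => |u| ^ r) volume (a - y) (b - y) :=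
    (h0 _).symm.trans (h0 _)
  have h2 := h1.comp_sub_right y
  simp only [sub_add_cancel] at h2
  rcases le_total a b with hab | hab
  · rwa [intervalIntegrable_iff_integrableOn_Ioo_of_le hab] at h2
  · rw [Set.Ioo_eq_empty (not_lt.2 hab)]; exact integrableOn_empty

theorem integrableOn_mul_abs_sub_rpow {h : ℝ → ℝ} (hh : IntegrableOn h (Set.Ioo 0 1)) {μ y : ℝ}
    (hμ : 0 < μ) (hμ1 : μ < 1) {d C : ℝ} (hd : 0 < d)
    (hC : ∀ t ∈ Set.Ioo (0 : ℝ) 1, |t - y| < d → |h t| ≤ C) :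
    IntegrableOn (fun t => h t * |t - y| ^ (μ - 1)) (Set.Ioo 0 1) := by
  refine Integrable.mono' (((integrableOn_abs_sub_rpow (r := μ - 1) (by linarith) y 0 1).const_mul
    |C|).add (hh.norm.const_mul (d ^ (μ - 1)))) ?_ ?_
  · exact hh.aestronglyMeasurable.mul (Measurable.aestronglyMeasurable (by fun_prop))
  · filter_upwards [ae_restrict_mem measurableSet_Ioo] with t ht
    have h1 : 0 ≤ |t - y| ^ (μ - 1) := Real.rpow_nonneg (abs_nonneg _) _
    have h2 : 0 ≤ d ^ (μ - 1) := Real.rpow_nonneg hd.le _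
    rw [norm_mul, Real.norm_eq_abs, Real.norm_of_nonneg h1]
    rcases lt_or_ge |t - y| d with hlt | hge
    · have := mul_le_mul_of_nonneg_right ((hC t ht hlt).trans (le_abs_self C)) h1
      simp only [Pi.add_apply, Real.norm_eq_abs]
      linarith [mul_nonneg h2 (abs_nonneg (h t))]
    · have h3 : |t - y| ^ (μ - 1) ≤ d ^ (μ - 1) :=
        Real.rpow_le_rpow_of_nonpos hd hge (by linarith)
      have := mul_le_mul_of_nonneg_left h3 (abs_nonneg (h t))
      simp only [Pi.add_apply, Real.norm_eq_abs]
      linarith [mul_nonneg (abs_nonneg C) h1]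

theorem integral_cpow_mul_fourier {h : ℝ → ℝ} (hh : IntegrableOn h (Set.Ioo 0 1)) {μ y : ℝ}
    (hμ : 0 < μ) (hμ1 : μ < 1)
    (hy : IntegrableOn (fun t => h t * |t - y| ^ (μ - 1)) (Set.Ioo 0 1))
    (hG : Integrable fun ω : ℝ => (Complex.I * ω) ^ ((-μ : ℝ) : ℂ) *
      ∫ t in Set.Ioo (0 : ℝ) 1, Complex.exp (Complex.I * ω * t) * (h t : ℂ)) :
    ∫ ω : ℝ, ((Complex.I * ω) ^ ((-μ : ℝ) : ℂ) *
      ∫ t in Set.Ioo (0 : ℝ) 1, Complex.exp (Complex.I * ω * t) * (h t : ℂ)) *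
        Complex.exp (-(Complex.I * ω * y)) =
      ((2 * Real.pi * (1 / Real.Gamma μ *
        ∫ t in Set.Ioo (max 0 y) 1, h t * (t - y) ^ (μ - 1)) : ℝ) : ℂ) := by
  set A : ℝ → ℂ := fun ω => (Complex.I * ω) ^ ((-μ : ℝ) : ℂ) with hA
  set G : ℝ → ℂ := fun ω => A ω *
      ∫ t in Set.Ioo (0 : ℝ) 1, Complex.exp (Complex.I * ω * t) * (h t : ℂ) with hGdef
  have hn : ∀ ω : ℝ, ‖Complex.exp (-(Complex.I * ω * y))‖ = 1 := fun ω => by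
    rw [← norm_exp_I_mul ω (-y)]; congr 2; push_cast; ring
  have hLm : ∀ ε : ℝ, AEStronglyMeasurable (fun ω : ℝ => G ω * Complex.exp (-(Complex.I * ω * y)) *
      (Real.exp (-(ε * |ω|)) : ℂ)) volume := fun ε =>
    (hG.aestronglyMeasurable.mul (Continuous.aestronglyMeasurable (by fun_prop))).mul
      (Continuous.aestronglyMeasurable (by fun_prop))
  have hL : Tendsto (fun ε : ℝ => ∫ ω : ℝ, G ω * Complex.exp (-(Complex.I * ω * y)) *
      (Real.exp (-(ε * |ω|)) : ℂ)) (𝓝[>] 0) (𝓝 (∫ ω : ℝ, G ω * Complex.exp (-(Complex.I * ω * y)))) := by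
    refine tendsto_integral_filter_of_dominated_convergence (fun ω => ‖G ω‖)
      (Eventually.of_forall hLm) ?_ hG.norm (ae_of_all _ fun ω => ?_)
    · filter_upwards [self_mem_nhdsWithin] with ε hε
      refine ae_of_all _ fun ω => ?_
      rw [norm_mul, norm_mul, hn, mul_one, Complex.norm_real, Real.norm_of_nonneg (Real.exp_nonneg _)]
      refine mul_le_of_le_one_right (norm_nonneg _) (Real.exp_le_one_iff.2 ?_)
      exact neg_nonpos.2 (mul_nonneg (le_of_lt hε) (abs_nonneg _))
    · have hc : Continuous fun ε : ℝ => G ω * Complex.exp (-(Complex.I * ω * y)) *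
          (Real.exp (-(ε * |ω|)) : ℂ) := by fun_prop
      exact (hc.tendsto' 0 _ (by simp)).mono_left nhdsWithin_le_nhds
  have hFub : ∀ ε : ℝ, 0 < ε → ∫ ω : ℝ, G ω * Complex.exp (-(Complex.I * ω * y)) *
      (Real.exp (-(ε * |ω|)) : ℂ) =
      ∫ t in Set.Ioo (0 : ℝ) 1, (h t : ℂ) * abelKernel μ ε (t - y) := by
    intro ε hε
    have hAi : Integrable fun ω : ℝ => A ω * (Real.exp (-(ε * |ω|)) : ℂ) := by
      simpa [hA] using integrable_abel hμ1 hε 0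
    have hprod := hAi.mul_prod (hh.ofReal (𝕜 := ℂ))
    have hprod2 : Integrable (Function.uncurry fun (ω t : ℝ) =>
        Complex.exp (Complex.I * ω * ((t - y : ℝ) : ℂ)) *
          (A ω * (Real.exp (-(ε * |ω|)) : ℂ) * (h t : ℂ)))
        (volume.prod (volume.restrict (Set.Ioo 0 1))) := by
      refine hprod.bdd_mul (c := 1) (Continuous.aestronglyMeasurable (by fun_prop))
        (ae_of_all _ fun z => ?_)
      rw [norm_exp_I_mul]
    have hsw := integral_integral_swap hprod2
    have e1 : ∀ ω : ℝ, ∫ t in Set.Ioo (0 : ℝ) 1, Complex.exp (Complex.I * ω * ((t - y : ℝ) : ℂ)) *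
        (A ω * (Real.exp (-(ε * |ω|)) : ℂ) * (h t : ℂ)) =
        G ω * Complex.exp (-(Complex.I * ω * y)) * (Real.exp (-(ε * |ω|)) : ℂ) := fun ω => by
      simp only [hGdef]
      rw [mul_assoc, mul_right_comm, ← integral_const_mul]
      refine integral_congr_ae (ae_of_all _ fun t => ?_)
      have : Complex.exp (Complex.I * ω * ((t - y : ℝ) : ℂ)) =
          Complex.exp (Complex.I * ω * t) * Complex.exp (-(Complex.I * ω * y)) := by
        rw [← Complex.exp_add]; congr 1; push_cast; ring
      simp only [this]
      ring
    have e2 : ∀ t : ℝ, ∫ ω : ℝ, Complex.exp (Complex.I * ω * ((t - y : ℝ) : ℂ)) *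
        (A ω * (Real.exp (-(ε * |ω|)) : ℂ) * (h t : ℂ)) = (h t : ℂ) * abelKernel μ ε (t - y) :=
      fun t => by
        rw [← integral_abel hμ1 hε, ← integral_const_mul]
        refine integral_congr_ae (ae_of_all _ fun ω => ?_)
        simp only [hA]
        ring
    simp only [e1, e2] at hsw
    exact hsw
  have hR : Tendsto (fun ε : ℝ => ∫ t in Set.Ioo (0 : ℝ) 1, (h t : ℂ) * abelKernel μ ε (t - y))
      (𝓝[>] 0) (𝓝 (∫ t in Set.Ioo (0 : ℝ) 1, (h t : ℂ) * abelKernel μ 0 (t - y))) := by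
    have hne : ∀ᵐ t ∂(volume.restrict (Set.Ioo (0 : ℝ) 1)), t ≠ y :=
      ae_restrict_of_ae (by simp [ae_iff])
    refine tendsto_integral_filter_of_dominated_convergence
      (fun t => 2 * Real.Gamma (1 - μ) * ‖h t * |t - y| ^ (μ - 1)‖)
      (Eventually.of_forall fun ε => ?_) (Eventually.of_forall fun ε => ?_)
      (hy.norm.const_mul _) ?_
    · refine (Complex.continuous_ofReal.comp_aestronglyMeasurable hh.aestronglyMeasurable).mul
        (Measurable.aestronglyMeasurable ?_)
      unfold abelKernel
      fun_prop
    · filter_upwards [hne] with t ht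
      have h1 := norm_abelKernel_le hμ1 ε (sub_ne_zero.2 ht)
      rw [norm_mul, norm_mul, Complex.norm_real, Real.norm_of_nonneg (Real.rpow_nonneg
        (abs_nonneg (t - y)) _)]
      calc _ ≤ ‖h t‖ * (2 * Real.Gamma (1 - μ) * |t - y| ^ (μ - 1)) := by gcongr
        _ = _ := by ring
    · filter_upwards [hne] with t ht
      exact ((continuousAt_abelKernel μ (sub_ne_zero.2 ht)).tendsto.mono_left
        nhdsWithin_le_nhds).const_mul _
  have hL' : Tendsto (fun ε : ℝ => ∫ ω : ℝ, G ω * Complex.exp (-(Complex.I * ω * y)) *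
      (Real.exp (-(ε * |ω|)) : ℂ)) (𝓝[>] 0)
      (𝓝 (∫ t in Set.Ioo (0 : ℝ) 1, (h t : ℂ) * abelKernel μ 0 (t - y))) := by
    refine hR.congr' ?_
    filter_upwards [self_mem_nhdsWithin] with ε hε using (hFub ε hε).symm
  rw [tendsto_nhds_unique hL hL']
  have hset : Set.Ioo (max 0 y) 1 = Set.Ioo 0 1 ∩ Set.Ioi y := by
    ext t; simp only [Set.mem_Ioo, Set.mem_inter_iff, Set.mem_Ioi, max_lt_iff]; tauto
  rw [hset, ← setIntegral_indicator measurableSet_Ioi, ← mul_assoc, ← integral_const_mul,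
    ← integral_complex_ofReal]
  have hne : ∀ᵐ t ∂(volume.restrict (Set.Ioo (0 : ℝ) 1)), t ≠ y :=
    ae_restrict_of_ae (by simp [ae_iff])
  refine integral_congr_ae ?_
  filter_upwards [hne] with t ht
  rcases lt_or_gt_of_ne ht with hlt | hgt
  · rw [abelKernel_zero_of_neg (sub_neg.2 hlt), Set.indicator_of_notMem (by simpa using hlt.le)]
    simp
  · rw [abelKernel_zero_of_pos hμ hμ1 (sub_pos.2 hgt), Set.indicator_of_mem (by simpa using hgt)]
    push_cast; ring

open scoped FourierTransform in
theorem integral_fourier_mul_exp {h : ℝ → ℝ} (hh : IntegrableOn h (Set.Ioo 0 1)) {y : ℝ}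
    (hy : ContinuousAt ((Set.Ioo 0 1).indicator h) y)
    (hG : Integrable fun ω : ℝ =>
      ∫ t in Set.Ioo (0 : ℝ) 1, Complex.exp (Complex.I * ω * t) * (h t : ℂ)) :
    ∫ ω : ℝ, (∫ t in Set.Ioo (0 : ℝ) 1, Complex.exp (Complex.I * ω * t) * (h t : ℂ)) *
        Complex.exp (-(Complex.I * ω * y)) =
      ((2 * Real.pi * (Set.Ioo 0 1).indicator h y : ℝ) : ℂ) := by
  set G : ℝ → ℂ := fun ω =>
    ∫ t in Set.Ioo (0 : ℝ) 1, Complex.exp (Complex.I * ω * t) * (h t : ℂ) with hGd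
  set f : ℝ → ℂ := fun t => (((Set.Ioo 0 1).indicator h t : ℝ) : ℂ) with hf
  have hfi : Integrable f := (hh.integrable_indicator measurableSet_Ioo).ofReal
  have hF : 𝓕 f = fun w : ℝ => G (w * (-(2 * Real.pi))) := by
    ext w
    rw [Real.fourier_real_eq_integral_exp_smul, hGd]
    simp only
    rw [← integral_indicator measurableSet_Ioo]
    refine integral_congr_ae (ae_of_all _ fun t => ?_)
    simp only [hf, smul_eq_mul]
    by_cases ht : t ∈ Set.Ioo (0 : ℝ) 1
    · rw [Set.indicator_of_mem ht, Set.indicator_of_mem ht]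
      congr 2
      push_cast; ring
    · rw [Set.indicator_of_notMem ht, Set.indicator_of_notMem ht]; simp
  have hpi : -(2 * Real.pi) ≠ 0 := by simp [Real.pi_ne_zero]
  have hFi : Integrable (𝓕 f) := by
    rw [hF]
    exact hG.comp_mul_right' hpi
  have hinv := hfi.fourierInv_fourier_eq hFi
    (Complex.continuous_ofReal.continuousAt.comp hy : ContinuousAt f y)
  rw [Real.fourierInv_eq', hF] at hinv
  have hcv := Measure.integral_comp_mul_right
    (fun ω : ℝ => G ω * Complex.exp (-(Complex.I * ω * y))) (-(2 * Real.pi))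
  have e : ∀ w : ℝ, Complex.exp (((2 * Real.pi * inner ℝ w y : ℝ) : ℂ) * Complex.I) •
      G (w * (-(2 * Real.pi))) = G (w * (-(2 * Real.pi))) *
        Complex.exp (-(Complex.I * (w * (-(2 * Real.pi)) : ℝ) * y)) := fun w => by
    rw [smul_eq_mul, mul_comm]
    congr 2
    simp only [RCLike.inner_apply, conj_trivial]
    push_cast; ring
  simp only [e] at hinv
  rw [hcv] at hinv
  have h2 : |(-(2 * Real.pi))⁻¹| = (2 * Real.pi)⁻¹ := by
    rw [inv_neg, abs_neg, abs_of_pos (by positivity)]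
  rw [h2, Complex.real_smul] at hinv
  have h3 : (2 * Real.pi) * (2 * Real.pi)⁻¹ = 1 := mul_inv_cancel₀ (by positivity)
  rw [Complex.ofReal_mul, show (((Set.Ioo 0 1).indicator h y : ℝ) : ℂ) = f y from rfl, ← hinv,
    ← mul_assoc, ← Complex.ofReal_mul, h3, Complex.ofReal_one, one_mul]

theorem integrable_of_norm_le_rpow {g : ℝ → ℂ} (hg : AEStronglyMeasurable g) {u v C D : ℝ}
    (hu : -1 < u) (hv : v < -1) (hC : ∀ ω ≠ 0, ‖g ω‖ ≤ C * |ω| ^ u)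
    (hD : ∀ ω ≠ 0, ‖g ω‖ ≤ D * |ω| ^ v) : Integrable g := by
  have key : ∀ k : ℝ → ℂ, AEStronglyMeasurable k → (∀ ω ≠ 0, ‖k ω‖ ≤ C * |ω| ^ u) →
      (∀ ω ≠ 0, ‖k ω‖ ≤ D * |ω| ^ v) → IntegrableOn k (Set.Ioi 0) := by
    intro k hk h1 h2
    rw [← Set.Ioc_union_Ioi_eq_Ioi zero_le_one]
    refine IntegrableOn.union ?_ ?_
    · have hi := intervalIntegral.intervalIntegrable_rpow' (a := 0) (b := 1) hu
      rw [intervalIntegrable_iff_integrableOn_Ioc_of_le zero_le_one] at hi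
      refine Integrable.mono' (hi.const_mul C) hk.restrict ?_
      filter_upwards [ae_restrict_mem measurableSet_Ioc] with ω hω
      have := h1 ω hω.1.ne'
      rwa [abs_of_pos hω.1] at this
    · refine Integrable.mono' ((integrableOn_Ioi_rpow_of_lt hv zero_lt_one).const_mul D)
        hk.restrict ?_
      filter_upwards [ae_restrict_mem measurableSet_Ioi] with ω hω
      have hω' : 0 < ω := zero_lt_one.trans hω
      have := h2 ω hω'.ne'
      rwa [abs_of_pos hω'] at this
  refine integrable_of_integrableOn_Ioi (key g hg hC hD) (key _ ?_ ?_ ?_)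
  · exact hg.comp_measurePreserving (Measure.measurePreserving_neg volume)
  · intro ω hω
    simpa using hC (-ω) (neg_ne_zero.2 hω)
  · intro ω hω
    simpa using hD (-ω) (neg_ne_zero.2 hω)

theorem integrable_kummerTransfer {a b c : ℝ} (hb : 0 < b) (hba : b < min a (c - a)) :
    Integrable fun ω : ℝ => kummerTransfer a b c ω := by
  obtain ⟨s, hbs, hs⟩ := exists_between hba
  have ha : 0 < a := hb.trans (lt_min_iff.1 hba).1
  have hca : 0 < c - a := hb.trans (lt_min_iff.1 hba).2
  have hB := beta_pos ha hca
  obtain ⟨C, hC⟩ := betaFourier_decay (hb.trans hbs) (lt_min_iff.1 hs).1 (lt_min_iff.1 hs).2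
  have hM : ∀ ω : ℝ, kummerM a c (Complex.I * ω) =
      ((beta a (c - a))⁻¹ : ℝ) * betaFourier 0 a (c - a) ω := fun ω => by
    have h := integral_exp_mul_betaD ha hca (Complex.I * ω)
    rw [betaFourier, h, ← mul_assoc, ← Complex.ofReal_mul, inv_mul_cancel₀ hB.ne']
    simp
  have hnorm : ∀ ω : ℝ, ‖kummerTransfer a b c ω‖ =
      |ω| ^ (b - 1) * ((beta a (c - a))⁻¹ * ‖betaFourier 0 a (c - a) ω‖) := fun ω => by
    rw [kummerTransfer, norm_mul, Complex.norm_cpow_real, hM, norm_mul, norm_mul, Complex.norm_I,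
      one_mul, Complex.norm_real, Complex.norm_real, Real.norm_of_nonneg (inv_nonneg.2 hB.le),
      Real.norm_eq_abs]
  refine integrable_of_norm_le_rpow (u := b - 1) (v := b - 1 - s) (C := 1)
    (D := (beta a (c - a))⁻¹ * C) ?_ (by linarith) (by linarith) ?_ ?_
  · refine Measurable.aestronglyMeasurable ?_
    have h1 : Measurable fun ω : ℝ => (Complex.I * ω) ^ ((b - 1 : ℝ) : ℂ) := by fun_prop
    have h2 : Measurable fun ω : ℝ => kummerM a c (Complex.I * ω) := by
      simp only [hM]
      exact ((continuous_betaFourier (n := 0) (by simpa) (by push_cast; exact hca)).measurable).const_mul _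
    exact h1.mul h2
  · intro ω _
    rw [hnorm, one_mul]
    refine mul_le_of_le_one_right (Real.rpow_nonneg (abs_nonneg _) _) ?_
    rw [inv_mul_le_iff₀ hB, mul_one]
    exact norm_betaFourier_zero_le ha hca ω
  · intro ω hω
    have hω' := abs_pos.2 hω
    rw [hnorm, Real.rpow_sub hω' (b - 1) s]
    have h := hC ω hω
    rw [Real.rpow_neg hω'.le] at h
    calc _ ≤ |ω| ^ (b - 1) * ((beta a (c - a))⁻¹ * (C * (|ω| ^ s)⁻¹)) := by gcongr
      _ = _ := by ring

theorem kummerTransfer_eq {a c μ : ℝ} {n : ℕ} (ha : n < a) (hca : n < c - a) {ω : ℝ} (hω : ω ≠ 0) :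
    kummerTransfer a (1 - μ + n) c ω = (((-1) ^ n / beta a (c - a) : ℝ) : ℂ) *
      ((Complex.I * ω) ^ ((-μ : ℝ) : ℂ) * betaFourier n a (c - a) ω) := by
  have hn : (0 : ℝ) ≤ n := n.cast_nonneg
  have hB := beta_pos (hn.trans_lt ha) (hn.trans_lt hca)
  have hIω : Complex.I * (ω : ℂ) ≠ 0 := by simp [hω]
  have hB' : (beta a (c - a) : ℂ) ≠ 0 := Complex.ofReal_ne_zero.2 hB.ne'
  have h := integral_exp_mul_betaD (hn.trans_lt ha) (hn.trans_lt hca) (Complex.I * ω)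
  have hsq : ((-1 : ℂ) ^ n) * (-1) ^ n = 1 := by rw [← mul_pow]; simp
  rw [betaFourier_eq ha hca, betaFourier, h, kummerTransfer,
    show ((1 - μ + n - 1 : ℝ) : ℂ) = ((-μ : ℝ) : ℂ) + (n : ℂ) by push_cast; ring,
    Complex.cpow_add _ _ hIω, Complex.cpow_natCast]
  push_cast
  field_simp
  linear_combination -((Complex.I * (ω : ℂ)) ^ (-(μ : ℂ)) * kummerM a c (Complex.I * ω)) * hsq

theorem inverseFourier_kummerTransfer {a c μ : ℝ} {n : ℕ} (ha : n < a) (hca : n < c - a)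
    (hμ : 0 ≤ μ) (hμ1 : μ < 1) (hG : Integrable fun ω : ℝ => kummerTransfer a (1 - μ + n) c ω)
    {y : ℝ} (hy0 : y ≠ 0) (hy1 : y ≠ 1) :
    inverseFourier (kummerTransfer a (1 - μ + n) c) y =
      ((√(2 * Real.pi) * ((-1) ^ n / beta a (c - a)) * betaKernel μ n a (c - a) y : ℝ) : ℂ) := by
  have hn : (0 : ℝ) ≤ n := n.cast_nonneg
  have hB := beta_pos (hn.trans_lt ha) (hn.trans_lt hca)
  have hne : ∀ᵐ ω : ℝ, ω ≠ 0 := by simp [ae_iff]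
  set K : ℝ := (-1) ^ n / beta a (c - a) with hK
  have hK0 : K ≠ 0 := div_ne_zero (pow_ne_zero _ (by norm_num)) hB.ne'
  have hG2 : Integrable fun ω : ℝ =>
      (Complex.I * ω) ^ ((-μ : ℝ) : ℂ) * betaFourier n a (c - a) ω := by
    have h := hG.const_mul ((K⁻¹ : ℝ) : ℂ)
    refine h.congr ?_
    filter_upwards [hne] with ω hω
    rw [kummerTransfer_eq ha hca hω, ← mul_assoc, ← Complex.ofReal_mul, inv_mul_cancel₀ hK0]
    simp
  have hcont : ContinuousAt ((Set.Ioo 0 1).indicator (betaD n a (c - a))) y := by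
    by_cases hy : y ∈ Set.Ioo (0 : ℝ) 1
    · refine (hasDerivAt_betaD n a (c - a) hy).continuousAt.congr ?_
      filter_upwards [isOpen_Ioo.mem_nhds hy] with t ht using (Set.indicator_of_mem ht _).symm
    · have hy' : y ∈ (Set.Icc (0 : ℝ) 1)ᶜ := fun h =>
        hy ⟨lt_of_le_of_ne h.1 hy0.symm, lt_of_le_of_ne h.2 hy1⟩
      refine (continuousAt_const (y := (0 : ℝ))).congr ?_
      filter_upwards [isClosed_Icc.isOpen_compl.mem_nhds hy'] with t ht
      exact (Set.indicator_of_notMem (fun h => ht (Set.Ioo_subset_Icc_self h)) _).symm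
  have hh := integrableOn_betaD ha hca
  have main : ∫ ω : ℝ, (Complex.I * ω) ^ ((-μ : ℝ) : ℂ) * betaFourier n a (c - a) ω *
      Complex.exp (-(Complex.I * ω * y)) = ((2 * Real.pi * betaKernel μ n a (c - a) y : ℝ) : ℂ) := by
    rcases hμ.eq_or_lt with rfl | hμ0
    · simp only [neg_zero, Complex.ofReal_zero, Complex.cpow_zero, one_mul] at hG2 ⊢
      rw [betaKernel, if_pos rfl]
      exact integral_fourier_mul_exp hh hcont hG2
    · rw [betaKernel, if_neg hμ0.ne']
      refine integral_cpow_mul_fourier hh hμ0 hμ1 ?_ hG2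
      have hb := Metric.continuousAt_iff.1 hcont 1 one_pos
      obtain ⟨d, hd, hb⟩ := hb
      refine integrableOn_mul_abs_sub_rpow hh hμ0 hμ1 hd
        (C := |(Set.Ioo 0 1).indicator (betaD n a (c - a)) y| + 1) fun t ht htd => ?_
      have h := hb (by rwa [Real.dist_eq])
      rw [Real.dist_eq, Set.indicator_of_mem ht] at h
      have := abs_sub_abs_le_abs_sub (betaD n a (c - a) t)
        ((Set.Ioo 0 1).indicator (betaD n a (c - a)) y)
      linarith
  have h2 : ∫ ω : ℝ, kummerTransfer a (1 - μ + n) c ω * Complex.exp (-(Complex.I * ω * y)) =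
      (K : ℂ) * ((2 * Real.pi * betaKernel μ n a (c - a) y : ℝ) : ℂ) := by
    rw [← main, ← integral_const_mul]
    refine integral_congr_ae ?_
    filter_upwards [hne] with ω hω
    rw [kummerTransfer_eq ha hca hω]
    ring
  rw [inverseFourier, h2, ← Complex.ofReal_mul, ← Complex.ofReal_mul]
  congr 1
  have hs : 0 < √(2 * Real.pi) := Real.sqrt_pos.2 (by positivity)
  have hsq : √(2 * Real.pi) * √(2 * Real.pi) = 2 * Real.pi := Real.mul_self_sqrt (by positivity)
  field_simp
  linear_combination -betaKernel μ n a (c - a) y * hsq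

theorem inverse_fourier_formula {a b c : ℝ} (hb : 0 < b) (hba : b < min a (c - a)) :
    (∀ y : ℝ, 1 < y → inverseFourier (kummerTransfer a b c) y = 0) ∧
      (∀ y : ℝ, 0 < y → y < 1 → inverseFourier (kummerTransfer a b c) y =
        ((√(2 * Real.pi) * (Real.Gamma c / (Real.Gamma a * Real.Gamma (1 - a - b + c))) *
          y ^ (a - b) * (1 - y) ^ (c - a - b) *
          ₂F₁ (1 - b) (c - b) (c + 1 - a - b) (1 - y) : ℝ) : ℂ)) ∧
      (∀ y : ℝ, y < 0 → inverseFourier (kummerTransfer a b c) y =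
        ((√(2 * Real.pi) / Real.Gamma (1 - b) * (1 / (1 - y) ^ b) *
          ₂F₁ b (c - a) c (1 / (1 - y)) : ℝ) : ℂ)) := by
  have ha : b < a := (lt_min_iff.1 hba).1
  have hca : b < c - a := (lt_min_iff.1 hba).2
  have hn0 : 0 < ⌈b⌉₊ := Nat.ceil_pos.2 hb
  obtain ⟨n, hn⟩ := Nat.exists_eq_succ_of_ne_zero hn0.ne'
  have hnb : (n : ℝ) < b := Nat.lt_ceil.1 (by omega)
  have hbn : b ≤ n + 1 := by
    have := Nat.le_ceil b
    rw [hn] at this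
    exact_mod_cast this
  obtain ⟨μ, hμ⟩ : ∃ μ, μ = n + 1 - b := ⟨_, rfl⟩
  have hb' : b = 1 - μ + n := by linarith
  have hG := integrable_kummerTransfer hb hba
  have key : ∀ y : ℝ, y ≠ 0 → y ≠ 1 → inverseFourier (kummerTransfer a b c) y =
      ((√(2 * Real.pi) * ((-1) ^ n / beta a (c - a)) * betaKernel μ n a (c - a) y : ℝ) : ℂ) := by
    intro y hy0 hy1
    rw [hb'] at hG ⊢
    exact inverseFourier_kummerTransfer (hnb.trans ha) (hnb.trans hca) (by linarith) (by linarith)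
      hG hy0 hy1
  have hsq : ((-1 : ℝ) ^ n) * (-1) ^ n = 1 := by rw [← mul_pow]; simp
  have hB := beta_pos (hb.trans ha) (hb.trans hca)
  have hGa := Real.Gamma_pos_of_pos (hb.trans ha)
  have hGca := Real.Gamma_pos_of_pos (hb.trans hca)
  have hGc := Real.Gamma_pos_of_pos (by linarith : 0 < c)
  refine ⟨fun y hy => ?_, fun y hy0 hy1 => ?_, fun y hy => ?_⟩
  · rw [key y (by linarith) (by linarith), betaKernel_of_one_le hy.le]
    simp
  · rw [key y hy0.ne' hy1.ne, betaKernel_of_mem_Ioo (hnb.trans hca) (by linarith) hb' ⟨hy0, hy1⟩,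
      beta, add_sub_cancel, show c - a + 1 - b = c + 1 - a - b by ring,
      show 1 - a - b + c = c + 1 - a - b by ring]
    congr 1
    have hG2 := Real.Gamma_pos_of_pos (by linarith : 0 < c + 1 - a - b)
    field_simp
    linear_combination ((1 - y) ^ (c - a - b) *
      ₂F₁ (1 - b) (c - b) (c + 1 - a - b) (1 - y)) * hsq
  · rw [key y hy.ne (by linarith), betaKernel_of_neg (hnb.trans ha) (hnb.trans hca) hb' hy,
      add_sub_cancel, Real.rpow_neg (by linarith)]
    congr 1
    rw [one_div ((1 - y) ^ b)]
    have : beta a (c - a) * (beta a (c - a))⁻¹ = 1 := mul_inv_cancel₀ hB.ne'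
    simp only [div_eq_mul_inv]
    linear_combination (√(2 * Real.pi) * (Real.Gamma (1 - b))⁻¹ * ((1 - y) ^ b)⁻¹ *
      ₂F₁ b (c - a) c (1 * (1 - y)⁻¹)) * ((-1) ^ n * (-1) ^ n * this + hsq)

theorem exists_norm_le_one_add_sub_rpow {f : ℝ → ℂ} (hf : Continuous f) {σ : ℝ} (hσ : 0 ≤ σ)
    (hO : f =O[atTop] fun t : ℝ => t ^ (-σ)) (x₀ : ℝ) :
    ∃ C, 0 ≤ C ∧ ∀ y, x₀ ≤ y → ‖f y‖ ≤ C * (1 + (y - x₀)) ^ (-σ) := by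
  obtain ⟨c, hc, hb⟩ := hO.exists_pos
  obtain ⟨N, hN⟩ := eventually_atTop.1 hb.bound
  set K := max (max N 1) x₀ with hK
  have hK1 : 1 ≤ K := (le_max_right N 1).trans (le_max_left _ _)
  have hKx : x₀ ≤ K := le_max_right _ _
  obtain ⟨M, hM⟩ := (isCompact_Icc (a := x₀) (b := K)).exists_bound_of_continuousOn hf.continuousOn
  have hM0 : 0 ≤ M := (norm_nonneg _).trans (hM x₀ ⟨le_rfl, hKx⟩)
  refine ⟨M * (1 + (K - x₀)) ^ σ + c * (2 + |x₀|) ^ σ, by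
    have : 0 ≤ 1 + (K - x₀) := by linarith
    positivity, fun y hy => ?_⟩
  have hpos : 0 < 1 + (y - x₀) := by linarith
  have h1 : 0 ≤ (1 + (y - x₀)) ^ (-σ) := Real.rpow_nonneg hpos.le _
  rcases le_total y K with hyK | hyK
  · have h2 : 1 ≤ (1 + (K - x₀)) ^ σ * (1 + (y - x₀)) ^ (-σ) := by
      rw [Real.rpow_neg hpos.le, ← div_eq_mul_inv, one_le_div (Real.rpow_pos_of_pos hpos _)]
      exact Real.rpow_le_rpow hpos.le (by linarith) hσ
    have h3 : 0 ≤ c * (2 + |x₀|) ^ σ * (1 + (y - x₀)) ^ (-σ) := by positivity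
    nlinarith [hM y ⟨hy, hyK⟩]
  · have hy1 : 1 ≤ y := hK1.trans hyK
    have hy0 : 0 < y := by linarith
    have h2 := hN y (((le_max_left N 1).trans (le_max_left _ _)).trans hyK)
    rw [Real.norm_of_nonneg (Real.rpow_nonneg hy0.le _)] at h2
    have h3 : y ^ (-σ) ≤ (2 + |x₀|) ^ σ * (1 + (y - x₀)) ^ (-σ) := by
      rw [Real.rpow_neg hpos.le, Real.rpow_neg hy0.le, ← div_eq_mul_inv,
        inv_le_comm₀ (Real.rpow_pos_of_pos hy0 _) (by positivity), inv_div,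
        div_le_iff₀ (by positivity), ← Real.mul_rpow hy0.le (by positivity)]
      refine Real.rpow_le_rpow hpos.le ?_ hσ
      nlinarith [neg_abs_le x₀, abs_nonneg x₀]
    have h4 : 0 ≤ M * (1 + (K - x₀)) ^ σ * (1 + (y - x₀)) ^ (-σ) := by
      have : 0 ≤ 1 + (K - x₀) := by linarith
      positivity
    nlinarith

theorem integrableOn_one_add_rpow_mul_rpow {μ σ : ℝ} (hμ : 0 < μ) (hσ : μ < σ) :
    IntegrableOn (fun u : ℝ => (1 + u) ^ (-σ) * u ^ (μ - 1)) (Set.Ioi 0) := by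
  rw [← Set.Ioc_union_Ioi_eq_Ioi zero_le_one]
  refine IntegrableOn.union ?_ ?_
  · have hi := intervalIntegral.intervalIntegrable_rpow' (a := 0) (b := 1) (r := μ - 1)
      (by linarith)
    rw [intervalIntegrable_iff_integrableOn_Ioc_of_le zero_le_one] at hi
    refine Integrable.mono' hi (Measurable.aestronglyMeasurable (by fun_prop)) ?_
    filter_upwards [ae_restrict_mem measurableSet_Ioc] with u hu
    have h1 : 0 ≤ u ^ (μ - 1) := Real.rpow_nonneg hu.1.le _
    have h2 : (1 + u) ^ (-σ) ≤ 1 := Real.rpow_le_one_of_one_le_of_nonpos (by linarith [hu.1])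
      (by linarith)
    have h3 : 0 ≤ (1 + u) ^ (-σ) := Real.rpow_nonneg (by linarith [hu.1]) _
    rw [Real.norm_of_nonneg (by positivity)]
    exact mul_le_of_le_one_left h1 h2
  · refine Integrable.mono' (integrableOn_Ioi_rpow_of_lt (a := -σ + (μ - 1)) (by linarith)
      zero_lt_one) (Measurable.aestronglyMeasurable (by fun_prop)) ?_
    filter_upwards [ae_restrict_mem measurableSet_Ioi] with u hu
    have hu0 : (0 : ℝ) < u := zero_lt_one.trans hu
    have h1 : 0 ≤ u ^ (μ - 1) := Real.rpow_nonneg hu0.le _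
    have h3 : 0 ≤ (1 + u) ^ (-σ) := Real.rpow_nonneg (by linarith) _
    rw [Real.norm_of_nonneg (by positivity), Real.rpow_add hu0]
    exact mul_le_mul_of_nonneg_right
      (Real.rpow_le_rpow_of_nonpos hu0 (by linarith) (by linarith)) h1

theorem preimage_add_Ioi (x : ℝ) : (fun u => x + u) ⁻¹' Set.Ioi x = Set.Ioi 0 := by
  ext; simp

theorem setIntegral_Ioi_eq (g : ℝ → ℂ) (x : ℝ) :
    ∫ y in Set.Ioi x, g y = ∫ u in Set.Ioi (0 : ℝ), g (x + u) := by
  rw [← (measurePreserving_add_left volume x).setIntegral_preimage_emb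
    (Homeomorph.addLeft x).measurableEmbedding g, preimage_add_Ioi]

theorem integrableOn_Ioi_iff_add (g : ℝ → ℂ) (x : ℝ) :
    IntegrableOn g (Set.Ioi x) ↔ IntegrableOn (fun u => g (x + u)) (Set.Ioi 0) := by
  rw [← (measurePreserving_add_left volume x).integrableOn_comp_preimage
    (Homeomorph.addLeft x).measurableEmbedding, preimage_add_Ioi]
  rfl

theorem weylIntegral_eq {μ : ℝ} (hμ : 0 < μ) (f : ℝ → ℂ) (x : ℝ) :
    weylIntegral μ f x = ((1 / Real.Gamma μ : ℝ) : ℂ) *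
      ∫ u in Set.Ioi (0 : ℝ), f (x + u) * ((u ^ (μ - 1) : ℝ) : ℂ) := by
  rw [weylIntegral, if_neg hμ.ne', setIntegral_Ioi_eq]
  simp only [add_sub_cancel_left]

theorem norm_weyl_integrand_le {f : ℝ → ℂ} {C σ x₀ : ℝ} (hσ : 0 ≤ σ) (hC0 : 0 ≤ C)
    (hC : ∀ y, x₀ ≤ y → ‖f y‖ ≤ C * (1 + (y - x₀)) ^ (-σ)) (μ : ℝ) {x u : ℝ} (hx : x₀ ≤ x)
    (hu : 0 < u) :
    ‖f (x + u) * ((u ^ (μ - 1) : ℝ) : ℂ)‖ ≤ C * ((1 + u) ^ (-σ) * u ^ (μ - 1)) := by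
  rw [norm_mul, Complex.norm_real, Real.norm_of_nonneg (Real.rpow_nonneg hu.le _), ← mul_assoc]
  refine mul_le_mul_of_nonneg_right ((hC _ (by linarith)).trans ?_) (Real.rpow_nonneg hu.le _)
  exact mul_le_mul_of_nonneg_left
    (Real.rpow_le_rpow_of_nonpos (by linarith) (by linarith) (by linarith)) hC0

section Decay

variable {f : ℝ → ℂ} {σ : ℝ}

theorem integrableOn_weyl (hf : Continuous f) (hO : f =O[atTop] fun t : ℝ => t ^ (-σ)) {μ : ℝ}
    (hμ : 0 < μ) (hσ : μ < σ) (x : ℝ) :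
    IntegrableOn (fun u : ℝ => f (x + u) * ((u ^ (μ - 1) : ℝ) : ℂ)) (Set.Ioi 0) := by
  obtain ⟨C, hC0, hC⟩ := exists_norm_le_one_add_sub_rpow hf (by linarith) hO x
  refine Integrable.mono' ((integrableOn_one_add_rpow_mul_rpow hμ hσ).const_mul C)
    (Measurable.aestronglyMeasurable (by have := hf.measurable; fun_prop)) ?_
  filter_upwards [ae_restrict_mem measurableSet_Ioi] with u hu
    using norm_weyl_integrand_le (by linarith) hC0 hC μ le_rfl hu

theorem continuous_weylIntegral (hf : Continuous f) (hO : f =O[atTop] fun t : ℝ => t ^ (-σ)) {μ : ℝ}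
    (hμ : 0 < μ) (hσ : μ < σ) : Continuous (weylIntegral μ f) := by
  rw [funext (weylIntegral_eq hμ f)]
  refine continuous_const.mul (continuous_iff_continuousAt.2 fun x₁ => ?_)
  obtain ⟨C, hC0, hC⟩ := exists_norm_le_one_add_sub_rpow hf (by linarith) hO (x₁ - 1)
  refine continuousAt_of_dominated (bound := fun u => C * ((1 + u) ^ (-σ) * u ^ (μ - 1)))
    (Eventually.of_forall fun x => (integrableOn_weyl hf hO hμ hσ x).aestronglyMeasurable) ?_
    ((integrableOn_one_add_rpow_mul_rpow hμ hσ).const_mul C) (ae_of_all _ fun u => by fun_prop)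
  filter_upwards [Ioi_mem_nhds (show x₁ - 1 < x₁ by linarith)] with x hx
  filter_upwards [ae_restrict_mem measurableSet_Ioi] with u hu
    using norm_weyl_integrand_le (by linarith) hC0 hC μ (le_of_lt hx) hu

theorem hasDerivAt_weylIntegral {f' : ℝ → ℂ} (hd : ∀ x, HasDerivAt f (f' x) x)
    (hf' : Continuous f') (hO : f =O[atTop] fun t : ℝ => t ^ (-σ))
    (hO' : f' =O[atTop] fun t : ℝ => t ^ (-σ)) {μ : ℝ} (hμ : 0 < μ) (hσ : μ < σ) (x : ℝ) :
    HasDerivAt (weylIntegral μ f) (weylIntegral μ f' x) x := by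
  have hf : Continuous f := continuous_iff_continuousAt.2 fun x => (hd x).continuousAt
  rw [funext (weylIntegral_eq hμ f), weylIntegral_eq hμ f']
  obtain ⟨C, hC0, hC⟩ := exists_norm_le_one_add_sub_rpow hf' (by linarith) hO' (x - 1)
  refine HasDerivAt.const_mul _ (hasDerivAt_integral_of_dominated_loc_of_deriv_le
    (s := Set.Ioi (x - 1)) (F' := fun x u => f' (x + u) * ((u ^ (μ - 1) : ℝ) : ℂ))
    (bound := fun u => C * ((1 + u) ^ (-σ) * u ^ (μ - 1)))
    (Ioi_mem_nhds (by linarith))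
    (Eventually.of_forall fun x => (integrableOn_weyl hf hO hμ hσ x).aestronglyMeasurable)
    (integrableOn_weyl hf hO hμ hσ x) (integrableOn_weyl hf' hO' hμ hσ x).aestronglyMeasurable ?_
    ((integrableOn_one_add_rpow_mul_rpow hμ hσ).const_mul C) (ae_of_all _ fun u z _ => ?_)).2
  · filter_upwards [ae_restrict_mem measurableSet_Ioi] with u hu z hz
      using norm_weyl_integrand_le (by linarith) hC0 hC μ (le_of_lt hz) hu
  · exact ((hd (z + u)).comp_add_const z u).mul_const _

theorem weylIntegral_succ_deriv {f' : ℝ → ℂ} (hd : ∀ x, HasDerivAt f (f' x) x)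
    (hf' : Continuous f') (h0 : ∀ᶠ t in atTop, f t = 0) {μ : ℝ} (hμ : 0 < μ)
    (hO : f =O[atTop] fun t : ℝ => t ^ (-σ))
    (hO' : f' =O[atTop] fun t : ℝ => t ^ (-σ)) (hσ : μ + 1 < σ) (x : ℝ) :
    weylIntegral (μ + 1) f' x = -weylIntegral μ f x := by
  have hf : Continuous f := continuous_iff_continuousAt.2 fun x => (hd x).continuousAt
  have i1 := integrableOn_weyl hf' hO' (by linarith : 0 < μ + 1) hσ x
  have i2 := integrableOn_weyl hf hO hμ (by linarith) x
  have h := integral_Ioi_of_hasDerivAt_of_tendsto (a := 0)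
    (f := fun u : ℝ => f (x + u) * ((u ^ μ : ℝ) : ℂ))
    (f' := fun u => f' (x + u) * ((u ^ (μ + 1 - 1) : ℝ) : ℂ) +
      (μ : ℂ) * (f (x + u) * ((u ^ (μ - 1) : ℝ) : ℂ))) (m := 0) ?_ ?_
      (i1.add (i2.const_mul (μ : ℂ))) ?_
  · rw [integral_add i1 (i2.const_mul _), integral_const_mul, Real.zero_rpow hμ.ne'] at h
    rw [weylIntegral_eq hμ, weylIntegral_eq (by linarith : 0 < μ + 1), Real.Gamma_add_one hμ.ne']
    have hG := (Real.Gamma_pos_of_pos hμ).ne'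
    have hGc : (Real.Gamma μ : ℂ) ≠ 0 := Complex.ofReal_ne_zero.2 hG
    have hμc : (μ : ℂ) ≠ 0 := Complex.ofReal_ne_zero.2 hμ.ne'
    push_cast at h ⊢
    rw [mul_zero, sub_zero] at h
    field_simp
    linear_combination h
  · refine Continuous.continuousWithinAt ?_
    have : Continuous fun u : ℝ => u ^ μ := Real.continuous_rpow_const hμ.le
    fun_prop
  · intro u hu
    have hu' : (0 : ℝ) < u := hu
    have h1 := ((hd (x + u)).comp_const_add x u).mul
      ((Real.hasDerivAt_rpow_const (p := μ) (Or.inl hu'.ne')).ofReal_comp)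
    refine h1.congr_deriv ?_
    rw [add_sub_cancel_right]
    push_cast; ring
  · refine tendsto_const_nhds.congr' ?_
    filter_upwards [(tendsto_atTop_add_const_left atTop x tendsto_id).eventually h0] with u hu
    simp only [id] at hu
    rw [hu, zero_mul]

end Decay

/-- The part of the Weyl integral that comes from beyond `R`, without the constant. -/
noncomputable def weylTail (h : ℝ → ℂ) (R r x : ℝ) : ℂ :=
  ∫ y in Set.Ioi R, h y * (((y - x) ^ r : ℝ) : ℂ)

theorem integrableOn_one_add_sub_rpow {s : ℝ} (hs : s < -1) (R : ℝ) :
    IntegrableOn (fun y : ℝ => (1 + (y - R)) ^ s) (Set.Ioi R) := by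
  rw [← (measurePreserving_add_left volume R).integrableOn_comp_preimage
    (Homeomorph.addLeft R).measurableEmbedding, preimage_add_Ioi]
  have h := integrableOn_one_add_rpow_mul_rpow (μ := 1) (σ := -s) one_pos (by linarith)
  simp only [sub_self, Real.rpow_zero, mul_one, neg_neg] at h
  refine h.congr_fun (fun u _ => ?_) measurableSet_Ioi
  simp

section Tail

variable {h : ℝ → ℂ} {σ R : ℝ}

theorem exists_norm_weylTail_integrand_le (hh : Continuous h) (hσ : 0 ≤ σ)
    (hO : h =O[atTop] fun t : ℝ => t ^ (-σ)) (s : ℝ) {x₀ : ℝ} (hx₀ : x₀ < R) :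
    ∃ C, ∀ x ∈ Metric.ball x₀ ((R - x₀) / 2), ∀ y, R < y →
      ‖h y * (((y - x) ^ s : ℝ) : ℂ)‖ ≤ C * (1 + (y - R)) ^ (s - σ) := by
  obtain ⟨C, hC0, hC⟩ := exists_norm_le_one_add_sub_rpow hh hσ hO R
  set d := R - x₀ with hd
  have hd0 : 0 < d := sub_pos.2 hx₀
  set c₁ := min 1 (d / 2)
  set c₂ := max 1 (3 * d / 2)
  have hc₁ : 0 < c₁ := lt_min one_pos (half_pos hd0)
  have hc₂ : 0 < c₂ := lt_max_of_lt_left one_pos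
  refine ⟨C * (c₁ ^ s + c₂ ^ s), fun x hx y hy => ?_⟩
  rw [Metric.mem_ball, Real.dist_eq, abs_lt] at hx
  have hu : 0 < 1 + (y - R) := by linarith
  have e1 : c₁ * (1 + (y - R)) ≤ y - x := by
    have h1 : c₁ ≤ 1 := min_le_left _ _
    have h2 : c₁ ≤ d / 2 := min_le_right _ _
    nlinarith
  have e2 : y - x ≤ c₂ * (1 + (y - R)) := by
    have h1 : 1 ≤ c₂ := le_max_left _ _
    have h2 : 3 * d / 2 ≤ c₂ := le_max_right _ _
    nlinarith
  have hyx : 0 < y - x := lt_of_lt_of_le (by positivity) e1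
  have p1 : 0 < c₁ ^ s := Real.rpow_pos_of_pos hc₁ s
  have p2 : 0 < c₂ ^ s := Real.rpow_pos_of_pos hc₂ s
  have pu : 0 < (1 + (y - R)) ^ s := Real.rpow_pos_of_pos hu s
  have key : (y - x) ^ s ≤ (c₁ ^ s + c₂ ^ s) * (1 + (y - R)) ^ s := by
    rcases le_total 0 s with hs | hs
    · have h1 := Real.rpow_le_rpow hyx.le e2 hs
      rw [Real.mul_rpow hc₂.le hu.le] at h1
      nlinarith
    · have h1 := Real.rpow_le_rpow_of_nonpos (by positivity) e1 hs
      rw [Real.mul_rpow hc₁.le hu.le] at h1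
      nlinarith
  rw [norm_mul, Complex.norm_real, Real.norm_of_nonneg (Real.rpow_nonneg hyx.le _),
    show s - σ = -σ + s by ring, Real.rpow_add hu]
  calc _ ≤ C * (1 + (y - R)) ^ (-σ) * ((c₁ ^ s + c₂ ^ s) * (1 + (y - R)) ^ s) :=
        mul_le_mul (hC y hy.le) key (Real.rpow_nonneg hyx.le _)
          (mul_nonneg hC0 (Real.rpow_nonneg hu.le _))
    _ = _ := by ring

theorem hasDerivAt_weylTail (hh : Continuous h) (hσ : 0 ≤ σ)
    (hO : h =O[atTop] fun t : ℝ => t ^ (-σ)) {r : ℝ} (hr : r < σ - 1) {x : ℝ} (hx : x < R) :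
    HasDerivAt (weylTail h R r) (-(r : ℂ) * weylTail h R (r - 1) x) x := by
  have hm : ∀ s x : ℝ, AEStronglyMeasurable (fun y : ℝ => h y * (((y - x) ^ s : ℝ) : ℂ))
      (volume.restrict (Set.Ioi R)) := fun s x =>
    Measurable.aestronglyMeasurable (by have := hh.measurable; fun_prop)
  obtain ⟨C, hC⟩ := exists_norm_weylTail_integrand_le hh hσ hO r hx
  obtain ⟨D, hD⟩ := exists_norm_weylTail_integrand_le hh hσ hO (r - 1) hx
  have hball : 0 < (R - x) / 2 := by linarith
  have hmain := (hasDerivAt_integral_of_dominated_loc_of_deriv_le (μ := volume.restrict (Set.Ioi R))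
    (F := fun x y => h y * (((y - x) ^ r : ℝ) : ℂ))
    (F' := fun x y => -(r : ℂ) * (h y * (((y - x) ^ (r - 1) : ℝ) : ℂ)))
    (bound := fun y => |r| * (D * (1 + (y - R)) ^ (r - 1 - σ)))
    (Metric.ball_mem_nhds x hball) (Eventually.of_forall fun z => hm r z) ?_
    ((hm (r - 1) x).const_mul _) ?_
    (((integrableOn_one_add_sub_rpow (by linarith) R).const_mul D).const_mul |r|) ?_).2
  · rw [integral_const_mul] at hmain
    exact hmain
  · refine Integrable.mono' ((integrableOn_one_add_sub_rpow (by linarith : r - σ < -1) R).const_mul C)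
      (hm r x) ?_
    filter_upwards [ae_restrict_mem measurableSet_Ioi] with y hy
      using hC x (Metric.mem_ball_self hball) y hy
  · filter_upwards [ae_restrict_mem measurableSet_Ioi] with y hy z hz
    rw [norm_mul, norm_neg, Complex.norm_real, Real.norm_eq_abs]
    exact mul_le_mul_of_nonneg_left (hD z hz y hy) (abs_nonneg _)
  · filter_upwards [ae_restrict_mem measurableSet_Ioi] with y hy z hz
    rw [Metric.mem_ball, Real.dist_eq, abs_lt] at hz
    have hyz : y - z ≠ 0 := by have : R < y := hy; linarith
    have h1 : HasDerivAt (fun z : ℝ => y - z) (-1) z := (hasDerivAt_id z).const_sub y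
    refine ((h1.rpow_const (p := r) (Or.inl hyz)).ofReal_comp.const_mul (h y)).congr_deriv ?_
    push_cast; ring

theorem contDiffOn_weylTail (hh : Continuous h) (hσ : 0 ≤ σ)
    (hO : h =O[atTop] fun t : ℝ => t ^ (-σ)) (m : ℕ) {r : ℝ} (hr : r < σ - 1) :
    ContDiffOn ℝ m (weylTail h R r) (Set.Iio R) := by
  induction m generalizing r with
  | zero =>
    rw [Nat.cast_zero, contDiffOn_zero]
    exact fun x hx => (hasDerivAt_weylTail hh hσ hO hr hx).continuousAt.continuousWithinAt
  | succ m ih =>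
    rw [Nat.cast_succ, contDiffOn_succ_iff_deriv_of_isOpen isOpen_Iio]
    refine ⟨fun x hx => (hasDerivAt_weylTail hh hσ hO hr hx).differentiableAt.differentiableWithinAt,
      by simp, ?_⟩
    refine ((ih (r := r - 1) (by linarith)).const_smul (-(r : ℂ))).congr fun x hx => ?_
    rw [(hasDerivAt_weylTail hh hσ hO hr hx).deriv]
    rfl

end Tail

theorem isBigO_of_eventually_eq_zero {f : ℝ → ℂ} (h0 : ∀ᶠ t in atTop, f t = 0) (g : ℝ → ℝ) :
    f =O[atTop] g := by
  refine (isBigO_zero g atTop).congr' ?_ EventuallyEq.rfl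
  filter_upwards [h0] with t ht using ht.symm

theorem deriv_eventually_eq_zero {f : ℝ → ℂ} (h0 : ∀ᶠ t in atTop, f t = 0) :
    ∀ᶠ t in atTop, deriv f t = 0 := by
  obtain ⟨N, hN⟩ := eventually_atTop.1 h0
  filter_upwards [eventually_gt_atTop N] with t ht
  have : f =ᶠ[𝓝 t] fun _ => 0 := by
    filter_upwards [Ioi_mem_nhds ht] with s hs using hN s (le_of_lt hs)
  rw [this.deriv_eq, deriv_const]

theorem contDiff_weylIntegral_of_eventually_zero {f : ℝ → ℂ} (m : ℕ) (hf : ContDiff ℝ m f)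
    (h0 : ∀ᶠ t in atTop, f t = 0) {μ : ℝ} (hμ : 0 < μ) : ContDiff ℝ m (weylIntegral μ f) := by
  induction m generalizing f with
  | zero =>
    rw [Nat.cast_zero, contDiff_zero]
    exact continuous_weylIntegral hf.continuous
      (isBigO_of_eventually_eq_zero h0 fun t => t ^ (-(μ + 1))) hμ (by linarith)
  | succ m ih =>
    rw [Nat.cast_succ, contDiff_succ_iff_deriv] at hf ⊢
    have hd : ∀ x, HasDerivAt (weylIntegral μ f) (weylIntegral μ (deriv f) x) x := fun x =>
      hasDerivAt_weylIntegral (fun x => (hf.1 x).hasDerivAt) hf.2.2.continuous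
        (isBigO_of_eventually_eq_zero h0 fun t => t ^ (-(μ + 1)))
        (isBigO_of_eventually_eq_zero (deriv_eventually_eq_zero h0) fun t => t ^ (-(μ + 1)))
        hμ (by linarith) x
    refine ⟨fun x => (hd x).differentiableAt, by simp, ?_⟩
    rw [funext fun x => (hd x).deriv]
    exact ih hf.2.2 (deriv_eventually_eq_zero h0)

/-- A smooth step which vanishes before `R` and is one after `R + 1`. -/
noncomputable def smoothStep (R t : ℝ) : ℂ := (Real.smoothTransition (t - R) : ℂ)

theorem contDiff_smoothStep (R : ℝ) (m : ℕ) : ContDiff ℝ m (smoothStep R) :=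
  Complex.ofRealCLM.contDiff.comp
    (Real.smoothTransition.contDiff.comp (contDiff_id.sub contDiff_const))

theorem smoothStep_of_le {R t : ℝ} (h : t ≤ R) : smoothStep R t = 0 := by
  rw [smoothStep, Real.smoothTransition.zero_of_nonpos (by linarith), Complex.ofReal_zero]

theorem smoothStep_of_ge {R t : ℝ} (h : R + 1 ≤ t) : smoothStep R t = 1 := by
  rw [smoothStep, Real.smoothTransition.one_of_one_le (by linarith), Complex.ofReal_one]

theorem norm_smoothStep_le (R t : ℝ) : ‖smoothStep R t‖ ≤ 1 := by
  rw [smoothStep, Complex.norm_real, Real.norm_of_nonneg (Real.smoothTransition.nonneg _)]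
  exact Real.smoothTransition.le_one _

section Split

variable {f : ℝ → ℂ} {σ : ℝ}

theorem isBigO_mul_smoothStep {g : ℝ → ℝ} (hO : f =O[atTop] g) (R : ℝ) :
    (fun t => f t * smoothStep R t) =O[atTop] g := by
  refine IsBigO.trans (IsBigO.of_bound 1 (Eventually.of_forall fun t => ?_)) hO
  rw [norm_mul, one_mul]
  exact mul_le_of_le_one_right (norm_nonneg _) (norm_smoothStep_le R t)

theorem eventually_mul_one_sub_smoothStep (f : ℝ → ℂ) (R : ℝ) :
    ∀ᶠ t in atTop, f t * (1 - smoothStep R t) = 0 := by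
  filter_upwards [eventually_ge_atTop (R + 1)] with t ht
  rw [smoothStep_of_ge ht, sub_self, mul_zero]

theorem weylIntegral_split (hf : Continuous f) (hO : f =O[atTop] fun t : ℝ => t ^ (-σ)) {μ : ℝ}
    (hμ : 0 < μ) (hσ : μ < σ) {R x : ℝ} (hx : x < R) :
    weylIntegral μ f x = weylIntegral μ (fun t => f t * (1 - smoothStep R t)) x +
      ((1 / Real.Gamma μ : ℝ) : ℂ) * weylTail (fun t => f t * smoothStep R t) R (μ - 1) x := by
  have hs : Continuous (smoothStep R) := (contDiff_smoothStep R 0).continuous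
  have i1 := integrableOn_weyl (f := fun t => f t * (1 - smoothStep R t)) (by fun_prop)
    (isBigO_of_eventually_eq_zero (eventually_mul_one_sub_smoothStep f R) _) hμ hσ x
  have i2 := integrableOn_weyl (f := fun t => f t * smoothStep R t) (by fun_prop)
    (isBigO_mul_smoothStep hO R) hμ hσ x
  have e2 : weylTail (fun t => f t * smoothStep R t) R (μ - 1) x =
      ∫ u in Set.Ioi (0 : ℝ), f (x + u) * smoothStep R (x + u) * ((u ^ (μ - 1) : ℝ) : ℂ) := by
    rw [weylTail, ← setIntegral_eq_of_subset_of_forall_sdiff_eq_zero measurableSet_Ioi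
      (Set.Ioi_subset_Ioi hx.le), setIntegral_Ioi_eq]
    · simp only [add_sub_cancel_left]
    · intro y hy
      rw [smoothStep_of_le (by simpa using hy.2)]
      simp
  rw [weylIntegral_eq hμ, weylIntegral_eq hμ, e2, ← mul_add, ← integral_add i1 i2]
  congr 1
  refine integral_congr_ae (ae_of_all _ fun u => ?_)
  simp only
  ring

theorem contDiff_weylIntegral (m : ℕ) (hf : ContDiff ℝ m f)
    (hO : f =O[atTop] fun t : ℝ => t ^ (-σ)) {μ : ℝ} (hμ : 0 < μ) (hσ : μ < σ) :
    ContDiff ℝ m (weylIntegral μ f) := by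
  refine contDiff_iff_contDiffAt.2 fun x => ?_
  have hs := contDiff_smoothStep (x + 1) m
  have h1 := contDiff_weylIntegral_of_eventually_zero m (f := fun t => f t * (1 - smoothStep (x + 1) t))
    (hf.mul (contDiff_const.sub hs)) (eventually_mul_one_sub_smoothStep f _) hμ
  have h2 := (contDiffOn_weylTail (R := x + 1) (h := fun t => f t * smoothStep (x + 1) t)
    (hf.continuous.mul hs.continuous) (by linarith) (isBigO_mul_smoothStep hO _) m
    (r := μ - 1) (by linarith)).contDiffAt (Iio_mem_nhds (by linarith : x < x + 1))
  refine (h1.contDiffAt.add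
    ((contDiffAt_const (c := ((1 / Real.Gamma μ : ℝ) : ℂ))).mul h2)).congr_of_eventuallyEq ?_
  · filter_upwards [Iio_mem_nhds (by linarith : x < x + 1)] with z hz
    exact weylIntegral_split hf.continuous hO hμ hσ hz

theorem hasDerivAt_weylIntegral_succ (hf : ContDiff ℝ 1 f)
    (hO : f =O[atTop] fun t : ℝ => t ^ (-σ)) {μ : ℝ} (hμ : 0 < μ) (hσ : μ + 1 < σ) (x : ℝ) :
    HasDerivAt (weylIntegral (μ + 1) f) (-weylIntegral μ f x) x := by
  have hs : ContDiff ℝ 1 (smoothStep (x + 1)) := contDiff_smoothStep (x + 1) 1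
  have hx : x < x + 1 := by linarith
  set f₁ : ℝ → ℂ := fun t => f t * (1 - smoothStep (x + 1) t) with hf₁
  have hc₁ : ContDiff ℝ 1 f₁ := hf.mul (contDiff_const.sub hs)
  have h0 : ∀ᶠ t in atTop, f₁ t = 0 := eventually_mul_one_sub_smoothStep f _
  have hd₁ : ∀ x, HasDerivAt f₁ (deriv f₁ x) x := fun x =>
    (hc₁.differentiable one_ne_zero x).hasDerivAt
  have hc' := hc₁.continuous_deriv_one
  have hO1 := isBigO_of_eventually_eq_zero h0 fun t => t ^ (-σ)
  have hO2 := isBigO_of_eventually_eq_zero (deriv_eventually_eq_zero h0) fun t => t ^ (-σ)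
  have h1 := hasDerivAt_weylIntegral hd₁ hc' hO1 hO2 (by linarith : 0 < μ + 1) hσ x
  rw [weylIntegral_succ_deriv hd₁ hc' h0 hμ hO1 hO2 hσ] at h1
  have h2 := (hasDerivAt_weylTail (R := x + 1) (h := fun t => f t * smoothStep (x + 1) t)
    (hf.continuous.mul hs.continuous) (by linarith) (isBigO_mul_smoothStep hO _)
    (r := μ + 1 - 1) (by linarith) hx).const_mul ((1 / Real.Gamma (μ + 1) : ℝ) : ℂ)
  refine ((h1.add h2).congr_of_eventuallyEq ?_).congr_deriv ?_
  · filter_upwards [Iio_mem_nhds hx] with z hz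
    exact weylIntegral_split hf.continuous hO (by linarith) hσ hz
  · rw [weylIntegral_split hf.continuous hO hμ (by linarith) hx, ← hf₁, Real.Gamma_add_one hμ.ne',
      add_sub_cancel_right]
    have hG : (Real.Gamma μ : ℂ) ≠ 0 := Complex.ofReal_ne_zero.2 (Real.Gamma_pos_of_pos hμ).ne'
    have hμc : (μ : ℂ) ≠ 0 := Complex.ofReal_ne_zero.2 hμ.ne'
    push_cast
    field_simp
    ring

end Split

theorem isBigO_rpow_of_le {f : ℝ → ℂ} {r s : ℝ} (hO : f =O[atTop] fun t : ℝ => t ^ r)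
    (h : r ≤ s) : f =O[atTop] fun t : ℝ => t ^ s := by
  refine hO.trans (IsBigO.of_bound 1 ?_)
  filter_upwards [eventually_ge_atTop 1] with t ht
  rw [one_mul, Real.norm_of_nonneg (Real.rpow_nonneg (by linarith) _),
    Real.norm_of_nonneg (Real.rpow_nonneg (by linarith) _)]
  exact Real.rpow_le_rpow_of_exponent_le ht h

theorem contDiff_weylIntegral_nat {f : ℝ → ℂ} {ν ε : ℝ} {m : ℕ} (hm : 0 < m) (hν : ν < m)
    (hε : 0 < ε) (k : ℕ) (hf : ContDiff ℝ (m + k : ℕ) f)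
    (hO : f =O[atTop] fun t : ℝ => t ^ (-((m + k : ℕ) - ν + ε))) :
    ContDiff ℝ (m + k : ℕ) (weylIntegral ((m + k : ℕ) - ν) f) ∧
      weylDeriv (m + k) ν f = weylDeriv m ν f := by
  refine ⟨contDiff_weylIntegral _ hf hO (by push_cast; linarith [(k.cast_nonneg : (0 : ℝ) ≤ k)])
    (by linarith), ?_⟩
  induction k with
  | zero => rfl
  | succ k ih =>
    have hk : (0 : ℝ) ≤ k := k.cast_nonneg
    have hO' : f =O[atTop] fun t : ℝ => t ^ (-((m + k : ℕ) - ν + ε)) :=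
      isBigO_rpow_of_le hO (by push_cast; linarith)
    rw [← ih (hf.of_le (by exact_mod_cast Nat.le_succ (m + k))) hO']
    ext x
    have hder : deriv (weylIntegral ((m + (k + 1) : ℕ) - ν) f) =
        fun x => -weylIntegral ((m + k : ℕ) - ν) f x := by
      ext x
      have h := hasDerivAt_weylIntegral_succ (f := f) (μ := (m + k : ℕ) - ν)
        (hf.of_le (by exact_mod_cast (by omega : 1 ≤ m + (k + 1)))) hO (by push_cast; linarith)
        (by push_cast; linarith) x
      rw [← h.deriv]
      congr 2
      push_cast; ring
    rw [weylDeriv, weylDeriv, ← add_assoc, iteratedDeriv_succ', add_assoc, hder]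
    rw [iteratedDeriv_fun_neg, ← add_assoc, pow_succ]
    ring

/-- The truncated power `u₊^(μ-1)`. -/
noncomputable def truncPow (μ : ℝ) : ℝ → ℝ := (Set.Ioi 0).indicator fun u => u ^ (μ - 1)

theorem measurable_truncPow (μ : ℝ) : Measurable (truncPow μ) :=
  Measurable.indicator (by fun_prop) measurableSet_Ioi

theorem truncPow_nonneg (μ u : ℝ) : 0 ≤ truncPow μ u :=
  Set.indicator_nonneg (fun _ hu => Real.rpow_nonneg (le_of_lt hu) _) u

theorem integral_mul_truncPow {μ : ℝ} (h : ℝ → ℂ) :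
    ∫ v, h v * (truncPow μ v : ℂ) = ∫ v in Set.Ioi (0 : ℝ), h v * ((v ^ (μ - 1) : ℝ) : ℂ) := by
  rw [← integral_indicator measurableSet_Ioi]
  refine integral_congr_ae (ae_of_all _ fun v => ?_)
  by_cases hv : v ∈ Set.Ioi (0 : ℝ)
  · simp only [truncPow, Set.indicator_of_mem hv]
  · simp only [truncPow, Set.indicator_of_notMem hv, Complex.ofReal_zero, mul_zero]

theorem integral_comp_mul_truncPow {μ η : ℝ} (hμ : 0 < μ) (hη : 0 < η) (f : ℝ → ℂ) (X t : ℝ) :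
    ∫ s, f (X - η * s) * (truncPow μ (t - s) : ℂ) =
      ((η ^ (-μ) * Real.Gamma μ : ℝ) : ℂ) * weylIntegral μ f (X - η * t) := by
  have hG := Real.Gamma_pos_of_pos hμ
  rw [← integral_sub_left_eq_self _ volume t, weylIntegral_eq hμ]
  simp only [sub_sub_cancel]
  rw [integral_mul_truncPow fun v => f (X - η * (t - v))]
  have h := integral_comp_mul_left_Ioi
    (fun u : ℝ => f (X - η * t + u) * ((u ^ (μ - 1) : ℝ) : ℂ)) 0 hη
  rw [mul_zero, Complex.real_smul] at h
  have h2 : ∫ v in Set.Ioi (0 : ℝ), f (X - η * t + η * v) * (((η * v) ^ (μ - 1) : ℝ) : ℂ) =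
      ((η ^ (μ - 1) : ℝ) : ℂ) *
        ∫ v in Set.Ioi (0 : ℝ), f (X - η * (t - v)) * ((v ^ (μ - 1) : ℝ) : ℂ) := by
    rw [← integral_const_mul]
    refine setIntegral_congr_fun measurableSet_Ioi fun v hv => ?_
    rw [Real.mul_rpow hη.le (le_of_lt hv), show X - η * (t - v) = X - η * t + η * v by ring]
    push_cast; ring
  rw [h2] at h
  rw [← mul_assoc, ← Complex.ofReal_mul, mul_assoc, mul_one_div_cancel hG.ne', mul_one]
  have h3 : η ^ (-μ) * η * η ^ (μ - 1) = 1 := by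
    rw [← Real.rpow_add_one hη.ne', ← Real.rpow_add hη]
    simp
  have h4 : ((η ^ (-μ) * η * η ^ (μ - 1) : ℝ) : ℂ) = 1 := by rw [h3, Complex.ofReal_one]
  have hη' : (η : ℂ) ≠ 0 := Complex.ofReal_ne_zero.2 hη.ne'
  have h5 := congrArg (fun z : ℂ => ((η ^ (-μ) * η : ℝ) : ℂ) * z) h
  simp only [← mul_assoc] at h5
  rw [← Complex.ofReal_mul, h4, one_mul, ← Complex.ofReal_mul, mul_assoc, mul_inv_cancel₀ hη.ne',
    mul_one] at h5
  exact h5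

theorem integrable_comp_mul_truncPow {f : ℝ → ℂ} (hf : Continuous f) {σ μ η : ℝ}
    (hO : f =O[atTop] fun t : ℝ => t ^ (-σ)) (hμ : 0 < μ) (hσ : μ < σ) (hη : 0 < η) (X t : ℝ) :
    Integrable fun s => f (X - η * s) * (truncPow μ (t - s) : ℂ) := by
  have h1 : Integrable fun v => f (X - η * (t - v)) * (truncPow μ v : ℂ) := by
    have h0 := integrableOn_weyl hf hO hμ hσ (X - η * t)
    have h2 : IntegrableOn (fun v : ℝ => f (X - η * t + η * v) * (((η * v) ^ (μ - 1) : ℝ) : ℂ))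
        (Set.Ioi 0) := by
      rw [integrableOn_Ioi_comp_mul_left_iff
        (fun u : ℝ => f (X - η * t + u) * ((u ^ (μ - 1) : ℝ) : ℂ)) 0 hη, mul_zero]
      exact h0
    have h3 := IntegrableOn.integrable_indicator (h2.const_mul ((η ^ (-(μ - 1)) : ℝ) : ℂ))
      measurableSet_Ioi
    refine h3.congr (ae_of_all _ fun v => ?_)
    by_cases hv : v ∈ Set.Ioi (0 : ℝ)
    · simp only [truncPow, Set.indicator_of_mem hv]
      rw [Real.mul_rpow hη.le (le_of_lt hv), show X - η * (t - v) = X - η * t + η * v by ring,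
        Real.rpow_neg hη.le]
      have : ((η ^ (μ - 1) : ℝ) : ℂ) ≠ 0 :=
        Complex.ofReal_ne_zero.2 (Real.rpow_pos_of_pos hη _).ne'
      push_cast at this ⊢
      field_simp
    · simp only [truncPow, Set.indicator_of_notMem hv, Complex.ofReal_zero, mul_zero]
  have h2 := h1.comp_sub_left t
  simpa only [sub_sub_cancel] using h2

theorem isBigO_norm_ofReal {f : ℝ → ℂ} {g : ℝ → ℝ} (hO : f =O[atTop] g) :
    (fun y => ((‖f y‖ : ℝ) : ℂ)) =O[atTop] g := by
  refine IsBigO.trans (IsBigO.of_bound 1 (Eventually.of_forall fun t => ?_)) hO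
  rw [one_mul, Complex.norm_real, norm_norm]

theorem betaKernel_eq_integral_truncPow {μ : ℝ} (hμ : 0 < μ) (n : ℕ) (p q s : ℝ) :
    ∫ t in Set.Ioo (0 : ℝ) 1, betaD n p q t * truncPow μ (t - s) =
      Real.Gamma μ * betaKernel μ n p q s := by
  have hset : Set.Ioo (max 0 s) 1 = Set.Ioo 0 1 ∩ Set.Ioi s := by
    ext t; simp only [Set.mem_Ioo, Set.mem_inter_iff, Set.mem_Ioi, max_lt_iff]; tauto
  rw [betaKernel, if_neg hμ.ne', ← mul_assoc, mul_one_div_cancel (Real.Gamma_pos_of_pos hμ).ne',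
    one_mul, hset, ← setIntegral_indicator measurableSet_Ioi]
  refine integral_congr_ae (ae_of_all _ fun t => ?_)
  beta_reduce
  by_cases ht : s < t
  · rw [Set.indicator_of_mem (show t ∈ Set.Ioi s from ht), truncPow,
      Set.indicator_of_mem (show t - s ∈ Set.Ioi 0 from sub_pos.2 ht)]
  · rw [Set.indicator_of_notMem (show t ∉ Set.Ioi s from ht), truncPow,
      Set.indicator_of_notMem (show t - s ∉ Set.Ioi 0 from fun h => ht (sub_pos.1 h)), mul_zero]

theorem weylIntegral_betaD {f : ℝ → ℂ} (hf : Continuous f) {σ μ η p q : ℝ} {n : ℕ}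
    (hO : f =O[atTop] fun t : ℝ => t ^ (-σ)) (hμ : 0 ≤ μ) (hσ : μ < σ) (hη : 0 < η)
    (hp : n < p) (hq : n < q) (X : ℝ) :
    Integrable (fun s => f (X - η * s) * (betaKernel μ n p q s : ℂ)) ∧
    ∫ t in Set.Ioo (0 : ℝ) 1, weylIntegral μ f (X - η * t) * (betaD n p q t : ℂ) =
      ((η ^ μ : ℝ) : ℂ) * ∫ s, f (X - η * s) * (betaKernel μ n p q s : ℂ) := by
  rcases hμ.eq_or_lt with rfl | hμ
  · have e : (fun s => f (X - η * s) * (betaKernel 0 n p q s : ℂ)) =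
        (Set.Ioo 0 1).indicator fun s => f (X - η * s) * (betaD n p q s : ℂ) := by
      ext s
      rw [betaKernel, if_pos rfl]
      by_cases hs : s ∈ Set.Ioo (0 : ℝ) 1
      · rw [Set.indicator_of_mem hs, Set.indicator_of_mem hs]
      · rw [Set.indicator_of_notMem hs, Set.indicator_of_notMem hs]; simp
    rw [e]
    refine ⟨IntegrableOn.integrable_indicator ?_ measurableSet_Ioo, ?_⟩
    · exact (Continuous.continuousOn (by fun_prop)).integrableOn_mul_betaD hp hq
    · rw [integral_indicator measurableSet_Ioo]
      simp [weylIntegral]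
  · have hG := Real.Gamma_pos_of_pos hμ
    set Ψ : ℝ → ℝ → ℂ := fun t s => (betaD n p q t : ℂ) * (f (X - η * s) * (truncPow μ (t - s) : ℂ))
      with hΨ
    have hmeas : AEStronglyMeasurable (Function.uncurry Ψ)
        ((volume.restrict (Set.Ioo (0 : ℝ) 1)).prod volume) := by
      refine Measurable.aestronglyMeasurable ?_
      have h1 := measurable_betaD n p q
      have h2 := measurable_truncPow μ
      have h3 := hf.measurable
      simp only [hΨ, Function.uncurry_def]
      fun_prop
    have hfn : Continuous fun y => ((‖f y‖ : ℝ) : ℂ) := by fun_prop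
    have hOn := isBigO_norm_ofReal hO
    have hint : Integrable (Function.uncurry Ψ)
        ((volume.restrict (Set.Ioo (0 : ℝ) 1)).prod volume) := by
      rw [integrable_prod_iff hmeas]
      refine ⟨ae_of_all _ fun t =>
        by simpa only [Function.uncurry_apply_pair, hΨ] using
          (integrable_comp_mul_truncPow hf hO hμ hσ hη X t).const_mul (betaD n p q t : ℂ), ?_⟩
      have hW : Continuous fun t => weylIntegral μ (fun y => ((‖f y‖ : ℝ) : ℂ)) (X - η * t) :=
        (continuous_weylIntegral hfn hOn hμ hσ).comp (by fun_prop)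
      refine ((hW.continuousOn.integrableOn_mul_betaD hp hq).norm.const_mul
        (η ^ (-μ) * Real.Gamma μ)).congr (ae_of_all _ fun t => ?_)
      have h := integral_comp_mul_truncPow hμ hη (fun y => ((‖f y‖ : ℝ) : ℂ)) X t
      have h' : ∫ s, ((‖f (X - η * s)‖ : ℝ) : ℂ) * (truncPow μ (t - s) : ℂ) =
          ((∫ s, ‖f (X - η * s) * (truncPow μ (t - s) : ℂ)‖ : ℝ) : ℂ) := by
        rw [← integral_complex_ofReal]
        refine integral_congr_ae (ae_of_all _ fun s => ?_)
        simp only [norm_mul, Complex.norm_real, Real.norm_of_nonneg (truncPow_nonneg _ _)]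
        push_cast; rfl
      have h2 := congrArg norm h
      rw [h', Complex.norm_real, Real.norm_of_nonneg (integral_nonneg fun s => norm_nonneg _),
        norm_mul, Complex.norm_real, Real.norm_of_nonneg (by positivity)] at h2
      simp only [hΨ, Function.uncurry_apply_pair, norm_mul (betaD n p q t : ℂ), integral_const_mul]
      rw [h2, norm_mul]
      ring
    have hsw := integral_integral_swap hint
    have e1 : ∀ t, ∫ s, Ψ t s = ((η ^ (-μ) * Real.Gamma μ : ℝ) : ℂ) *
        (weylIntegral μ f (X - η * t) * (betaD n p q t : ℂ)) := fun t => by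
      simp only [hΨ, integral_const_mul]
      rw [integral_comp_mul_truncPow hμ hη]
      ring
    have e2 : ∀ s, ∫ t in Set.Ioo (0 : ℝ) 1, Ψ t s =
        (Real.Gamma μ : ℂ) * (f (X - η * s) * (betaKernel μ n p q s : ℂ)) := fun s => by
      rw [mul_left_comm, ← Complex.ofReal_mul, ← betaKernel_eq_integral_truncPow hμ,
        ← integral_complex_ofReal, ← integral_const_mul]
      refine integral_congr_ae (ae_of_all _ fun t => ?_)
      simp only [hΨ]
      push_cast; ring
    have hGc : (Real.Gamma μ : ℂ) ≠ 0 := Complex.ofReal_ne_zero.2 hG.ne'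
    constructor
    · have h := hint.integral_prod_right
      simp only [Function.uncurry_apply_pair, e2] at h
      refine (h.const_mul (Real.Gamma μ : ℂ)⁻¹).congr (ae_of_all _ fun s => ?_)
      simp only
      rw [← mul_assoc, inv_mul_cancel₀ hGc, one_mul]
    · simp only [e1, e2, integral_const_mul] at hsw
      have h3 : η ^ μ * η ^ (-μ) = 1 := by rw [← Real.rpow_add hη, add_neg_cancel, Real.rpow_zero]
      have h4 : ((η ^ μ : ℝ) : ℂ) * ((η ^ (-μ) : ℝ) : ℂ) = 1 := by
        rw [← Complex.ofReal_mul, h3, Complex.ofReal_one]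
      rw [Complex.ofReal_mul] at hsw
      apply mul_left_cancel₀ hGc
      rw [mul_left_comm, ← hsw]
      linear_combination -((Real.Gamma μ : ℂ) *
        ∫ t in Set.Ioo (0 : ℝ) 1, weylIntegral μ f (X - η * t) * (betaD n p q t : ℂ)) * h4

theorem betaKernel_eq_outerKernel {n : ℕ} {a c ν y : ℝ} (ha : n < a) (hc : n < c - a)
    (hy : 1 < y) : betaKernel (n - ν) n a (c - a) ((1 - y) / 2) =
      (-1) ^ n * (beta a (c - a) / Real.Gamma (-ν)) * 2 ^ (ν + 1) * outerKernel a c ν y := by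
  rw [betaKernel_of_neg (b := ν + 1) ha hc (by ring) (by linarith), outerKernel,
    show 1 - (1 - y) / 2 = (1 + y) / 2 by ring, one_div_div, add_sub_cancel,
    show 1 - (ν + 1) = -ν by ring, Real.rpow_neg (by linarith), Real.div_rpow (by linarith) (by norm_num),
    inv_div]
  ring

theorem betaKernel_eq_innerKernel {n : ℕ} {a c ν y : ℝ} (hν : ν ≤ n) (hc : n < c - a)
    (hy : y ∈ Set.Ioo (-1 : ℝ) 1) : betaKernel (n - ν) n a (c - a) ((1 - y) / 2) =
      (-1) ^ n * (Real.Gamma (c - a) / Real.Gamma (c - a - ν)) * 2 ^ (-(c - 2 * ν - 2)) *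
        innerKernel a c ν y := by
  rw [betaKernel_of_mem_Ioo (b := ν + 1) hc (by linarith) (by ring)
      ⟨by linarith [hy.2], by linarith [hy.1]⟩, innerKernel,
    show 1 - (1 - y) / 2 = (1 + y) / 2 by ring, Real.div_rpow (by linarith [hy.2]) (by norm_num),
    Real.div_rpow (by linarith [hy.1]) (by norm_num),
    show c - a + 1 - (ν + 1) = c - a - ν by ring, show 1 - (ν + 1) = -ν by ring,
    show a + (c - a) - (ν + 1) = c - ν - 1 by ring, show a - (ν + 1) = a - ν - 1 by ring,
    show c - a - (ν + 1) = c - a - ν - 1 by ring,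
    show -(c - 2 * ν - 2) = -(a - ν - 1) + -(c - a - ν - 1) by ring,
    Real.rpow_add two_pos, Real.rpow_neg two_pos.le, Real.rpow_neg two_pos.le]
  ring

theorem integral_eq_half_integral_comp (F : ℝ → ℂ) :
    ∫ s, F s = 1 / 2 * ∫ y, F ((1 - y) / 2) := by
  have h := Measure.integral_comp_mul_left (fun s => F (1 / 2 + s)) (-(1 / 2) : ℝ)
  rw [integral_add_left_eq_self] at h
  have e : ∀ y : ℝ, F ((1 - y) / 2) = F (1 / 2 + -(1 / 2) * y) := fun y => by congr 1; ring
  simp only [e, h]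
  norm_num
  ring

section
variable {n : ℕ} {a c ν ε : ℝ} {f : ℝ → ℂ}

theorem approxDeriv_core (hf : Continuous f) (hO : f =O[atTop] fun t : ℝ => t ^ (-(n - ν + ε)))
    (hε : 0 < ε) (hν : ν ≤ n) (ha : n < a) (hc : n < c - a) (x : ℝ) {δ : ℝ} (hδ : 0 < δ) :
    IntegrableOn (fun y : ℝ => (innerKernel a c ν y : ℂ) * f (x + δ * y)) (Set.Ioo (-1) 1) ∧
    ∫ t in Set.Ioo (0 : ℝ) 1, weylIntegral (n - ν) f (x + δ - 2 * δ * t) *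
      (betaD n a (c - a) t : ℂ) =
      (((-1) ^ n * (beta a (c - a) * 2 ^ n * δ ^ n) : ℝ) : ℂ) * approxDeriv a c ν δ f x := by
  have hn : (0 : ℝ) ≤ n := n.cast_nonneg
  have hGca := Real.Gamma_pos_of_pos (by linarith : 0 < c - a)
  have hGa := Real.Gamma_pos_of_pos (by linarith : 0 < a)
  have hGc := Real.Gamma_pos_of_pos (by linarith : 0 < c)
  have hGi := Real.Gamma_pos_of_pos (by linarith : 0 < c - a - ν)
  obtain ⟨h1, h2⟩ := weylIntegral_betaD (n := n) (p := a) (q := c - a) (μ := n - ν) hf hO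
    (by linarith) (by linarith) (by linarith : 0 < 2 * δ) ha hc (x + δ)
  set κ : ℝ → ℂ := fun y => f (x + δ * y) * (betaKernel (n - ν) n a (c - a) ((1 - y) / 2) : ℂ)
    with hκ
  have hκe : κ = fun y => (fun s => f (x + δ - 2 * δ * s) * (betaKernel (n - ν) n a (c - a) s : ℂ))
      ((1 - y) / 2) := by
    ext y
    simp only [hκ]
    congr 2; ring
  have h3 : Integrable κ := by
    rw [hκe]
    have h := (h1.comp_add_left (1 / 2)).comp_mul_left' (R := -(1 / 2)) (by norm_num)
    refine h.congr (ae_of_all _ fun y => ?_)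
    simp only
    rw [show 1 / 2 + -(1 / 2) * y = (1 - y) / 2 by ring]
  rw [integral_eq_half_integral_comp, ← hκe] at h2
  set A : ℝ := (-1) ^ n * (beta a (c - a) / Real.Gamma (-ν)) * 2 ^ (ν + 1) with hA
  set C : ℝ := (-1) ^ n * (Real.Gamma (c - a) / Real.Gamma (c - a - ν)) * 2 ^ (-(c - 2 * ν - 2))
    with hC
  have hC0 : C ≠ 0 := by positivity
  have e1 : ∀ y ∈ Set.Ioi (1 : ℝ), κ y = (A : ℂ) * ((outerKernel a c ν y : ℂ) * f (x + δ * y)) :=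
    fun y hy => by
      simp only [hκ]
      rw [betaKernel_eq_outerKernel ha hc hy, Complex.ofReal_mul]
      ring
  have e2 : ∀ y ∈ Set.Ioo (-1 : ℝ) 1,
      κ y = (C : ℂ) * ((innerKernel a c ν y : ℂ) * f (x + δ * y)) := fun y hy => by
    simp only [hκ]
    rw [betaKernel_eq_innerKernel hν hc hy, Complex.ofReal_mul]
    ring
  have e3 : ∀ y ∈ Set.Iic (-1 : ℝ), κ y = 0 := fun y hy => by
    simp only [hκ]
    rw [betaKernel_of_one_le (by linarith [Set.mem_Iic.1 hy])]
    simp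
  have h4 : ∫ y, κ y = (C : ℂ) *
        (∫ y in Set.Ioo (-1 : ℝ) 1, (innerKernel a c ν y : ℂ) * f (x + δ * y)) +
      (A : ℂ) * ∫ y in Set.Ioi (1 : ℝ), (outerKernel a c ν y : ℂ) * f (x + δ * y) := by
    have hu : Set.Ioc (-1 : ℝ) 1 ∪ Set.Ioi 1 = Set.Ioi (-1) :=
      Set.Ioc_union_Ioi_eq_Ioi (by norm_num)
    rw [← intervalIntegral.integral_Iic_add_Ioi (b := (-1 : ℝ)) h3.integrableOn h3.integrableOn,
      setIntegral_congr_fun measurableSet_Iic e3, integral_zero, zero_add, ← hu,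
      setIntegral_union (Set.Ioc_disjoint_Ioi le_rfl) measurableSet_Ioi h3.integrableOn
        h3.integrableOn, integral_Ioc_eq_integral_Ioo, setIntegral_congr_fun measurableSet_Ioo e2,
      setIntegral_congr_fun measurableSet_Ioi e1, integral_const_mul, integral_const_mul]
  refine ⟨?_, ?_⟩
  · refine IntegrableOn.congr_fun (h3.integrableOn.const_mul (C : ℂ)⁻¹) (fun y hy => ?_)
      measurableSet_Ioo
    rw [e2 y hy, ← mul_assoc, inv_mul_cancel₀ (Complex.ofReal_ne_zero.2 hC0), one_mul]
  · rw [h2, h4, approxDeriv]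
    have hpow : (2 * δ) ^ ((n : ℝ) - ν) = 2 ^ n * 2 ^ (-ν) * (δ ^ n * (1 / δ ^ ν)) := by
      rw [Real.mul_rpow two_pos.le hδ.le, sub_eq_add_neg, Real.rpow_add two_pos, Real.rpow_add hδ,
        Real.rpow_natCast, Real.rpow_natCast, Real.rpow_neg hδ.le, one_div]
    have t1 : (2 : ℝ) ^ (-ν) * 2 ^ (ν + 1) = 2 := by
      rw [← Real.rpow_add two_pos]; simp
    have t2 : (2 : ℝ) ^ (-ν) * 2 ^ (-(c - 2 * ν - 2)) = 2 * (2 ^ (c - ν - 1))⁻¹ := by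
      rw [← Real.rpow_add two_pos, ← Real.rpow_neg two_pos.le,
        show -ν + -(c - 2 * ν - 2) = 1 + -(c - ν - 1) by ring, Real.rpow_add two_pos, Real.rpow_one]
    have r1 : (2 * δ) ^ ((n : ℝ) - ν) * (1 / 2) * A = (-1) ^ n * (beta a (c - a) * 2 ^ n * δ ^ n) *
        (1 / Real.Gamma (-ν) * (1 / δ ^ ν)) := by
      rw [hpow, hA]
      linear_combination (2 ^ n * (δ ^ n * (1 / δ ^ ν)) * (1 / 2) * (-1) ^ n *
        (beta a (c - a) / Real.Gamma (-ν))) * t1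
    have r2 : (2 * δ) ^ ((n : ℝ) - ν) * (1 / 2) * C = (-1) ^ n * (beta a (c - a) * 2 ^ n * δ ^ n) *
        (Real.Gamma c / (2 ^ (c - ν - 1) * Real.Gamma a * Real.Gamma (c - a - ν)) *
          (1 / δ ^ ν)) := by
      have hB : beta a (c - a) * (Real.Gamma c /
          (2 ^ (c - ν - 1) * Real.Gamma a * Real.Gamma (c - a - ν))) =
          (2 ^ (c - ν - 1))⁻¹ * (Real.Gamma (c - a) / Real.Gamma (c - a - ν)) := by
        rw [beta, add_sub_cancel]
        field_simp
      rw [hpow, hC]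
      linear_combination (2 ^ n * (δ ^ n * (1 / δ ^ ν)) * (1 / 2) * (-1) ^ n *
        (Real.Gamma (c - a) / Real.Gamma (c - a - ν))) * t2 -
        ((-1) ^ n * 2 ^ n * δ ^ n * (1 / δ ^ ν)) * hB
    have r1' := congrArg (fun r : ℝ => (r : ℂ)) r1
    have r2' := congrArg (fun r : ℝ => (r : ℂ)) r2
    simp only [Complex.ofReal_mul _ A, Complex.ofReal_mul _ C,
      Complex.ofReal_mul _ (1 / Real.Gamma (-ν) * (1 / δ ^ ν)),
      Complex.ofReal_mul _ (Real.Gamma c / (2 ^ (c - ν - 1) * Real.Gamma a *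
        Real.Gamma (c - a - ν)) * (1 / δ ^ ν)), Complex.ofReal_mul _ (1 / 2 : ℝ)] at r1' r2'
    have hh : ((1 / 2 : ℝ) : ℂ) = 1 / 2 := by norm_num
    rw [hh] at r1' r2'
    linear_combination (∫ y in Set.Ioi (1 : ℝ), (outerKernel a c ν y : ℂ) * f (x + δ * y)) * r1' +
      (∫ y in Set.Ioo (-1 : ℝ) 1, (innerKernel a c ν y : ℂ) * f (x + δ * y)) * r2'

end

theorem abs_hyp_le {p q b s : ℝ} (hb : 0 ≤ b) (hp : b < p) (hq : 0 < q) (hs : s < 0) :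
    |₂F₁ b q (p + q) (1 / (1 - s))| ≤ beta (p - b) q / beta p q := by
  have hs1 : 0 < 1 - s := by linarith
  have hB := beta_pos (by linarith : 0 < p) hq
  have h := integral_beta_mul_rpow (by linarith : 0 < p) hq b hs
  have hpw := Real.rpow_pos_of_pos hs1 (-b)
  have h2 : |∫ t in Set.Ioo (0 : ℝ) 1, betaD 0 p q t * (t - s) ^ (-b)| ≤
      ∫ t in Set.Ioo (0 : ℝ) 1, (1 - s) ^ (-b) * (t ^ (p - b - 1) * (1 - t) ^ (q - 1)) := by
    refine (abs_integral_le_integral_abs).trans ?_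
    refine integral_mono_of_nonneg (ae_of_all _ fun _ => abs_nonneg _)
      ((integrableOn_beta (by linarith) hq).const_mul _) ?_
    filter_upwards [ae_restrict_mem measurableSet_Ioo] with t ht
    have ht1 : 0 ≤ 1 - t := by linarith [ht.2]
    have e1 : (t - s) ^ (-b) ≤ (1 - s) ^ (-b) * t ^ (-b) := by
      rw [← Real.mul_rpow hs1.le ht.1.le]
      exact Real.rpow_le_rpow_of_nonpos (mul_pos hs1 ht.1) (by nlinarith [ht.2]) (by linarith)
    have e2 : 0 ≤ t ^ (p - 1) * (1 - t) ^ (q - 1) :=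
      mul_nonneg (Real.rpow_nonneg ht.1.le _) (Real.rpow_nonneg ht1 _)
    rw [betaD_zero, abs_of_nonneg (mul_nonneg e2 (Real.rpow_nonneg (by linarith [ht.1]) _))]
    refine (mul_le_mul_of_nonneg_left e1 e2).trans (le_of_eq ?_)
    rw [show p - b - 1 = (p - 1) + -b by ring, Real.rpow_add ht.1]
    ring
  rw [h, integral_const_mul, integral_beta (by linarith) hq, abs_mul, abs_mul, abs_of_pos hB,
    abs_of_pos hpw] at h2
  rw [le_div_iff₀ hB]
  refine le_of_mul_le_mul_left ?_ hpw
  linarith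

theorem integrableOn_outerKernel {a c ν : ℝ} {f : ℝ → ℂ} (hf : Continuous f) (hν : 0 < ν)
    (ha : ν + 1 < a) (hc : 0 < c - a) {σ : ℝ} (hσ : 0 ≤ σ)
    (hO : f =O[atTop] fun t : ℝ => t ^ (-σ)) (x : ℝ) {δ : ℝ} (hδ : 0 < δ) :
    IntegrableOn (fun y : ℝ => (outerKernel a c ν y : ℂ) * f (x + δ * y)) (Set.Ioi 1) := by
  obtain ⟨C, hC, hfC⟩ := exists_norm_le_one_add_sub_rpow hf hσ hO (x + δ)
  have hcont : ContinuousOn (outerKernel a c ν) (Set.Ioi 1) := by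
    refine ContinuousOn.mul ?_ ((continuousOn_hyp _ _ _).comp ?_ fun y hy => ?_)
    · refine continuousOn_const.div (ContinuousOn.rpow_const (by fun_prop) fun y hy => ?_)
        fun y hy => ?_
      · exact Or.inr (by linarith)
      · exact (Real.rpow_pos_of_pos (by linarith [Set.mem_Ioi.1 hy]) _).ne'
    · exact continuousOn_const.div (by fun_prop) fun y hy => by linarith [Set.mem_Ioi.1 hy]
    · have hy' := Set.mem_Ioi.1 hy
      exact ⟨by have : 0 < 2 / (1 + y) := by positivity
                linarith, by rw [div_lt_one (by linarith)]; linarith⟩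
  have hi := (integrableOn_Ioi_rpow_of_lt (by linarith : -(ν + 1) < -1) one_pos).const_mul
    (beta (a - (ν + 1)) (c - a) / beta a (c - a) * C)
  refine Integrable.mono' hi (ContinuousOn.aestronglyMeasurable ?_ measurableSet_Ioi) ?_
  · exact (Complex.continuous_ofReal.comp_continuousOn hcont).mul
      (Continuous.continuousOn (by fun_prop))
  · filter_upwards [ae_restrict_mem measurableSet_Ioi] with y hy
    have hy' := Set.mem_Ioi.1 hy
    have h1 := abs_hyp_le (s := (1 - y) / 2) (by linarith : 0 ≤ ν + 1) ha hc (by linarith)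
    rw [show 1 - (1 - y) / 2 = (1 + y) / 2 by ring, one_div_div, add_sub_cancel] at h1
    have hB := (beta_pos (by linarith : 0 < a - (ν + 1)) hc)
    have hB' := (beta_pos (by linarith : 0 < a) hc)
    have h2 : ‖f (x + δ * y)‖ ≤ C := (hfC _ (by nlinarith)).trans
      (mul_le_of_le_one_right hC
        (Real.rpow_le_one_of_one_le_of_nonpos (by nlinarith) (by linarith)))
    have h3 : 1 / (1 + y) ^ (ν + 1) ≤ y ^ (-(ν + 1)) := by
      rw [Real.rpow_neg (by linarith), ← one_div]
      exact one_div_le_one_div_of_le (Real.rpow_pos_of_pos (by linarith) _)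
        (Real.rpow_le_rpow (by linarith) (by linarith) (by linarith))
    have h4 : 0 ≤ 1 / (1 + y) ^ (ν + 1) := by
      have : 0 ≤ 1 + y := by linarith
      positivity
    rw [norm_mul, Complex.norm_real, Real.norm_eq_abs, outerKernel, abs_mul, abs_of_nonneg h4]
    calc _ ≤ y ^ (-(ν + 1)) * (beta (a - (ν + 1)) (c - a) / beta a (c - a)) * C := by gcongr
      _ = _ := by ring

section
variable {m : ℕ} {a c ν ε : ℝ} {f : ℝ → ℂ}

theorem continuous_weylDeriv (hf : ContDiff ℝ m f)
    (hO : f =O[atTop] fun t : ℝ => t ^ (-(m - ν + ε))) (hε : 0 < ε) (hν : ν < m) :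
    Continuous (weylDeriv m ν f) :=
  continuous_const.mul ((contDiff_weylIntegral m hf hO (by linarith)
    (by linarith)).continuous_iteratedDeriv' m)

theorem approxDeriv_eq_integral (hf : ContDiff ℝ m f)
    (hO : f =O[atTop] fun t : ℝ => t ^ (-(m - ν + ε))) (hε : 0 < ε) (hν : ν < m) (ha : m < a)
    (hc : m < c - a) (x : ℝ) {δ : ℝ} (hδ : 0 < δ) :
    approxDeriv a c ν δ f x = ((beta a (c - a) : ℝ) : ℂ)⁻¹ *
      ∫ t in Set.Ioo (0 : ℝ) 1, weylDeriv m ν f (x + δ - 2 * δ * t) *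
        (betaD 0 a (c - a) t : ℂ) := by
  have hm : (0 : ℝ) ≤ m := m.cast_nonneg
  have hB : (beta a (c - a) : ℂ) ≠ 0 :=
    Complex.ofReal_ne_zero.2 (beta_pos (by linarith) (by linarith)).ne'
  have hδc : (δ : ℂ) ≠ 0 := Complex.ofReal_ne_zero.2 hδ.ne'
  have hG := contDiff_weylIntegral m hf hO (by linarith : 0 < m - ν) (by linarith)
  have h := (approxDeriv_core hf.continuous hO hε hν.le ha hc x hδ).2
  set G := weylIntegral (m - ν) f with hGdef
  have hder : ∀ j < m, ∀ t : ℝ, HasDerivAt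
      (fun t : ℝ => (-2 * δ : ℂ) ^ j * iteratedDeriv j G (x + δ - 2 * δ * t))
      ((-2 * δ : ℂ) ^ (j + 1) * iteratedDeriv (j + 1) G (x + δ - 2 * δ * t)) t := fun j hj t => by
    have h1 : HasDerivAt (iteratedDeriv j G) (iteratedDeriv (j + 1) G (x + δ - 2 * δ * t))
        (x + δ - 2 * δ * t) := by
      rw [iteratedDeriv_succ]
      exact (hG.differentiable_iteratedDeriv j (by exact_mod_cast hj) _).hasDerivAt
    have h2 : HasDerivAt (fun t : ℝ => x + δ - 2 * δ * t) (-(2 * δ)) t := by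
      simpa using ((hasDerivAt_id t).const_mul (2 * δ)).const_sub (x + δ)
    refine ((h1.scomp t h2).const_mul ((-2 * δ : ℂ) ^ j)).congr_deriv ?_
    rw [Complex.real_smul]
    push_cast
    ring
  have hI := integral_mul_betaD ha hc
    (fun j t => (-2 * δ : ℂ) ^ j * iteratedDeriv j G (x + δ - 2 * δ * t))
    (fun j hj => (Continuous.continuousOn (continuous_const.mul
      ((hG.continuous_iteratedDeriv j (by exact_mod_cast hj)).comp (by fun_prop)))))
    (fun j hj t _ => hder j hj t)
  simp only [pow_zero, one_mul, iteratedDeriv_zero] at hI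
  rw [hI] at h
  have e : ∀ t : ℝ, weylDeriv m ν f (x + δ - 2 * δ * t) * (betaD 0 a (c - a) t : ℂ) =
      (-1) ^ m * ((-2 * δ : ℂ) ^ m)⁻¹ * ((-2 * δ : ℂ) ^ m *
        iteratedDeriv m G (x + δ - 2 * δ * t) * (betaD 0 a (c - a) t : ℂ)) := fun t => by
    rw [weylDeriv, ← hGdef]
    field_simp
  simp only [e, integral_const_mul]
  have hs : ((-1 : ℂ) ^ m) * (-1) ^ m = 1 := by rw [← mul_pow]; simp
  rw [mul_assoc ((-1 : ℂ) ^ m), mul_left_comm ((-1 : ℂ) ^ m), h]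
  have e2 : (-2 * (δ : ℂ)) ^ m = (-1) ^ m * (2 ^ m * δ ^ m) := by
    rw [← mul_pow, ← mul_pow]; ring
  rw [e2]
  push_cast
  field_simp

theorem tendsto_approxDeriv (hf : ContDiff ℝ m f)
    (hO : f =O[atTop] fun t : ℝ => t ^ (-(m - ν + ε))) (hε : 0 < ε) (hν : ν < m) (ha : m < a)
    (hc : m < c - a) (x : ℝ) :
    Tendsto (fun δ : ℝ => approxDeriv a c ν δ f x) (𝓝[>] 0) (𝓝 (weylDeriv m ν f x)) := by
  have hm : (0 : ℝ) ≤ m := m.cast_nonneg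
  have hBp := beta_pos (by linarith : 0 < a) (by linarith : 0 < c - a)
  have hB : (beta a (c - a) : ℂ) ≠ 0 := Complex.ofReal_ne_zero.2 hBp.ne'
  have hW := continuous_weylDeriv hf hO hε hν
  have hint : IntegrableOn (betaD 0 a (c - a)) (Set.Ioo 0 1) :=
    integrableOn_betaD (by push_cast; linarith) (by push_cast; linarith)
  obtain ⟨M, hM⟩ := (isCompact_Icc (a := x - 1) (b := x + 1)).exists_bound_of_continuousOn
    hW.continuousOn
  have hlim : Tendsto (fun δ : ℝ => ∫ t in Set.Ioo (0 : ℝ) 1,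
      weylDeriv m ν f (x + δ - 2 * δ * t) * (betaD 0 a (c - a) t : ℂ)) (𝓝[>] 0)
      (𝓝 (∫ t in Set.Ioo (0 : ℝ) 1, weylDeriv m ν f x * (betaD 0 a (c - a) t : ℂ))) := by
    refine tendsto_integral_filter_of_dominated_convergence
      (fun t => M * ‖betaD 0 a (c - a) t‖) ?_ ?_ (hint.norm.const_mul M) ?_
    · refine Eventually.of_forall fun δ => Measurable.aestronglyMeasurable ?_
      have := measurable_betaD 0 a (c - a)
      have h2 := hW.measurable
      fun_prop
    · filter_upwards [Ioo_mem_nhdsGT (zero_lt_one (α := ℝ))] with δ hδ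
      filter_upwards [ae_restrict_mem measurableSet_Ioo] with t ht
      rw [norm_mul, Complex.norm_real]
      refine mul_le_mul_of_nonneg_right (hM _ ⟨?_, ?_⟩) (norm_nonneg _)
      · nlinarith [ht.1, ht.2, hδ.1, hδ.2]
      · nlinarith [ht.1, ht.2, hδ.1, hδ.2]
    · refine ae_of_all _ fun t => Tendsto.mul_const _ ?_
      have h1 : Continuous fun δ : ℝ => weylDeriv m ν f (x + δ - 2 * δ * t) := by fun_prop
      have h2 := (h1.tendsto 0).mono_left (nhdsWithin_le_nhds (s := Set.Ioi 0))
      simpa using h2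
  have h := hlim.const_mul ((beta a (c - a) : ℝ) : ℂ)⁻¹
  rw [integral_const_mul, integral_complex_ofReal] at h
  simp only [betaD_zero] at h
  rw [integral_beta (by linarith) (by linarith), mul_left_comm, inv_mul_cancel₀ hB, mul_one] at h
  refine h.congr' ?_
  filter_upwards [self_mem_nhdsWithin] with δ hδ
  rw [approxDeriv_eq_integral hf hO hε hν ha hc x hδ]
  rfl

end

theorem weyl_derivative_formula {a c ν ε : ℝ} {n : ℕ} {f : ℝ → ℂ} (hν : 0 < ν)
    (hνa : ν < min a (c - a) - 1) (hνn : ν < n) (hε : 0 < ε) (hf : ContDiff ℝ n f)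
    (hO : f =O[atTop] (fun t : ℝ => t ^ (ν - n - ε))) :
    (∀ x : ℝ, IntegrableOn (fun y : ℝ => f y * (((y - x) ^ (n - ν - 1) : ℝ) : ℂ)) (Set.Ioi x)) ∧
    ContDiff ℝ n (weylIntegral (n - ν) f) ∧
    (∀ x δ : ℝ, 0 < δ →
      IntegrableOn (fun y : ℝ => (outerKernel a c ν y : ℂ) * f (x + δ * y)) (Set.Ioi 1) ∧
      IntegrableOn (fun y : ℝ => (innerKernel a c ν y : ℂ) * f (x + δ * y)) (Set.Ioo (-1) 1)) ∧
    (∀ x : ℝ, Tendsto (fun δ : ℝ => approxDeriv a c ν δ f x) (𝓝[>] 0)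
      (𝓝 (weylDeriv n ν f x))) := by
  have h1 := min_le_left a (c - a)
  have h2 := min_le_right a (c - a)
  obtain ⟨m, hm⟩ : ∃ m, m = ⌊ν⌋₊ + 1 := ⟨_, rfl⟩
  have hm1 : ν < m := by rw [hm]; push_cast; exact Nat.lt_floor_add_one ν
  have hm2 : (m : ℝ) ≤ ν + 1 := by rw [hm]; push_cast; linarith [Nat.floor_le hν.le]
  have hmn : m ≤ n := by
    rw [hm]
    exact Nat.succ_le_of_lt ((Nat.floor_lt hν.le).2 hνn)
  obtain ⟨k, rfl⟩ := Nat.exists_eq_add_of_le hmn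
  have hk : (0 : ℝ) ≤ k := k.cast_nonneg
  rw [show ν - ((m + k : ℕ) : ℝ) - ε = -((m + k : ℕ) - ν + ε) by ring] at hO
  have hO' : f =O[atTop] fun t : ℝ => t ^ (-(m - ν + ε)) :=
    isBigO_rpow_of_le hO (by push_cast; linarith)
  have hf' : ContDiff ℝ m f := hf.of_le (by exact_mod_cast Nat.le_add_right m k)
  obtain ⟨h3, h4⟩ := contDiff_weylIntegral_nat (by omega) hm1 hε k hf hO
  refine ⟨fun x => ?_, h3, fun x δ hδ => ⟨?_, ?_⟩, fun x => ?_⟩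
  · rw [integrableOn_Ioi_iff_add]
    simp only [add_sub_cancel_left]
    exact integrableOn_weyl hf.continuous hO (by push_cast at hνn ⊢; linarith) (by linarith) x
  · exact integrableOn_outerKernel hf.continuous hν (by linarith) (by linarith) (by linarith) hO'
      x hδ
  · exact (approxDeriv_core hf.continuous hO' hε hm1.le (by linarith) (by linarith) x hδ).1
  · rw [h4]
    exact tendsto_approxDeriv hf' hO' hε hm1 (by linarith) (by linarith) x

theorem succ_mul_choose_succ (r : ℝ) (i : ℕ) :
    (i + 1 : ℝ) * Ring.choose r (i + 1) = r * Ring.choose (r - 1) i := by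
  have h := Ring.choose_smul_choose r (Nat.le_add_left 1 i)
  rw [Nat.choose_one_right, Ring.choose_one_right, Nat.add_sub_cancel, nsmul_eq_mul] at h
  exact_mod_cast h

theorem choose_pos_of_lt {r : ℝ} {k : ℕ} (h : (k : ℝ) - 1 < r) : 0 < Ring.choose r k := by
  induction k generalizing r with
  | zero => rw [Ring.choose_zero_right]; exact one_pos
  | succ k ih =>
    push_cast at h
    have hk : (0 : ℝ) ≤ k := k.cast_nonneg
    have h1 := succ_mul_choose_succ r k
    have h2 : 0 < r * Ring.choose (r - 1) k := mul_pos (by linarith) (ih (by linarith))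
    rw [← h1] at h2
    exact pos_of_mul_pos_right h2 (by positivity)

/-- Leibniz's formula for the `n`-th derivative of the beta density. -/
theorem betaD_eq_sum_antidiagonal (n : ℕ) (p q t : ℝ) :
    betaD n p q t = n ! * ∑ ij ∈ Finset.HasAntidiagonal.antidiagonal n,
      Ring.choose (p - 1) ij.1 * Ring.choose (q - 1) ij.2 * (-1) ^ ij.2 *
        (t ^ (p - 1 - ij.1) * (1 - t) ^ (q - 1 - ij.2)) := by
  induction n generalizing p q with
  | zero => simp [betaD_zero]
  | succ n ih =>
    set T : ℕ × ℕ → ℝ := fun ij => Ring.choose (p - 1) ij.1 * Ring.choose (q - 1) ij.2 *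
      (-1) ^ ij.2 * (t ^ (p - 1 - ij.1) * (1 - t) ^ (q - 1 - ij.2)) with hT
    have h1 : (p - 1) * betaD n (p - 1) q t =
        n ! * ∑ ij ∈ Finset.HasAntidiagonal.antidiagonal (n + 1), (ij.1 : ℝ) * T ij := by
      rw [ih, Finset.Nat.sum_antidiagonal_succ, Nat.cast_zero, zero_mul, zero_add, mul_left_comm,
        Finset.mul_sum]
      congr 1
      refine Finset.sum_congr rfl fun ij _ => ?_
      simp only [hT]
      rw [show p - 1 - ((ij.1 + 1 : ℕ) : ℝ) = p - 1 - 1 - ij.1 by push_cast; ring]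
      push_cast
      linear_combination (-(Ring.choose (q - 1) ij.2 * (-1) ^ ij.2 *
        (t ^ (p - 1 - 1 - ij.1) * (1 - t) ^ (q - 1 - ij.2)))) * succ_mul_choose_succ (p - 1) ij.1
    have h2 : -((q - 1) * betaD n p (q - 1) t) =
        n ! * ∑ ij ∈ Finset.HasAntidiagonal.antidiagonal (n + 1), (ij.2 : ℝ) * T ij := by
      rw [ih, Finset.Nat.sum_antidiagonal_succ', Nat.cast_zero, zero_mul, zero_add, mul_left_comm,
        Finset.mul_sum, ← mul_neg, ← Finset.sum_neg_distrib]
      congr 1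
      refine Finset.sum_congr rfl fun ij _ => ?_
      simp only [hT]
      rw [show q - 1 - ((ij.2 + 1 : ℕ) : ℝ) = q - 1 - 1 - ij.2 by push_cast; ring, pow_succ]
      push_cast
      linear_combination (Ring.choose (p - 1) ij.1 * (-1) ^ ij.2 *
        (t ^ (p - 1 - ij.1) * (1 - t) ^ (q - 1 - 1 - ij.2))) * succ_mul_choose_succ (q - 1) ij.2
    have h3 : ∑ ij ∈ Finset.HasAntidiagonal.antidiagonal (n + 1),
        ((ij.1 : ℝ) * T ij + (ij.2 : ℝ) * T ij) =
        (n + 1 : ℕ) * ∑ ij ∈ Finset.HasAntidiagonal.antidiagonal (n + 1), T ij := by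
      rw [Finset.mul_sum]
      refine Finset.sum_congr rfl fun ij hij => ?_
      rw [← Finset.HasAntidiagonal.mem_antidiagonal.1 hij]
      push_cast
      ring
    rw [betaD_succ, sub_eq_add_neg, h1, h2, ← mul_add, ← Finset.sum_add_distrib, h3,
      Nat.factorial_succ, Nat.cast_mul]
    ring

/-- Rodrigues' formula for Jacobi polynomials. -/
theorem jacobiPoly_rodrigues (n : ℕ) (α β : ℝ) {t : ℝ} (ht : t ∈ Set.Ioo (0 : ℝ) 1) :
    betaD n (n + α + 1) (n + β + 1) t =
      n ! * ((jacobiPoly n α β).eval (1 - 2 * t) * (t ^ α * (1 - t) ^ β)) := by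
  have ht' := sub_pos.2 ht.2
  rw [betaD_eq_sum_antidiagonal, Finset.Nat.sum_antidiagonal_eq_sum_range_succ_mk,
    ← Finset.sum_range_reflect, jacobiPoly, Polynomial.eval_finsetSum, Finset.sum_mul]
  congr 1
  refine Finset.sum_congr rfl fun s hs => ?_
  have hs' : s ≤ n := Nat.lt_succ_iff.1 (Finset.mem_range.1 hs)
  have e1 : n + 1 - 1 - s = n - s := by omega
  have e2 : n - (n - s) = s := by omega
  simp only [e1, e2, Polynomial.eval_mul, Polynomial.eval_pow, Polynomial.eval_C,
    Polynomial.eval_sub, Polynomial.eval_add, Polynomial.eval_X, Polynomial.eval_one]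
  rw [show (n : ℝ) + α + 1 - 1 = n + α by ring, show (n : ℝ) + β + 1 - 1 = n + β by ring,
    show (n : ℝ) + α - ((n - s : ℕ) : ℝ) = α + s by rw [Nat.cast_sub hs']; ring,
    show (n : ℝ) + β - s = β + (n - s : ℕ) by rw [Nat.cast_sub hs']; ring,
    Real.rpow_add ht.1, Real.rpow_add ht', Real.rpow_natCast, Real.rpow_natCast,
    show 1 / 2 * (1 - 2 * t - 1) = -1 * t by ring, show 1 / 2 * (1 - 2 * t + 1) = 1 - t by ring,
    mul_pow]
  ring

theorem natDegree_jacobiPoly_le (n : ℕ) (α β : ℝ) : (jacobiPoly n α β).natDegree ≤ n := by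
  refine Polynomial.natDegree_sum_le_of_forall_le _ _ fun s hs => ?_
  have hs' : s ≤ n := Nat.lt_succ_iff.1 (Finset.mem_range.1 hs)
  have h1 : (Polynomial.C (1 / 2 : ℝ) * (Polynomial.X - 1)).natDegree ≤ 1 := by compute_degree
  have h2 : (Polynomial.C (1 / 2 : ℝ) * (Polynomial.X + 1)).natDegree ≤ 1 := by compute_degree
  have h3 := Polynomial.natDegree_pow_le_of_le s h1
  have h4 := Polynomial.natDegree_pow_le_of_le (n - s) h2
  refine (Polynomial.natDegree_mul_le_of_le
    (Polynomial.natDegree_mul_le_of_le (Polynomial.natDegree_C _).le h3) h4).trans ?_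
  omega

theorem coeff_jacobiPoly_pos (n : ℕ) {α β : ℝ} (hα : -1 < α) (hβ : -1 < β) :
    0 < (jacobiPoly n α β).coeff n := by
  rw [jacobiPoly, Polynomial.finsetSum_coeff]
  refine Finset.sum_pos (fun s hs => ?_) ⟨0, by simp⟩
  have hs' : s ≤ n := Nat.lt_succ_iff.1 (Finset.mem_range.1 hs)
  have hsr : (s : ℝ) ≤ n := by exact_mod_cast hs'
  have h1 : (Polynomial.C (1 / 2 : ℝ) * (Polynomial.X - 1)).natDegree ≤ 1 := by compute_degree
  have h2 : (Polynomial.C (1 / 2 : ℝ) * (Polynomial.X + 1)).natDegree ≤ 1 := by compute_degree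
  have h3 := Polynomial.natDegree_pow_le_of_le s h1
  have h4 := Polynomial.natDegree_pow_le_of_le (n - s) h2
  have c3 := Polynomial.coeff_pow_of_natDegree_le (m := s) h1
  have c4 := Polynomial.coeff_pow_of_natDegree_le (m := n - s) h2
  have c1 : (Polynomial.C (1 / 2 : ℝ) * (Polynomial.X - 1)).coeff 1 = 1 / 2 := by
    simp [Polynomial.coeff_one]
  have c2 : (Polynomial.C (1 / 2 : ℝ) * (Polynomial.X + 1)).coeff 1 = 1 / 2 := by
    simp [Polynomial.coeff_one]
  rw [mul_one] at h3 h4 c3 c4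
  have hc := Polynomial.coeff_mul_add_eq_of_natDegree_le h3 h4
  rw [Nat.add_sub_cancel' hs', c3, c4, c1, c2] at hc
  rw [mul_assoc, Polynomial.coeff_C_mul, hc]
  refine mul_pos (mul_pos (choose_pos_of_lt ?_) (choose_pos_of_lt ?_)) (by positivity)
  · rw [Nat.cast_sub hs']
    have : (0 : ℝ) ≤ s := s.cast_nonneg
    linarith
  · linarith

theorem eval_iterate_derivative_jacobiPoly (n : ℕ) (α β x : ℝ) :
    (Polynomial.derivative^[n] (jacobiPoly n α β)).eval x = n ! * (jacobiPoly n α β).coeff n := by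
  have h := Polynomial.natDegree_iterate_derivative (jacobiPoly n α β) n
  rw [Nat.sub_eq_zero_of_le (natDegree_jacobiPoly_le n α β)] at h
  rw [Polynomial.eq_C_of_natDegree_le_zero h, Polynomial.eval_C, Polynomial.coeff_iterate_derivative,
    zero_add, Nat.descFactorial_self, nsmul_eq_mul]

theorem integral_Ioo_eq_half_integral (g : ℝ → ℂ) :
    ∫ t in Set.Ioo (0 : ℝ) 1, g t = 1 / 2 * ∫ ξ in Set.Ioo (-1 : ℝ) 1, g ((1 - ξ) / 2) := by
  rw [← integral_indicator measurableSet_Ioo, integral_eq_half_integral_comp,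
    ← integral_indicator measurableSet_Ioo]
  congr 2
  ext ξ
  by_cases h : ξ ∈ Set.Ioo (-1 : ℝ) 1
  · rw [Set.indicator_of_mem h, Set.indicator_of_mem
      (show (1 - ξ) / 2 ∈ Set.Ioo (0 : ℝ) 1 from ⟨by linarith [h.2], by linarith [h.1]⟩)]
  · rw [Set.indicator_of_notMem h, Set.indicator_of_notMem fun h' : (1 - ξ) / 2 ∈ Set.Ioo (0 : ℝ) 1 =>
      h ⟨by linarith [h'.2], by linarith [h'.1]⟩]

theorem integrableOn_Ioo_comp_one_sub_div_two {g : ℝ → ℂ} (hg : IntegrableOn g (Set.Ioo 0 1)) :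
    IntegrableOn (fun ξ : ℝ => g ((1 - ξ) / 2)) (Set.Ioo (-1) 1) := by
  have h := ((hg.integrable_indicator measurableSet_Ioo).comp_add_left (1 / 2)).comp_mul_left'
    (R := -(1 / 2)) (by norm_num)
  refine h.integrableOn.congr_fun (fun ξ hξ => ?_) measurableSet_Ioo
  beta_reduce
  rw [show (1 / 2 + -(1 / 2) * ξ) = (1 - ξ) / 2 by ring,
    Set.indicator_of_mem
      (show (1 - ξ) / 2 ∈ Set.Ioo (0 : ℝ) 1 from ⟨by linarith [hξ.2], by linarith [hξ.1]⟩)]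

theorem measurable_jacobiDensity (α β : ℝ) :
    Measurable fun ξ : ℝ => ENNReal.ofReal ((1 - ξ) ^ α * (1 + ξ) ^ β) := by fun_prop

theorem toReal_jacobiDensity_smul {α β ξ : ℝ} (hξ : ξ ∈ Set.Ioo (-1 : ℝ) 1) (z : ℂ) :
    (ENNReal.ofReal ((1 - ξ) ^ α * (1 + ξ) ^ β)).toReal • z =
      z * (((1 - ξ) ^ α * (1 + ξ) ^ β : ℝ) : ℂ) := by
  rw [ENNReal.toReal_ofReal (mul_nonneg (Real.rpow_nonneg (by linarith [hξ.2]) _)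
    (Real.rpow_nonneg (by linarith [hξ.1]) _)), Complex.real_smul, mul_comm]

theorem integral_jacobiMeasure (α β : ℝ) (g : ℝ → ℂ) : ∫ ξ, g ξ ∂jacobiMeasure α β =
    ∫ ξ in Set.Ioo (-1 : ℝ) 1, g ξ * (((1 - ξ) ^ α * (1 + ξ) ^ β : ℝ) : ℂ) := by
  rw [jacobiMeasure, integral_withDensity_eq_integral_toReal_smul (measurable_jacobiDensity α β)
    (ae_of_all _ fun _ => ENNReal.ofReal_lt_top)]
  exact setIntegral_congr_fun measurableSet_Ioo fun ξ hξ => toReal_jacobiDensity_smul hξ _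

theorem integrable_jacobiMeasure {α β : ℝ} {g : ℝ → ℂ} (hg : IntegrableOn
    (fun ξ => g ξ * (((1 - ξ) ^ α * (1 + ξ) ^ β : ℝ) : ℂ)) (Set.Ioo (-1) 1)) :
    Integrable g (jacobiMeasure α β) := by
  rw [jacobiMeasure, integrable_withDensity_iff_integrable_smul' (measurable_jacobiDensity α β)
    (ae_of_all _ fun _ => ENNReal.ofReal_lt_top)]
  exact IntegrableOn.congr_fun hg (fun ξ hξ => (toReal_jacobiDensity_smul hξ _).symm)
    measurableSet_Ioo

theorem jacobiPoly_mul_weight (n : ℕ) {α β ξ : ℝ} (hξ : ξ ∈ Set.Ioo (-1 : ℝ) 1) :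
    (jacobiPoly n α β).eval ξ * ((1 - ξ) ^ α * (1 + ξ) ^ β) =
      2 ^ (α + β) / n ! * betaD n (n + α + 1) (n + β + 1) ((1 - ξ) / 2) := by
  rw [jacobiPoly_rodrigues n α β ⟨by linarith [hξ.2], by linarith [hξ.1]⟩,
    show 1 - 2 * ((1 - ξ) / 2) = ξ by ring, show 1 - (1 - ξ) / 2 = (1 + ξ) / 2 by ring,
    Real.div_rpow (by linarith [hξ.2]) two_pos.le, Real.div_rpow (by linarith [hξ.1]) two_pos.le,
    Real.rpow_add two_pos]
  have h1 := (Real.rpow_pos_of_pos (two_pos (α := ℝ)) α).ne'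
  have h2 := (Real.rpow_pos_of_pos (two_pos (α := ℝ)) β).ne'
  field_simp

section
variable {n : ℕ} {α β : ℝ}

theorem jacobiPoly_integral {g : ℝ → ℂ} (hg : Continuous g) (hα : -1 < α) (hβ : -1 < β) :
    Integrable (fun ξ => g ξ * (((jacobiPoly n α β).eval ξ : ℝ) : ℂ)) (jacobiMeasure α β) ∧
    ∫ ξ, g ξ * (((jacobiPoly n α β).eval ξ : ℝ) : ℂ) ∂jacobiMeasure α β =
      ((2 ^ (α + β + 1) / n ! : ℝ) : ℂ) * ∫ t in Set.Ioo (0 : ℝ) 1, g (1 - 2 * t) *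
        (betaD n (n + α + 1) (n + β + 1) t : ℂ) := by
  have hp : (n : ℝ) < n + α + 1 := by linarith
  have hq : (n : ℝ) < n + β + 1 := by linarith
  have e : ∀ ξ ∈ Set.Ioo (-1 : ℝ) 1, g ξ * (((jacobiPoly n α β).eval ξ : ℝ) : ℂ) *
      (((1 - ξ) ^ α * (1 + ξ) ^ β : ℝ) : ℂ) = ((2 ^ (α + β) / n ! : ℝ) : ℂ) *
        (g (1 - 2 * ((1 - ξ) / 2)) *
          (betaD n (n + α + 1) (n + β + 1) ((1 - ξ) / 2) : ℂ)) := fun ξ hξ => by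
    rw [mul_assoc, ← Complex.ofReal_mul, jacobiPoly_mul_weight n hξ, Complex.ofReal_mul,
      show 1 - 2 * ((1 - ξ) / 2) = ξ by ring]
    ring
  have hi : IntegrableOn (fun t => g (1 - 2 * t) * (betaD n (n + α + 1) (n + β + 1) t : ℂ))
      (Set.Ioo 0 1) :=
    (Continuous.continuousOn (by fun_prop)).integrableOn_mul_betaD hp hq
  constructor
  · exact integrable_jacobiMeasure (IntegrableOn.congr_fun
      ((integrableOn_Ioo_comp_one_sub_div_two hi).const_mul _) (fun ξ hξ => (e ξ hξ).symm)
      measurableSet_Ioo)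
  · rw [integral_jacobiMeasure, setIntegral_congr_fun measurableSet_Ioo e, integral_const_mul,
      integral_Ioo_eq_half_integral, Real.rpow_add_one two_ne_zero]
    push_cast
    ring

theorem integral_jacobiPoly_sq (hα : -1 < α) (hβ : -1 < β) :
    ∫ ξ, (jacobiPoly n α β).eval ξ ^ 2 ∂jacobiMeasure α β =
      2 ^ (α + β + 1) * 2 ^ n * (jacobiPoly n α β).coeff n *
        beta (n + α + 1) (n + β + 1) := by
  have hp : (n : ℝ) < n + α + 1 := by linarith
  have hq : (n : ℝ) < n + β + 1 := by linarith
  have hn : (0 : ℝ) ≤ n := n.cast_nonneg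
  set P := jacobiPoly n α β with hP
  have h1 := (jacobiPoly_integral (n := n) (g := fun ξ => ((P.eval ξ : ℝ) : ℂ))
    (by fun_prop) hα hβ).2
  have hd : ∀ j < n, ∀ t ∈ Set.Ioo (0 : ℝ) 1, HasDerivAt
      (fun t : ℝ => (((-2) ^ j * (Polynomial.derivative^[j] P).eval (1 - 2 * t) : ℝ) : ℂ))
      (((-2) ^ (j + 1) * (Polynomial.derivative^[j + 1] P).eval (1 - 2 * t) : ℝ) : ℂ) t :=
    fun j _ t _ => by
      refine HasDerivAt.ofReal_comp ?_
      have h2 : HasDerivAt (fun t : ℝ => 1 - 2 * t) (-2) t := by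
        simpa using ((hasDerivAt_id t).const_mul (2 : ℝ)).const_sub 1
      refine ((((Polynomial.derivative^[j] P).hasDerivAt (1 - 2 * t)).comp t h2).const_mul
        ((-2) ^ j)).congr_deriv ?_
      rw [Function.iterate_succ_apply', pow_succ]
      ring
  have h2 := integral_mul_betaD hp hq
    (fun j t => (((-2) ^ j * (Polynomial.derivative^[j] P).eval (1 - 2 * t) : ℝ) : ℂ))
    (fun j _ => Continuous.continuousOn (by fun_prop)) hd
  simp only [pow_zero, one_mul, Function.iterate_zero, id, hP,
    eval_iterate_derivative_jacobiPoly, integral_const_mul, betaD_zero] at h2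
  rw [hP, h2, integral_complex_ofReal, integral_beta (by linarith) (by linarith)] at h1
  simp only [← Complex.ofReal_mul, integral_complex_ofReal] at h1
  have h3 : ∫ ξ, P.eval ξ * P.eval ξ ∂jacobiMeasure α β = 2 ^ (α + β + 1) / n ! *
      ((-1) ^ n * ((-2) ^ n * (n ! * P.coeff n) * beta (n + α + 1) (n + β + 1))) := by
    exact_mod_cast h1
  simp only [pow_two]
  rw [h3]
  have h4 : ((-1 : ℝ) ^ n) * (-2) ^ n = 2 ^ n := by rw [← mul_pow]; norm_num
  have : (n ! : ℝ) ≠ 0 := by positivity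
  rw [← h4]
  field_simp

theorem jacobiFracDeriv_eq (hα : -1 < α) (hβ : -1 < β) {ν δ : ℝ} {f : ℝ → ℂ}
    (hW : Continuous (weylIntegral (n - ν) f)) (x : ℝ) :
    jacobiFracDeriv n α β ν δ f x =
      (((-1) ^ n * (1 / (beta (n + α + 1) (n + β + 1) * 2 ^ n * δ ^ n)) : ℝ) : ℂ) *
      ∫ t in Set.Ioo (0 : ℝ) 1, weylIntegral (n - ν) f (x + δ - 2 * δ * t) *
        (betaD n (n + α + 1) (n + β + 1) t : ℂ) := by
  have hn0 : (0 : ℝ) ≤ n := n.cast_nonneg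
  have hB := (beta_pos (by linarith : 0 < n + α + 1) (by linarith : 0 < n + β + 1)).ne'
  have hk := (coeff_jacobiPoly_pos n hα hβ).ne'
  have h2 := (Real.rpow_pos_of_pos (two_pos (α := ℝ)) (α + β + 1)).ne'
  have hf : (n ! : ℝ) ≠ 0 := by positivity
  rw [jacobiFracDeriv, orthogonalDeriv, integral_jacobiPoly_sq hα hβ,
    (jacobiPoly_integral (n := n) (g := fun ξ => weylIntegral (n - ν) f (x + δ * ξ))
      (by fun_prop) hα hβ).2, ← mul_assoc, ← mul_assoc]
  congr 1
  · have : (-1 : ℂ) ^ n = (((-1) ^ n : ℝ) : ℂ) := by push_cast; rfl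
    rw [this, ← Complex.ofReal_mul, ← Complex.ofReal_mul]
    congr 1
    field_simp
  · congr 1
    ext t
    congr 2
    ring_nf

end

theorem jacobi_derivative_formula {n : ℕ} {α β ν ε : ℝ} {f : ℝ → ℂ} (hα : -1 < α)
    (hβ : -1 < β) (hν : 0 < ν) (hνn : ν ≤ n) (hνm : ν < n + min α β) (hε : 0 < ε)
    (hf : Continuous f) (hO : f =O[atTop] (fun t : ℝ => t ^ (ν - n - ε))) (x : ℝ) {δ : ℝ}
    (hδ : 0 < δ) :
    Integrable (fun ξ : ℝ => weylIntegral (n - ν) f (x + δ * ξ) *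
      (((jacobiPoly n α β).eval ξ : ℝ) : ℂ)) (jacobiMeasure α β) ∧
    IntegrableOn (fun y : ℝ => (outerKernel (n + α + 1) (2 * n + α + β + 2) ν y : ℂ) *
      f (x + δ * y)) (Set.Ioi 1) ∧
    IntegrableOn (fun y : ℝ => (innerKernel (n + α + 1) (2 * n + α + β + 2) ν y : ℂ) *
      f (x + δ * y)) (Set.Ioo (-1) 1) ∧
    approxDeriv (n + α + 1) (2 * n + α + β + 2) ν δ f x = jacobiFracDeriv n α β ν δ f x := by
  have h1 := min_le_left α β
  have h2 := min_le_right α β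
  have hn0 : (0 : ℝ) ≤ n := n.cast_nonneg
  have hca : 2 * n + α + β + 2 - (n + α + 1) = n + β + 1 := by ring
  rw [show ν - (n : ℝ) - ε = -(n - ν + ε) by ring] at hO
  have hW : Continuous (weylIntegral (n - ν) f) := by
    rcases hνn.eq_or_lt with h | h
    · rw [h, sub_self]
      have h0 : weylIntegral 0 f = f := funext fun x => if_pos rfl
      rwa [h0]
    · exact continuous_weylIntegral hf hO (by linarith) (by linarith)
  obtain ⟨c1, c2⟩ := approxDeriv_core (a := n + α + 1) (c := 2 * n + α + β + 2) hf hO hε hνn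
    (by linarith) (by linarith) x hδ
  refine ⟨(jacobiPoly_integral (g := fun ξ => weylIntegral (n - ν) f (x + δ * ξ))
    (by fun_prop) hα hβ).1, ?_, c1, ?_⟩
  · exact integrableOn_outerKernel hf hν (by linarith) (by linarith) (by linarith) hO x hδ
  · have hB := (beta_pos (by linarith : 0 < n + α + 1) (by linarith : 0 < n + β + 1)).ne'
    rw [hca] at c2
    rw [jacobiFracDeriv_eq hα hβ hW, c2, ← mul_assoc, ← Complex.ofReal_mul]
    have hs : ((-1 : ℝ) ^ n) * (-1) ^ n = 1 := by rw [← mul_pow]; simp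
    have : (-1) ^ n * (1 / (beta (n + α + 1) (n + β + 1) * 2 ^ n * δ ^ n)) *
        ((-1) ^ n * (beta (n + α + 1) (n + β + 1) * 2 ^ n * δ ^ n)) = 1 := by
      rw [mul_mul_mul_comm, hs, one_mul, one_div_mul_cancel (by positivity)]
    rw [this, Complex.ofReal_one, one_mul]

theorem mainTheorem4 :
    -- the inverse Fourier transform
    (∀ a b c : ℝ, 0 < b → b < min a (c - a) →
      Integrable (fun ω : ℝ => kummerTransfer a b c ω) ∧
      (∀ y : ℝ, 1 < y → inverseFourier (kummerTransfer a b c) y = 0) ∧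
      (∀ y : ℝ, 0 < y → y < 1 → inverseFourier (kummerTransfer a b c) y =
        ((√(2 * Real.pi) * (Real.Gamma c / (Real.Gamma a * Real.Gamma (1 - a - b + c))) *
          y ^ (a - b) * (1 - y) ^ (c - a - b) *
          ₂F₁ (1 - b) (c - b) (c + 1 - a - b) (1 - y) : ℝ) : ℂ)) ∧
      (∀ y : ℝ, y < 0 → inverseFourier (kummerTransfer a b c) y =
        ((√(2 * Real.pi) / Real.Gamma (1 - b) * (1 / (1 - y) ^ b) *
          ₂F₁ b (c - a) c (1 / (1 - y)) : ℝ) : ℂ))) ∧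
    -- the formula for the fractional derivative
    (∀ (a c ν ε : ℝ) (n : ℕ) (f : ℝ → ℂ), 0 < ν → ν < min a (c - a) - 1 → ν < n → 0 < ε →
      ContDiff ℝ n f → f =O[atTop] (fun t : ℝ => t ^ (ν - n - ε)) →
      (∀ x : ℝ, IntegrableOn (fun y : ℝ => f y * (((y - x) ^ (n - ν - 1) : ℝ) : ℂ)) (Set.Ioi x)) ∧
      ContDiff ℝ n (weylIntegral (n - ν) f) ∧
      (∀ x δ : ℝ, 0 < δ →
        IntegrableOn (fun y : ℝ => (outerKernel a c ν y : ℂ) * f (x + δ * y)) (Set.Ioi 1) ∧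
        IntegrableOn (fun y : ℝ => (innerKernel a c ν y : ℂ) * f (x + δ * y)) (Set.Ioo (-1) 1)) ∧
      (∀ x : ℝ, Tendsto (fun δ : ℝ => approxDeriv a c ν δ f x) (𝓝[>] 0)
        (𝓝 (weylDeriv n ν f x)))) ∧
    -- the specialization to the approximate fractional Jacobi derivative
    (∀ (n : ℕ) (α β ν ε : ℝ) (f : ℝ → ℂ), 0 < n → -1 < α → -1 < β →
      0 < ν → ν ≤ n → ν < n + min α β → 0 < ε →
      Continuous f → f =O[atTop] (fun t : ℝ => t ^ (ν - n - ε)) →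
      ∀ x δ : ℝ, 0 < δ →
        Integrable (fun ξ : ℝ => weylIntegral (n - ν) f (x + δ * ξ) *
          (((jacobiPoly n α β).eval ξ : ℝ) : ℂ)) (jacobiMeasure α β) ∧
        IntegrableOn (fun y : ℝ => ((1 / (y + 1) ^ (ν + 1) *
          ₂F₁ (ν + 1) (n + β + 1) (2 * n + α + β + 2) (2 / (y + 1)) : ℝ) : ℂ) *
            f (x + δ * y)) (Set.Ioi 1) ∧
        IntegrableOn (fun y : ℝ => (((1 - y) ^ (n + α - ν) * (1 + y) ^ (n + β - ν) *
          ₂F₁ (-ν) (2 * n - ν + α + β + 1) (n - ν + β + 1) ((1 + y) / 2) : ℝ) : ℂ) *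
            f (x + δ * y)) (Set.Ioo (-1) 1) ∧
        approxDeriv (n + α + 1) (2 * n + α + β + 2) ν δ f x = jacobiFracDeriv n α β ν δ f x ∧
        jacobiFracDeriv n α β ν δ f x =
          ((1 / Real.Gamma (-ν) * (1 / δ ^ ν) : ℝ) : ℂ) *
            (∫ y in Set.Ioi (1 : ℝ), ((1 / (y + 1) ^ (ν + 1) *
              ₂F₁ (ν + 1) (n + β + 1) (2 * n + α + β + 2) (2 / (y + 1)) : ℝ) : ℂ) *
                f (x + δ * y)) +
          ((Real.Gamma (2 * n + α + β + 2) /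
            (2 ^ (2 * n - ν + α + β + 1) * Real.Gamma (n + α + 1) *
              Real.Gamma (n - ν + β + 1)) * (1 / δ ^ ν) : ℝ) : ℂ) *
            ∫ y in Set.Ioo (-1 : ℝ) 1, (((1 - y) ^ (n + α - ν) * (1 + y) ^ (n + β - ν) *
              ₂F₁ (-ν) (2 * n - ν + α + β + 1) (n - ν + β + 1) ((1 + y) / 2) : ℝ) : ℂ) *
                f (x + δ * y)) := by
  refine ⟨fun a b c hb hba => ⟨integrable_kummerTransfer hb hba, inverse_fourier_formula hb hba⟩,
    fun a c ν ε n f hν hνa hνn hε hf hO => weyl_derivative_formula hν hνa hνn hε hf hO,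
    fun n α β ν ε f _ hα hβ hν hνn hνm hε hf hO x δ hδ => ?_⟩
  obtain ⟨h1, h2, h3, h4⟩ := jacobi_derivative_formula hα hβ hν hνn hνm hε hf hO x hδ
  have e1 : ∀ y : ℝ, outerKernel (n + α + 1) (2 * n + α + β + 2) ν y = 1 / (y + 1) ^ (ν + 1) *
      ₂F₁ (ν + 1) (n + β + 1) (2 * n + α + β + 2) (2 / (y + 1)) := fun y => by
    rw [outerKernel, add_comm 1 y, show 2 * n + α + β + 2 - (n + α + 1) = n + β + 1 by ring]
  have e2 : ∀ y : ℝ, innerKernel (n + α + 1) (2 * n + α + β + 2) ν y =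
      (1 - y) ^ (n + α - ν) * (1 + y) ^ (n + β - ν) *
        ₂F₁ (-ν) (2 * n - ν + α + β + 1) (n - ν + β + 1) ((1 + y) / 2) := fun y => by
    rw [innerKernel, show n + α + 1 - ν - 1 = n + α - ν by ring,
      show 2 * n + α + β + 2 - (n + α + 1) - ν - 1 = n + β - ν by ring,
      show 2 * n + α + β + 2 - ν - 1 = 2 * n - ν + α + β + 1 by ring,
      show 2 * n + α + β + 2 - (n + α + 1) - ν = n - ν + β + 1 by ring]
  have h5 := h4
  rw [approxDeriv, show 2 * n + α + β + 2 - ν - 1 = 2 * n - ν + α + β + 1 by ring,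
    show 2 * n + α + β + 2 - (n + α + 1) - ν = n - ν + β + 1 by ring] at h5
  simp only [e1, e2] at h2 h3 h5
  exact ⟨h1, h2, h3, h4, h5.symm⟩
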